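/- Let $p\ge 0$, $0<\lambda\le\infty$, and let $(N_q,g_{N_q})$, $q=1,\dots,p$, be non-empty compact smooth Riemannian manifolds without boundary, of dimensions $m_q\ge 0$. Put $N=\prod_q N_q$, $m=\sum_q m_q$, and let $M=[0,\lambda)\times N$ (with the product topology) carry the multiply warped product metric $$g=dr^2+\sum_{q=1}^p s_q(r)^2 g_{N_q},$$ where $s_q:[0,\lambda)\to[0,\infty)$ are continuous and $A(r):=\prod_q s_q(r)^{m_q}$ is positive for $r>0$ ($A(0)=0$ is allowed). Let $B_R=\{(r,\theta)\in M: r<R\}$. Let $dv_g$ be the $(m+1)$-dimensional volume measure of $(M,g)$ and $dS$ the $m$-dimensional area measure on a hypersurface; $\partial$ denotes the topological boundary in $M$. Let $\Omega\subset M$ be an open set which is bounded, i.e. $\Omega\subset[0,R_0]\times N$ for some $R_0<\lambda$, and has Lipschitz boundary: near each boundary point with $A(r)\neq0$, $\Omega$ is, in suitable smooth coordinates, one side of the graph of a Lipschitz function, $\partial\Omega$ being the graph (no condition is imposed at boundary points with $r=0$ if $A(0)=0$). Assume that the projection $\partial\Omega\to N$, $(r,\theta)\mapsto\theta$, is surjective.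 **(1)** Let $c:[0,\lambda)\to(0,\infty)$ be measurable, and such that, with $\mathrm{Vol}_c(U):=\int_U c(r)\,dv_g$, the function $\widetilde V(r):=\mathrm{Vol}_c(B_r)$ is finite for all $r\in[0,\lambda)$. Let $a:[0,\lambda)\to(0,\infty)$ be continuous, such that $\psi:=aA$ is non-decreasing and $\psi\circ\widetilde V^{-1}$ is convex on $\widetilde V([0,\lambda))$. Then there is exactly one $R\in[0,\lambda)$ with $\mathrm{Vol}_c(B_R)=\mathrm{Vol}_c(\Omega)$, and for $\widetilde\Omega^\#:=B_R$, $$\int_{\partial\Omega}a(r)\,dS\ \ge\ \int_{\partial\widetilde\Omega^\#}a(r)\,dS .$$ Equality holds if $\partial\Omega$ is a coordinate slice $\{r=r_0\}$. Conversely, suppose that every $N_q$ is connected and that, in case $\partial\Omega$ meets $\{r=0\}$, there are points of $M\setminus\overline\Omega$ with $r<\varepsilon$ for every $\varepsilon>0$. Then equality holds only if $\partial\Omega$ is a coordinate slice. **(2)** In particular, the classical isoperimetric inequality need not be assumed: if every $s_q$ is positive, non-decreasing and log-convex on $[0,\lambda)$ (for $p=1$: if $s$ is), then there is exactly one $R\in[0,\lambda)$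 such that $\Omega^\#:=B_R$ has the same volume as $\Omega$, and $|\partial\Omega|\ge|\partial\Omega^\#|$. -/

import Mathlib

open Set MeasureTheory Topology
open scoped Manifold ContDiff NNReal ENNReal

noncomputable section

/-- The interval `[0, lam)`, where `0 < lam ≤ ∞`. -/
def radialInterval (lam : EReal) : Set ℝ := {r | 0 ≤ r ∧ (r : EReal) < lam}

/-- The product manifold `M = [0, lam) × ∏ q, N q`, with the product topology. -/
abbrev WarpedSpace {p : ℕ} (lam : EReal) (N : Fin p → Type*) : Type _ :=
  radialInterval lam × (∀ q, N q)

/-- A smooth Riemannian metric on an `m`-dimensional manifold. -/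
abbrev SmoothMetric (m : ℕ) (N : Type*) [TopologicalSpace N]
    [ChartedSpace (EuclideanSpace ℝ (Fin m)) N] [IsManifold (𝓡 m) ∞ N] : Type _ :=
  Bundle.ContMDiffRiemannianMetric (𝓡 m) ∞ (EuclideanSpace ℝ (Fin m))
    (fun x : N => TangentSpace (𝓡 m) x)

section Warped

variable {p : ℕ} {m : Fin p → ℕ} {lam : EReal} {N : Fin p → Type*}
  [∀ q, TopologicalSpace (N q)]

/-- `A(r) = ∏ q, s_q(r) ^ m_q`. -/
def areaFactor (m : Fin p → ℕ) (s : Fin p → ℝ → ℝ) (r : ℝ) : ℝ := ∏ q, s q r ^ m q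

/-- `B_R = {(r, θ) ∈ M : r < R}`. -/
def warpedBall (lam : EReal) (N : Fin p → Type*) (R : ℝ) : Set (WarpedSpace lam N) :=
  {x | (x.1 : ℝ) < R}

/-- The coordinate slice `{r = R}`. -/
def slice (lam : EReal) (N : Fin p → Type*) (R : ℝ) : Set (WarpedSpace lam N) :=
  {x | (x.1 : ℝ) = R}

/-- A bounded subset of `M`: it lies in `[0, R] × N` for some `R < lam`. -/
def IsBoundedInM (Ω : Set (WarpedSpace lam N)) : Prop :=
  ∃ R ∈ radialInterval lam, ∀ x ∈ Ω, (x.1 : ℝ) ≤ R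

variable [∀ q, ChartedSpace (EuclideanSpace ℝ (Fin (m q))) (N q)]

/-- The local coordinates `(r, φ_1(θ_1), …, φ_p(θ_p))` around the point `x`, where `φ_q` is the
chart of `N q` around the component `x.2 q`. -/
def warpedCoord (m : Fin p → ℕ) [∀ q, ChartedSpace (EuclideanSpace ℝ (Fin (m q))) (N q)]
    (x y : WarpedSpace lam N) : ℝ × (∀ q, EuclideanSpace ℝ (Fin (m q))) :=
  ((y.1 : ℝ), fun q => extChartAt (𝓡 (m q)) (x.2 q) (y.2 q))

/-- `Ω` has Lipschitz boundary at its boundary point `x`: near `x`, in suitable coordinates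
`(z, t) ∈ ℝ^m × ℝ` obtained from the local coordinates around `x` by a linear change of variables,
`Ω` is `{t < f z}` and `∂Ω` is `{t = f z}` with `f` Lipschitz. -/
def IsLipschitzBoundaryAt (m : Fin p → ℕ)
    [∀ q, ChartedSpace (EuclideanSpace ℝ (Fin (m q))) (N q)]
    (Ω : Set (WarpedSpace lam N)) (x : WarpedSpace lam N) : Prop :=
  ∃ (T : (ℝ × (∀ q, EuclideanSpace ℝ (Fin (m q)))) ≃L[ℝ]
        (EuclideanSpace ℝ (Fin (∑ q, m q)) × ℝ))
    (f : EuclideanSpace ℝ (Fin (∑ q, m q)) → ℝ) (L : ℝ≥0), LipschitzWith L f ∧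
    ∀ᶠ y in 𝓝 x,
      (y ∈ Ω ↔ (T (warpedCoord m x y)).2 < f (T (warpedCoord m x y)).1) ∧
      (y ∈ frontier Ω ↔ (T (warpedCoord m x y)).2 = f (T (warpedCoord m x y)).1)

/-- `Ω` has Lipschitz boundary. Nothing is required at boundary points where the metric
degenerates (only possible on `{r = 0}`, when `A(0) = 0`). -/
def HasLipschitzBoundary (m : Fin p → ℕ)
    [∀ q, ChartedSpace (EuclideanSpace ℝ (Fin (m q))) (N q)]
    (s : Fin p → ℝ → ℝ) (Ω : Set (WarpedSpace lam N)) : Prop :=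
  ∀ x ∈ frontier Ω, areaFactor m s x.1 ≠ 0 → IsLipschitzBoundaryAt m Ω x

/-- `F : K → S`, with `K ⊆ ℝ^k` measurable, is a parametrized `k`-dimensional piece of `S ⊆ M`:
it is injective and differentiable within `K`. -/
structure IsPatch (m : Fin p → ℕ) [∀ q, ChartedSpace (EuclideanSpace ℝ (Fin (m q))) (N q)]
    {k : ℕ} (S : Set (WarpedSpace lam N)) (K : Set (EuclideanSpace ℝ (Fin k)))
    (F : EuclideanSpace ℝ (Fin k) → WarpedSpace lam N) : Prop where
  measurableSet : MeasurableSet K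
  injOn : InjOn F K
  mapsTo : MapsTo F K S
  differentiable_radial : DifferentiableOn ℝ (fun z => ((F z).1 : ℝ)) K
  differentiable_base : ∀ q, MDifferentiableOn (𝓡 k) (𝓡 (m q)) (fun z => (F z).2 q) K

variable [∀ q, IsManifold (𝓡 (m q)) ∞ (N q)]

/-- The Gram matrix `g(∂_i F, ∂_j F)` of a patch for the multiply warped product metric
`g = dr² + ∑ q, s_q(r)² g_q`. -/
def patchGram (s : Fin p → ℝ → ℝ) (g : ∀ q, SmoothMetric (m q) (N q)) {k : ℕ}
    (K : Set (EuclideanSpace ℝ (Fin k))) (F : EuclideanSpace ℝ (Fin k) → WarpedSpace lam N)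
    (z : EuclideanSpace ℝ (Fin k)) : Matrix (Fin k) (Fin k) ℝ :=
  Matrix.of fun i j =>
    fderivWithin ℝ (fun z => ((F z).1 : ℝ)) K z (EuclideanSpace.single i 1) *
      fderivWithin ℝ (fun z => ((F z).1 : ℝ)) K z (EuclideanSpace.single j 1) +
    ∑ q, s q (F z).1 ^ 2 *
      (g q).inner ((F z).2 q)
        (mfderivWithin (𝓡 k) (𝓡 (m q)) (fun z => (F z).2 q) K z
          (EuclideanSpace.single i (1 : ℝ) : EuclideanSpace ℝ (Fin k)))
        (mfderivWithin (𝓡 k) (𝓡 (m q)) (fun z => (F z).2 q) K z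
          (EuclideanSpace.single j (1 : ℝ) : EuclideanSpace ℝ (Fin k)))

variable [∀ q, MeasurableSpace (N q)]

/-- The area measure of a patch: the image under `F` of `√(det g(∂_i F, ∂_j F)) dz` on `K`. -/
def patchMeasure (s : Fin p → ℝ → ℝ) (g : ∀ q, SmoothMetric (m q) (N q)) {k : ℕ}
    (K : Set (EuclideanSpace ℝ (Fin k))) (F : EuclideanSpace ℝ (Fin k) → WarpedSpace lam N) :
    Measure (WarpedSpace lam N) :=
  ((volume.restrict K).withDensity
    fun z => ENNReal.ofReal (Real.sqrt (patchGram s g K F z).det)).map F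

/-- The `k`-dimensional Riemannian area measure on `S ⊆ M` for the metric
`g = dr² + ∑ q, s_q(r)² g_q`: the least measure that dominates the area measure of every
`k`-dimensional patch in `S`. (By the area formula the area measures of two patches agree on the
common part of their images.) -/
def riemannianMeasure (s : Fin p → ℝ → ℝ) (g : ∀ q, SmoothMetric (m q) (N q)) (k : ℕ)
    (S : Set (WarpedSpace lam N)) : Measure (WarpedSpace lam N) :=
  ⨆ (K : Set (EuclideanSpace ℝ (Fin k)))
    (F : EuclideanSpace ℝ (Fin k) → WarpedSpace lam N) (_ : IsPatch m S K F),
    patchMeasure s g K F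

/-- `Vol_c(Ω) = ∫_Ω c(r) dv_g`, with `dv_g` the `(m+1)`-dimensional measure of `(M, g)`. -/
def weightedVolume (s : Fin p → ℝ → ℝ) (g : ∀ q, SmoothMetric (m q) (N q)) (c : ℝ → ℝ)
    (Ω : Set (WarpedSpace lam N)) : ℝ≥0∞ :=
  ∫⁻ x in Ω, ENNReal.ofReal (c x.1) ∂riemannianMeasure s g ((∑ q, m q) + 1) univ

/-- `∫_{∂Ω} a(r) dS`, with `dS` the `m`-dimensional area measure on the boundary `∂Ω` of `Ω`
in `M`. -/
def weightedArea (s : Fin p → ℝ → ℝ) (g : ∀ q, SmoothMetric (m q) (N q)) (a : ℝ → ℝ)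
    (Ω : Set (WarpedSpace lam N)) : ℝ≥0∞ :=
  ∫⁻ x, ENNReal.ofReal (a x.1) ∂riemannianMeasure s g (∑ q, m q) (frontier Ω)

/-- `Ṽ(r) = Vol_c(B_r)` as a real number. -/
def ballVolume (lam : EReal) (s : Fin p → ℝ → ℝ) (g : ∀ q, SmoothMetric (m q) (N q))
    (c : ℝ → ℝ) (r : ℝ) : ℝ :=
  (weightedVolume s g c (warpedBall lam N r)).toReal

end Warped

end

/-!
The boundary of `Ω` is compared with the part of it that is seen from large `r`. Let `ν` be the
Riemannian measure of the base `N = ∏ q, N q` and `u θ` the largest `r` with `(r, θ) ∈ ∂Ω`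
(`exists_top_function`); `Ω` lies below the graph of `u`.

*Volume.* The volume measure of `M` is the product of `A(r) dr` and `ν` (`riemannianMeasure_univ`).
Hence `Vol_c(B_r) = W(r) ν(N)` with `W(r) = ∫₀ʳ c A` (`radialVolume`), and `Vol_c(Ω) ≤ ∫ W(u) dν`.
As `W` is strictly increasing and continuous, exactly one ball has the volume of `Ω`
(`existsUnique_radius`).

*Area.* The Gram matrix of a hypersurface patch is that of its projection to the base plus the
square of the differential of `r`, so that its determinant is at least that of the projection
(`det_le_det_add_vecMulVec`). Together with the theorem of Rademacher and the change of variables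
formula for `ν` this gives that the area measure of `∂Ω` dominates the measure `A(u) dν` on the
graph of `u` (`graphMeasure_le`). Therefore the weighted area of `∂Ω` is at least `∫ ψ(u) dν`, where
`ψ = a A`.

*Convexity.* If `ψ ≥ ψ(R) + k (W - W(R))` with `k ≥ 0`, then integration over `N` gives
`∫ ψ(u) dν ≥ ψ(R) ν(N) + k (∫ W(u) dν - W(R) ν(N)) ≥ ψ(R) ν(N)`, where `R` is the radius of
the ball with the volume of `Ω` (`weightedArea_warpedBall_le_lintegral_graphMeasure`); and
`ψ(R) ν(N)` is at least the weighted area of `∂B_R`. The supporting lines exist if `ψ ∘ Ṽ⁻¹` is convex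
(`exists_support_of_convexOn_comp_invFunOn`), and for `a = c = 1` if `A` is non-decreasing and
log-convex (`exists_support_of_log_convexOn`).

*Equality.* If equality holds, the area measure of `∂Ω` is the measure `A(u) dν` on the graph of
`u`. Then the two determinants above agree almost everywhere on a Lipschitz patch of `∂Ω`, which
forces the differential of `r` to vanish there (`radialDeriv_eq_zero`). A Lipschitz function with
almost everywhere vanishing differential is locally constant, so that `∂Ω` lies locally in a
coordinate slice, and it contains the slice locally because `Ω` and its exterior are its two sides
(`eventually_mem_frontier`). As the base is connected, `∂Ω` contains with each point with `r > 0`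
the whole slice through it. Every such slice has positive area, so it meets the graph of `u`; hence
there is only one (`exists_frontier_eq_slice`). The assumption on the exterior of `Ω` excludes
further boundary points with `r = 0` (`frontier_eq_slice`).
-/

noncomputable section

set_option linter.unusedSectionVars false

/-! ### Determinants of Gram matrices -/

section LinearAlgebra

open Matrix

lemma det_blockDiagonal'_eq_prod {p : ℕ} {m : Fin p → ℕ}
    (B : ∀ q, Matrix (Fin (m q)) (Fin (m q)) ℝ) :
    (blockDiagonal' B).det = ∏ q, (B q).det := by
  rw [(blockTriangular_blockDiagonal' B).det_fintype]
  refine Finset.prod_congr rfl fun q _ => ?_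
  let e : {a : Σ q, Fin (m q) // a.1 = q} ≃ Fin (m q) := Equiv.sigmaSubtype q
  rw [← Matrix.det_submatrix_equiv_self e.symm]
  congr 1
  ext i j
  simp [toSquareBlock, toSquareBlockProp, e, Equiv.sigmaSubtype]

lemma det_transpose_mul_mul {ι κ : Type*} [Fintype ι] [DecidableEq ι] [Fintype κ] [DecidableEq κ]
    (e : ι ≃ κ) (B : Matrix ι ι ℝ) (X : Matrix ι κ ℝ) :
    (Xᵀ * B * X).det = B.det * (X.submatrix e.symm id).det ^ 2 := by
  have h : Xᵀ * B * X = (X.submatrix e.symm id)ᵀ * (B.submatrix e.symm e.symm) *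
      (X.submatrix e.symm id) := by
    rw [transpose_submatrix, submatrix_mul_equiv, submatrix_mul_equiv]
    simp
  rw [h, det_mul, det_mul, det_transpose, det_submatrix_equiv_self]
  ring

variable {κ : Type*} [Fintype κ] [DecidableEq κ]

lemma det_add_vecMulVec {C : Matrix κ κ ℝ} (hC : C.PosDef) (v : κ → ℝ) :
    (C + vecMulVec v v).det = C.det * (1 + v ⬝ᵥ (C⁻¹ *ᵥ v)) := by
  have h := det_add_replicateCol_mul_replicateRow (ι := Unit) (hC.det_pos.ne'.isUnit) v v
  rw [← vecMulVec_eq] at h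
  rw [h, det_unique (1 + _), Matrix.mul_assoc, ← replicateCol_mulVec, Matrix.add_apply,
    replicateRow_mul_replicateCol_apply, Matrix.one_apply_eq]

/-- Adding a rank one form to a positive semidefinite form does not decrease the determinant. -/
lemma det_le_det_add_vecMulVec {C : Matrix κ κ ℝ} (hC : C.PosSemidef) (v : κ → ℝ) :
    C.det ≤ (C + vecMulVec v v).det := by
  by_cases h0 : C.det = 0
  · rw [h0]
    have : (vecMulVec v v).PosSemidef := by
      simpa using posSemidef_vecMulVec_self_star v
    exact (hC.add this).det_nonneg
  · have hpd : C.PosDef := hC.posDef_iff_det_ne_zero.2 h0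
    rw [det_add_vecMulVec hpd]
    have h1 : 0 ≤ v ⬝ᵥ (C⁻¹ *ᵥ v) := by
      simpa using hpd.inv.posSemidef.dotProduct_mulVec_nonneg v
    nlinarith [hpd.det_pos]

/-- Equality in `det_le_det_add_vecMulVec`: if a positive definite form arises from a semidefinite
one by adding the square of a linear form without changing the determinant, then the linear form
vanishes. -/
lemma eq_zero_of_det_add_vecMulVec_eq {C : Matrix κ κ ℝ} (hC : C.PosSemidef) {v : κ → ℝ}
    (hpos : (C + vecMulVec v v).PosDef) (h : (C + vecMulVec v v).det ≤ C.det) : v = 0 := by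
  have h0 : 0 < C.det := hpos.det_pos.trans_le h
  have hpd : C.PosDef := hC.posDef_iff_det_ne_zero.2 h0.ne'
  rw [det_add_vecMulVec hpd] at h
  by_contra hv
  have h1 : 0 < v ⬝ᵥ (C⁻¹ *ᵥ v) := by
    simpa using hpd.inv.dotProduct_mulVec_pos hv
  nlinarith

end LinearAlgebra

/-! ### Riemannian metrics in charts -/

section SingleManifold

variable {m : ℕ} {N : Type*} [TopologicalSpace N] [ChartedSpace (EuclideanSpace ℝ (Fin m)) N]
  [IsManifold (𝓡 m) ∞ N]

/-- The chart around `x` induces an isomorphism between the coordinate space and the tangent space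
at `y`; this is the image of the vector `v` of the coordinate space. -/
def chartVec (x y : N) (v : EuclideanSpace ℝ (Fin m)) : TangentSpace (𝓡 m) y :=
  (trivializationAt (EuclideanSpace ℝ (Fin m)) (TangentSpace (𝓡 m)) x).symmL ℝ y v

/-- The matrix of the metric `g` at `y` in the chart around `x`. -/
def chartGram (g : SmoothMetric m N) (x y : N) : Matrix (Fin m) (Fin m) ℝ :=
  Matrix.of fun a b => g.inner y (chartVec x y (EuclideanSpace.single a 1))
    (chartVec x y (EuclideanSpace.single b 1))

/-- The derivative at `y` of the chart around `x`. -/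
def chartDeriv (x y : N) : TangentSpace (𝓡 m) y →L[ℝ] EuclideanSpace ℝ (Fin m) :=
  (trivializationAt (EuclideanSpace ℝ (Fin m)) (TangentSpace (𝓡 m)) x).continuousLinearMapAt ℝ y

lemma chartVec_chartDeriv {x y : N} (hy : y ∈ (extChartAt (𝓡 m) x).source)
    (u : TangentSpace (𝓡 m) y) : chartVec x y (chartDeriv x y u) = u :=
  (trivializationAt (EuclideanSpace ℝ (Fin m)) (TangentSpace (𝓡 m)) x).symmL_continuousLinearMapAt
    (R := ℝ) (by simpa using hy) u

lemma chartDeriv_chartVec {x y : N} (hy : y ∈ (extChartAt (𝓡 m) x).source)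
    (v : EuclideanSpace ℝ (Fin m)) : chartDeriv x y (chartVec x y v) = v :=
  (trivializationAt (EuclideanSpace ℝ (Fin m)) (TangentSpace (𝓡 m)) x).continuousLinearMapAt_symmL
    (R := ℝ) (by simpa using hy) v

lemma inner_chartVec (g : SmoothMetric m N) (x y : N) (v w : EuclideanSpace ℝ (Fin m)) :
    g.inner y (chartVec x y v) (chartVec x y w) = v.ofLp ⬝ᵥ (chartGram g x y).mulVec w.ofLp := by
  have key : ∀ v : EuclideanSpace ℝ (Fin m), chartVec x y v =
      ∑ a, v a • chartVec x y (EuclideanSpace.single a (1 : ℝ)) := by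
    intro v
    have h : v = ∑ a, v a • EuclideanSpace.single a (1 : ℝ) := by
      ext i; simp [Pi.single_apply]
    conv_lhs => rw [h]
    simp [chartVec]
  rw [key v, key w]
  simp only [map_sum, map_smul, sum_apply, smul_apply,
    smul_eq_mul, dotProduct, Matrix.mulVec, chartGram, Matrix.of_apply, Finset.mul_sum]
  rw [Finset.sum_comm]
  refine Finset.sum_congr rfl fun a _ => Finset.sum_congr rfl fun b _ => ?_
  ring

lemma inner_eq_chartGram (g : SmoothMetric m N) {x y : N}
    (hy : y ∈ (extChartAt (𝓡 m) x).source) (u w : TangentSpace (𝓡 m) y) :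
    g.inner y u w = (chartDeriv x y u).ofLp ⬝ᵥ
      (chartGram g x y).mulVec (chartDeriv x y w).ofLp := by
  rw [← inner_chartVec, chartVec_chartDeriv hy, chartVec_chartDeriv hy]

lemma chartGram_posDef (g : SmoothMetric m N) {x y : N}
    (hy : y ∈ (extChartAt (𝓡 m) x).source) : (chartGram g x y).PosDef := by
  refine Matrix.PosDef.of_dotProduct_mulVec_pos ?_ fun v hv => ?_
  · ext a b
    simp [chartGram, g.symm]
  · have := inner_chartVec g x y (WithLp.toLp 2 v) (WithLp.toLp 2 v)
    simp only [star_trivial]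
    rw [← this]
    refine g.pos _ _ fun h => hv ?_
    have h2 := chartDeriv_chartVec hy (WithLp.toLp 2 v)
    rw [h, map_zero] at h2
    simpa using congrArg WithLp.ofLp h2.symm

lemma continuousOn_chartGram (g : SmoothMetric m N) (x : N) :
    ContinuousOn (chartGram g x) (extChartAt (𝓡 m) x).source := by
  have hb : (trivializationAt (EuclideanSpace ℝ (Fin m)) (TangentSpace (𝓡 m)) x).baseSet =
      (extChartAt (𝓡 m) x).source := by simp
  have hvec : ∀ v : EuclideanSpace ℝ (Fin m), ContinuousOn
      (fun y => (⟨y, chartVec x y v⟩ :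
        Bundle.TotalSpace (EuclideanSpace ℝ (Fin m)) (TangentSpace (𝓡 m) : N → Type _)))
      (extChartAt (𝓡 m) x).source := by
    intro v
    have := (trivializationAt (EuclideanSpace ℝ (Fin m))
      (TangentSpace (𝓡 m) : N → Type _) x).continuousOn_symm
    rw [hb] at this
    have h2 : ContinuousOn (fun y : N => (y, v)) (extChartAt (𝓡 m) x).source := by fun_prop
    exact (this.comp h2 fun y hy => ⟨hy, mem_univ _⟩).congr fun y hy => by
      unfold chartVec
      rw [Bundle.Trivialization.symmL_apply _ (hb ▸ hy)]
      rfl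
  refine continuousOn_pi.2 fun a => continuousOn_pi.2 fun b => fun y hy => ?_
  have := (g.contMDiff.continuous.continuousAt (x := y)).continuousWithinAt
    (s := (extChartAt (𝓡 m) x).source)
    |>.clm_bundle_apply₂ (F₁ := EuclideanSpace ℝ (Fin m)) (F₂ := EuclideanSpace ℝ (Fin m))
      (F₃ := ℝ) (E₃ := Bundle.Trivial N ℝ)
      (hvec (EuclideanSpace.single a 1) y hy) (hvec (EuclideanSpace.single b 1) y hy)
  simp only [FiberBundle.continuousWithinAt_totalSpace] at this
  exact this.2

lemma hasFDerivWithinAt_extChartAt_comp {k : ℕ} {G : EuclideanSpace ℝ (Fin k) → N}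
    {K : Set (EuclideanSpace ℝ (Fin k))} {z : EuclideanSpace ℝ (Fin k)}
    (hG : MDifferentiableWithinAt (𝓡 k) (𝓡 m) G K z) {x : N}
    (hz : G z ∈ (extChartAt (𝓡 m) x).source) :
    HasFDerivWithinAt (fun z => extChartAt (𝓡 m) x (G z))
      ((chartDeriv x (G z)).comp (mfderivWithin (𝓡 k) (𝓡 m) G K z)) K z := by
  have hz' : G z ∈ (chartAt (EuclideanSpace ℝ (Fin m)) x).source := by simpa using hz
  have h1 := (mdifferentiableAt_extChartAt (I := 𝓡 m) hz').hasMFDerivAt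
  have h2 := h1.comp_hasMFDerivWithinAt z hG.hasMFDerivWithinAt
  rw [← TangentBundle.continuousLinearMapAt_trivializationAt hz'] at h2
  exact h2.hasFDerivWithinAt

end SingleManifold

/-! ### Product charts and the Gram matrix of a patch -/

section ProductChart

variable {p : ℕ} (m : Fin p → ℕ)

/-- The identification of a product of coordinate spaces with a single coordinate space. -/
def coordEquiv : (∀ q, EuclideanSpace ℝ (Fin (m q))) ≃L[ℝ] EuclideanSpace ℝ (Fin (∑ q, m q)) :=
  LinearEquiv.toContinuousLinearEquiv
  { toFun := fun w => WithLp.toLp 2 fun i =>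
      w (finSigmaFinEquiv.symm i).1 (finSigmaFinEquiv.symm i).2
    invFun := fun v q => WithLp.toLp 2 fun a => v (finSigmaFinEquiv ⟨q, a⟩)
    map_add' := fun _ _ => rfl
    map_smul' := fun _ _ => rfl
    left_inv := fun w => by
      ext q a
      exact congrArg (fun s : Σ q, Fin (m q) => w s.1 s.2)
        (finSigmaFinEquiv.symm_apply_apply ⟨q, a⟩)
    right_inv := fun v => by ext i; simp }

lemma coordEquiv_apply (w : ∀ q, EuclideanSpace ℝ (Fin (m q))) (i : Σ q, Fin (m q)) :
    coordEquiv m w (finSigmaFinEquiv i) = w i.1 i.2 :=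
  congrArg (fun s : Σ q, Fin (m q) => w s.1 s.2) (finSigmaFinEquiv.symm_apply_apply i)

/-- The identification `ℝ × ℝⁿ ≃ ℝⁿ⁺¹`. -/
def consEquiv (n : ℕ) : (ℝ × EuclideanSpace ℝ (Fin n)) ≃L[ℝ] EuclideanSpace ℝ (Fin (n + 1)) :=
  LinearEquiv.toContinuousLinearEquiv
  { toFun := fun w => WithLp.toLp 2 (Fin.cons w.1 w.2.ofLp)
    invFun := fun v => (v 0, WithLp.toLp 2 fun a => v a.succ)
    map_add' := fun v w => by
      ext i; refine Fin.cases ?_ (fun i => ?_) i <;> simp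
    map_smul' := fun c w => by
      ext i; refine Fin.cases ?_ (fun i => ?_) i <;> simp
    left_inv := fun w => by simp
    right_inv := fun v => by
      ext i; refine Fin.cases ?_ (fun i => ?_) i <;> simp }

lemma consEquiv_zero {n : ℕ} (w : ℝ × EuclideanSpace ℝ (Fin n)) : consEquiv n w 0 = w.1 := rfl

lemma consEquiv_succ {n : ℕ} (w : ℝ × EuclideanSpace ℝ (Fin n)) (i : Fin n) :
    consEquiv n w i.succ = w.2 i := rfl

variable {m} {N : Fin p → Type*}
  [∀ q, TopologicalSpace (N q)] [∀ q, ChartedSpace (EuclideanSpace ℝ (Fin (m q))) (N q)]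

/-- The domain of the product chart around `x`. -/
def prodSource (m : Fin p → ℕ) [∀ q, ChartedSpace (EuclideanSpace ℝ (Fin (m q))) (N q)]
    (x : ∀ q, N q) : Set (∀ q, N q) :=
  {θ | ∀ q, θ q ∈ (extChartAt (𝓡 (m q)) (x q)).source}

/-- The image of the product chart around `x`. -/
def prodTarget (m : Fin p → ℕ) [∀ q, ChartedSpace (EuclideanSpace ℝ (Fin (m q))) (N q)]
    (x : ∀ q, N q) : Set (EuclideanSpace ℝ (Fin (∑ q, m q))) :=
  {w | ∀ q, (coordEquiv m).symm w q ∈ (extChartAt (𝓡 (m q)) (x q)).target}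

/-- The product of the charts around the components of `x`. -/
def prodChart (m : Fin p → ℕ) [∀ q, ChartedSpace (EuclideanSpace ℝ (Fin (m q))) (N q)]
    (x θ : ∀ q, N q) : EuclideanSpace ℝ (Fin (∑ q, m q)) :=
  coordEquiv m fun q => extChartAt (𝓡 (m q)) (x q) (θ q)

/-- The inverse of the product chart around `x`. -/
def prodChartSymm (m : Fin p → ℕ) [∀ q, ChartedSpace (EuclideanSpace ℝ (Fin (m q))) (N q)]
    (x : ∀ q, N q) (w : EuclideanSpace ℝ (Fin (∑ q, m q))) : ∀ q, N q :=
  fun q => (extChartAt (𝓡 (m q)) (x q)).symm ((coordEquiv m).symm w q)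

lemma mem_prodSource_self (x : ∀ q, N q) : x ∈ prodSource m x := fun _ => mem_extChartAt_source _

lemma prodChart_mem {x θ : ∀ q, N q} (h : θ ∈ prodSource m x) : prodChart m x θ ∈ prodTarget m x :=
  fun q => by simpa [prodChart] using (extChartAt (𝓡 (m q)) (x q)).map_source (h q)

lemma prodChartSymm_mem {x : ∀ q, N q} {w} (h : w ∈ prodTarget m x) :
    prodChartSymm m x w ∈ prodSource m x :=
  fun q => (extChartAt (𝓡 (m q)) (x q)).map_target (h q)

lemma prodChartSymm_prodChart {x θ : ∀ q, N q} (h : θ ∈ prodSource m x) :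
    prodChartSymm m x (prodChart m x θ) = θ := by
  ext q
  simpa [prodChart, prodChartSymm] using (extChartAt (𝓡 (m q)) (x q)).left_inv (h q)

lemma prodChart_prodChartSymm {x : ∀ q, N q} {w} (h : w ∈ prodTarget m x) :
    prodChart m x (prodChartSymm m x w) = w := by
  rw [prodChart, ← ContinuousLinearEquiv.eq_symm_apply]
  ext1 q
  exact (extChartAt (𝓡 (m q)) (x q)).right_inv (h q)

lemma isOpen_prodSource (x : ∀ q, N q) : IsOpen (prodSource m x) := by
  have : prodSource m x = ⋂ q, (fun θ => θ q) ⁻¹' (extChartAt (𝓡 (m q)) (x q)).source := by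
    ext θ; simp [prodSource]
  rw [this]
  exact isOpen_iInter_of_finite fun q => (isOpen_extChartAt_source _).preimage (continuous_apply q)

lemma isOpen_prodTarget (x : ∀ q, N q) : IsOpen (prodTarget m x) := by
  have : prodTarget m x = ⋂ q, (fun w => (coordEquiv m).symm w q) ⁻¹'
      (extChartAt (𝓡 (m q)) (x q)).target := by
    ext θ; simp [prodTarget]
  rw [this]
  exact isOpen_iInter_of_finite fun q => (isOpen_extChartAt_target _).preimage
    ((continuous_apply q).comp (coordEquiv m).symm.continuous)

lemma continuousOn_prodChart (x : ∀ q, N q) : ContinuousOn (prodChart m x) (prodSource m x) :=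
  (coordEquiv m).continuous.comp_continuousOn <| continuousOn_pi.2 fun q =>
    (continuousOn_extChartAt (x q)).comp (continuous_apply q).continuousOn fun _ h => h q

lemma continuousOn_prodChartSymm (x : ∀ q, N q) :
    ContinuousOn (prodChartSymm m x) (prodTarget m x) :=
  continuousOn_pi.2 fun q => (continuousOn_extChartAt_symm (x q)).comp
    ((continuous_apply q).comp (coordEquiv m).symm.continuous).continuousOn fun _ h => h q

variable [∀ q, IsManifold (𝓡 (m q)) ∞ (N q)]

lemma mdifferentiableOn_prodChartSymm (x : ∀ q, N q) (q : Fin p) :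
    MDifferentiableOn (𝓡 (∑ q, m q)) (𝓡 (m q)) (fun w => prodChartSymm m x w q)
      (prodTarget m x) := by
  have h1 : MDifferentiableOn (𝓡 (m q)) (𝓡 (m q)) (extChartAt (𝓡 (m q)) (x q)).symm
      (extChartAt (𝓡 (m q)) (x q)).target := mdifferentiableOn_extChartAt_symm
  have h2 : MDifferentiable (𝓡 (∑ q, m q)) (𝓡 (m q)) (fun w => (coordEquiv m).symm w q) := by
    apply Differentiable.mdifferentiable
    fun_prop
  exact h1.comp h2.mdifferentiableOn fun w hw => hw q

/-- The Riemannian density of the product metric in the product chart around `x`. -/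
def prodDensity (g : ∀ q, SmoothMetric (m q) (N q)) (x θ : ∀ q, N q) : ℝ :=
  Real.sqrt (∏ q, (chartGram (g q) (x q) (θ q)).det)

lemma prodDensity_pos (g : ∀ q, SmoothMetric (m q) (N q)) {x θ : ∀ q, N q}
    (h : θ ∈ prodSource m x) : 0 < prodDensity g x θ :=
  Real.sqrt_pos.2 <| Finset.prod_pos fun q _ => (chartGram_posDef (g q) (h q)).det_pos

lemma continuousOn_prodDensity (g : ∀ q, SmoothMetric (m q) (N q)) (x : ∀ q, N q) :
    ContinuousOn (prodDensity g x) (prodSource m x) := by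
  refine Real.continuous_sqrt.comp_continuousOn <| continuousOn_finsetProd _ fun q _ => ?_
  have h : Continuous fun M : Matrix (Fin (m q)) (Fin (m q)) ℝ => M.det := by fun_prop
  exact h.comp_continuousOn <| (continuousOn_chartGram (g q) (x q)).comp
    (continuous_apply q).continuousOn fun _ h => h q

/-- The derivative of a map into `∏ q, N q`, read in the product chart around `x`. It is formed from
the derivatives within `K` that occur in `patchGram`; where derivatives within `K` are not unique,
it is still one of the derivatives of the map within `K`. -/
def prodDeriv {k : ℕ} (x : ∀ q, N q) (G : EuclideanSpace ℝ (Fin k) → ∀ q, N q)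
    (K : Set (EuclideanSpace ℝ (Fin k))) (z : EuclideanSpace ℝ (Fin k)) :
    EuclideanSpace ℝ (Fin k) →L[ℝ] EuclideanSpace ℝ (Fin (∑ q, m q)) :=
  (coordEquiv m : (∀ q, EuclideanSpace ℝ (Fin (m q))) →L[ℝ] EuclideanSpace ℝ (Fin (∑ q, m q))).comp
    (ContinuousLinearMap.pi fun q => (chartDeriv (x q) (G z q)).comp
      (mfderivWithin (𝓡 k) (𝓡 (m q)) (fun z => G z q) K z))

lemma prodDeriv_apply {k : ℕ} (x : ∀ q, N q) (G : EuclideanSpace ℝ (Fin k) → ∀ q, N q)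
    (K : Set (EuclideanSpace ℝ (Fin k))) (z v : EuclideanSpace ℝ (Fin k)) (a : Σ q, Fin (m q)) :
    prodDeriv x G K z v (finSigmaFinEquiv a) = chartDeriv (x a.1) (G z a.1)
      (mfderivWithin (𝓡 k) (𝓡 (m a.1)) (fun z => G z a.1) K z v) a.2 :=
  coordEquiv_apply m _ a

lemma hasFDerivWithinAt_prodChart_comp {k : ℕ} {G : EuclideanSpace ℝ (Fin k) → ∀ q, N q}
    {K : Set (EuclideanSpace ℝ (Fin k))} {z : EuclideanSpace ℝ (Fin k)}
    (hG : ∀ q, MDifferentiableWithinAt (𝓡 k) (𝓡 (m q)) (fun z => G z q) K z) {x : ∀ q, N q}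
    (hz : G z ∈ prodSource m x) :
    HasFDerivWithinAt (fun z => prodChart m x (G z)) (prodDeriv x G K z) K z := by
  refine (coordEquiv m).hasFDerivAt.comp_hasFDerivWithinAt z ?_
  exact hasFDerivWithinAt_pi.2 fun q => hasFDerivWithinAt_extChartAt_comp (hG q) (hz q)

/-- The Gram matrix of a map into `∏ q, N q` for the metric `∑ q, σ_q² g_q`. -/
def baseGram (σ : Fin p → ℝ) (g : ∀ q, SmoothMetric (m q) (N q)) {k : ℕ}
    (K : Set (EuclideanSpace ℝ (Fin k))) (G : EuclideanSpace ℝ (Fin k) → ∀ q, N q)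
    (z : EuclideanSpace ℝ (Fin k)) : Matrix (Fin k) (Fin k) ℝ :=
  Matrix.of fun i j => ∑ q, σ q ^ 2 * (g q).inner (G z q)
        (mfderivWithin (𝓡 k) (𝓡 (m q)) (fun z => G z q) K z
          (EuclideanSpace.single i (1 : ℝ) : EuclideanSpace ℝ (Fin k)))
        (mfderivWithin (𝓡 k) (𝓡 (m q)) (fun z => G z q) K z
          (EuclideanSpace.single j (1 : ℝ) : EuclideanSpace ℝ (Fin k)))

open Matrix in
/-- The block diagonal matrix of the metric `∑ q, σ_q² g_q` in the product chart around `x`. -/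
def blockGram (σ : Fin p → ℝ) (g : ∀ q, SmoothMetric (m q) (N q)) (x θ : ∀ q, N q) :
    Matrix (Σ q, Fin (m q)) (Σ q, Fin (m q)) ℝ :=
  blockDiagonal' fun q => σ q ^ 2 • chartGram (g q) (x q) (θ q)

lemma det_blockGram (σ : Fin p → ℝ) (g : ∀ q, SmoothMetric (m q) (N q)) {x θ : ∀ q, N q}
    (h : θ ∈ prodSource m x) :
    (blockGram σ g x θ).det = ((∏ q, σ q ^ m q) * prodDensity g x θ) ^ 2 := by
  rw [blockGram, det_blockDiagonal'_eq_prod, mul_pow, prodDensity, Real.sq_sqrt, ← Finset.prod_pow,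
    ← Finset.prod_mul_distrib]
  · refine Finset.prod_congr rfl fun q _ => ?_
    rw [Matrix.det_smul, Fintype.card_fin]
    ring
  · exact (Finset.prod_pos fun q _ => (chartGram_posDef (g q) (h q)).det_pos).le

lemma baseGram_apply (σ : Fin p → ℝ) (g : ∀ q, SmoothMetric (m q) (N q)) {k : ℕ}
    (K : Set (EuclideanSpace ℝ (Fin k))) (G : EuclideanSpace ℝ (Fin k) → ∀ q, N q)
    (z : EuclideanSpace ℝ (Fin k)) {x : ∀ q, N q} (h : G z ∈ prodSource m x) (i j : Fin k) :
    baseGram σ g K G z i j =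
      (fun a : Σ q, Fin (m q) =>
        prodDeriv x G K z (EuclideanSpace.single i 1) (finSigmaFinEquiv a)) ⬝ᵥ
      (blockGram σ g x (G z)).mulVec
      (fun a => prodDeriv x G K z (EuclideanSpace.single j 1) (finSigmaFinEquiv a)) := by
  rw [baseGram, Matrix.of_apply]
  simp only [prodDeriv_apply, blockGram, dotProduct, Matrix.mulVec, Fintype.sum_sigma]
  refine Finset.sum_congr rfl fun q _ => ?_
  rw [inner_eq_chartGram (g q) (h q)]
  simp only [dotProduct, Matrix.mulVec, Finset.mul_sum]
  refine Finset.sum_congr rfl fun a _ => ?_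
  rw [Finset.sum_eq_single q]
  · refine Finset.sum_congr rfl fun b _ => ?_
    simp [Matrix.blockDiagonal'_apply_eq]
    ring
  · intro q' _ hq
    refine Finset.sum_eq_zero fun b _ => ?_
    simp [Matrix.blockDiagonal'_apply_ne _ _ _ hq.symm]
  · simp

/-- The Gram determinant of an `n`-dimensional map into the `n`-dimensional product `∏ q, N q`. -/
lemma det_baseGram (σ : Fin p → ℝ) (g : ∀ q, SmoothMetric (m q) (N q))
    (K : Set (EuclideanSpace ℝ (Fin (∑ q, m q))))
    (G : EuclideanSpace ℝ (Fin (∑ q, m q)) → ∀ q, N q)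
    (z : EuclideanSpace ℝ (Fin (∑ q, m q))) {x : ∀ q, N q} (h : G z ∈ prodSource m x) :
    (baseGram σ g K G z).det =
      ((∏ q, σ q ^ m q) * (prodDensity g x (G z) * (prodDeriv x G K z).det)) ^ 2 := by
  let D : Matrix (Σ q, Fin (m q)) (Fin (∑ q, m q)) ℝ := Matrix.of fun a i =>
    prodDeriv x G K z (EuclideanSpace.single i 1) (finSigmaFinEquiv a)
  have h1 : baseGram σ g K G z = D.transpose * blockGram σ g x (G z) * D := by
    ext i j
    rw [baseGram_apply σ g K G z h, Matrix.dotProduct_mulVec]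
    rfl
  rw [h1, det_transpose_mul_mul finSigmaFinEquiv, det_blockGram σ g h]
  have h2 : (D.submatrix finSigmaFinEquiv.symm id).det = (prodDeriv x G K z).det := by
    rw [ContinuousLinearMap.det, ← LinearMap.det_toMatrix (EuclideanSpace.basisFun _ ℝ).toBasis]
    congr 1
    ext i j
    simp [D, LinearMap.toMatrix_apply]
  rw [h2]
  ring

lemma dotProduct_baseGram_mulVec (σ : Fin p → ℝ) (g : ∀ q, SmoothMetric (m q) (N q)) {k : ℕ}
    (K : Set (EuclideanSpace ℝ (Fin k))) (G : EuclideanSpace ℝ (Fin k) → ∀ q, N q)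
    (z v : EuclideanSpace ℝ (Fin k)) :
    v.ofLp ⬝ᵥ (baseGram σ g K G z).mulVec v.ofLp = ∑ q, σ q ^ 2 * (g q).inner (G z q)
        (mfderivWithin (𝓡 k) (𝓡 (m q)) (fun z => G z q) K z v)
        (mfderivWithin (𝓡 k) (𝓡 (m q)) (fun z => G z q) K z v) := by
  have key : ∀ q, mfderivWithin (𝓡 k) (𝓡 (m q)) (fun z => G z q) K z v =
      ∑ i, v i • mfderivWithin (𝓡 k) (𝓡 (m q)) (fun z => G z q) K z
        (EuclideanSpace.single i (1 : ℝ) : EuclideanSpace ℝ (Fin k)) := by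
    intro q
    have h : v = ∑ i, v i • (EuclideanSpace.single i (1 : ℝ) : EuclideanSpace ℝ (Fin k)) := by
      ext i; simp [Pi.single_apply]
    conv_lhs => rw [h]
    exact (map_sum (mfderivWithin (𝓡 k) (𝓡 (m q)) (fun z => G z q) K z) _ _).trans
      (Finset.sum_congr rfl fun i _ => map_smul _ _ _)
  simp_rw [key]
  simp only [map_sum, map_smul, sum_apply, smul_apply, smul_eq_mul, dotProduct, Matrix.mulVec,
    baseGram, Matrix.of_apply, Finset.mul_sum, Finset.sum_mul]
  conv_rhs => rw [Finset.sum_comm]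
  refine Finset.sum_congr rfl fun j _ => ?_
  conv_rhs => rw [Finset.sum_comm]
  refine Finset.sum_congr rfl fun i _ => Finset.sum_congr rfl fun q _ => ?_
  rw [(g q).symm]
  ring

lemma isHermitian_baseGram (σ : Fin p → ℝ) (g : ∀ q, SmoothMetric (m q) (N q)) {k : ℕ}
    (K : Set (EuclideanSpace ℝ (Fin k))) (G : EuclideanSpace ℝ (Fin k) → ∀ q, N q)
    (z : EuclideanSpace ℝ (Fin k)) : (baseGram σ g K G z).IsHermitian := by
  ext i j
  simp only [Matrix.conjTranspose_apply, star_trivial, baseGram, Matrix.of_apply]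
  exact Finset.sum_congr rfl fun q _ => by rw [(g q).symm]

lemma inner_self_nonneg' {n : ℕ} {X : Type*} [TopologicalSpace X]
    [ChartedSpace (EuclideanSpace ℝ (Fin n)) X] [IsManifold (𝓡 n) ∞ X] (g : SmoothMetric n X)
    (x : X) (v : TangentSpace (𝓡 n) x) : 0 ≤ g.inner x v v := by
  by_cases h : v = 0
  · simp [h]
  · exact (g.pos x v h).le

lemma posSemidef_baseGram (σ : Fin p → ℝ) (g : ∀ q, SmoothMetric (m q) (N q)) {k : ℕ}
    (K : Set (EuclideanSpace ℝ (Fin k))) (G : EuclideanSpace ℝ (Fin k) → ∀ q, N q)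
    (z : EuclideanSpace ℝ (Fin k)) : (baseGram σ g K G z).PosSemidef := by
  refine .of_dotProduct_mulVec_nonneg (isHermitian_baseGram σ g K G z) fun v => ?_
  have := dotProduct_baseGram_mulVec σ g K G z (WithLp.toLp 2 v)
  rw [star_trivial]
  refine le_of_le_of_eq ?_ this.symm
  exact Finset.sum_nonneg fun q _ => mul_nonneg (sq_nonneg _) (inner_self_nonneg' _ _ _)

section Patch

variable {lam : EReal} {s : Fin p → ℝ → ℝ} {g : ∀ q, SmoothMetric (m q) (N q)}

/-- The differential of the radial component of a map into `M`. -/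
def radialDeriv {k : ℕ} (F : EuclideanSpace ℝ (Fin k) → WarpedSpace lam N)
    (K : Set (EuclideanSpace ℝ (Fin k))) (z : EuclideanSpace ℝ (Fin k)) :
    EuclideanSpace ℝ (Fin k) →L[ℝ] ℝ :=
  fderivWithin ℝ (fun z => ((F z).1 : ℝ)) K z

lemma patchGram_eq {k : ℕ} (K : Set (EuclideanSpace ℝ (Fin k)))
    (F : EuclideanSpace ℝ (Fin k) → WarpedSpace lam N) (z : EuclideanSpace ℝ (Fin k)) :
    patchGram s g K F z = baseGram (fun q => s q (F z).1) g K (fun z => (F z).2) z +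
      Matrix.vecMulVec (fun i => radialDeriv F K z (EuclideanSpace.single i 1))
        (fun i => radialDeriv F K z (EuclideanSpace.single i 1)) := by
  ext i j
  exact add_comm _ _

lemma sqrt_det_baseGram (hs : ∀ q, ∀ r ∈ radialInterval lam, 0 ≤ s q r)
    (K : Set (EuclideanSpace ℝ (Fin (∑ q, m q))))
    (F : EuclideanSpace ℝ (Fin (∑ q, m q)) → WarpedSpace lam N)
    (z : EuclideanSpace ℝ (Fin (∑ q, m q))) {x : ∀ q, N q} (h : (F z).2 ∈ prodSource m x) :
    √(baseGram (fun q => s q (F z).1) g K (fun z => (F z).2) z).det =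
      areaFactor m s (F z).1 * (prodDensity g x (F z).2 *
        |(prodDeriv x (fun z => (F z).2) K z).det|) := by
  rw [det_baseGram _ g K (fun z => (F z).2) z h, Real.sqrt_sq_eq_abs, abs_mul, abs_mul,
    abs_of_pos (prodDensity_pos g h)]
  congr 1
  exact abs_of_nonneg (Finset.prod_nonneg fun q _ => pow_nonneg (hs q _ (F z).1.2) _)

lemma le_sqrt_det_patchGram (hs : ∀ q, ∀ r ∈ radialInterval lam, 0 ≤ s q r)
    (K : Set (EuclideanSpace ℝ (Fin (∑ q, m q))))
    (F : EuclideanSpace ℝ (Fin (∑ q, m q)) → WarpedSpace lam N)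
    (z : EuclideanSpace ℝ (Fin (∑ q, m q))) {x : ∀ q, N q} (h : (F z).2 ∈ prodSource m x) :
    areaFactor m s (F z).1 * (prodDensity g x (F z).2 *
        |(prodDeriv x (fun z => (F z).2) K z).det|) ≤ √(patchGram s g K F z).det := by
  rw [← sqrt_det_baseGram hs K F z h, patchGram_eq]
  exact Real.sqrt_le_sqrt (det_le_det_add_vecMulVec (posSemidef_baseGram _ g K _ z) _)

lemma sqrt_det_patchGram_of_radialDeriv_eq_zero (hs : ∀ q, ∀ r ∈ radialInterval lam, 0 ≤ s q r)
    (K : Set (EuclideanSpace ℝ (Fin (∑ q, m q))))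
    (F : EuclideanSpace ℝ (Fin (∑ q, m q)) → WarpedSpace lam N)
    (z : EuclideanSpace ℝ (Fin (∑ q, m q))) {x : ∀ q, N q} (h : (F z).2 ∈ prodSource m x)
    (h0 : radialDeriv F K z = 0) :
    √(patchGram s g K F z).det = areaFactor m s (F z).1 * (prodDensity g x (F z).2 *
        |(prodDeriv x (fun z => (F z).2) K z).det|) := by
  rw [← sqrt_det_baseGram hs K F z h, patchGram_eq, h0]
  congr 2
  ext i j
  simp [Matrix.vecMulVec_apply]

/-- A hypersurface patch that is immersed at `z` and whose area density there does not exceed that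
of its projection to `∏ q, N q` is tangent to a coordinate slice. -/
lemma radialDeriv_eq_zero (hA : ∀ r ∈ radialInterval lam, 0 < r → 0 < areaFactor m s r)
    (hs : ∀ q, ∀ r ∈ radialInterval lam, 0 ≤ s q r)
    (K : Set (EuclideanSpace ℝ (Fin (∑ q, m q))))
    (F : EuclideanSpace ℝ (Fin (∑ q, m q)) → WarpedSpace lam N)
    (z : EuclideanSpace ℝ (Fin (∑ q, m q))) {x : ∀ q, N q} (h : (F z).2 ∈ prodSource m x)
    (hr : 0 < ((F z).1 : ℝ))
    (himm : ∀ v, radialDeriv F K z v = 0 →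
      prodDeriv (m := m) x (fun z => (F z).2) K z v = 0 → v = 0)
    (hle : √(patchGram s g K F z).det ≤ areaFactor m s (F z).1 * (prodDensity g x (F z).2 *
        |(prodDeriv x (fun z => (F z).2) K z).det|)) :
    radialDeriv F K z = 0 := by
  rw [← sqrt_det_baseGram hs K F z h, patchGram_eq] at hle
  set C := baseGram (fun q => s q (F z).1) g K (fun z => (F z).2) z with hC
  set v : Fin (∑ q, m q) → ℝ := fun i => radialDeriv F K z (EuclideanSpace.single i 1) with hv
  have hCpsd : C.PosSemidef := posSemidef_baseGram _ g K _ z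
  have hlin : ∀ w : EuclideanSpace ℝ (Fin (∑ q, m q)), radialDeriv F K z w = v ⬝ᵥ w.ofLp := by
    intro w
    have h : w = ∑ i, w i • (EuclideanSpace.single i (1 : ℝ)) := by
      ext i; simp [Pi.single_apply]
    conv_lhs => rw [h]
    simp [dotProduct, hv, mul_comm]
  have hpd : (C + Matrix.vecMulVec v v).PosDef := by
    refine .of_dotProduct_mulVec_pos (hCpsd.isHermitian.add ?_) fun w hw => ?_
    · ext i j
      simp [Matrix.vecMulVec_apply, mul_comm]
    have hform := dotProduct_baseGram_mulVec (fun q => s q (F z).1) g K (fun z => (F z).2) z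
      (WithLp.toLp 2 w)
    rw [star_trivial, Matrix.add_mulVec, dotProduct_add]
    have h2 : w ⬝ᵥ (Matrix.vecMulVec v v).mulVec w = (v ⬝ᵥ w) ^ 2 := by
      rw [Matrix.vecMulVec_mulVec, dotProduct_smul, dotProduct_comm w v, sq]
      simp
    rw [h2]
    change w ⬝ᵥ C.mulVec w = _ at hform
    have hnn : ∀ q, 0 ≤ s q (F z).1 ^ 2 * (g q).inner ((F z).2 q)
        (mfderivWithin (𝓡 (∑ q, m q)) (𝓡 (m q)) (fun z => (F z).2 q) K z (WithLp.toLp 2 w))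
        (mfderivWithin (𝓡 (∑ q, m q)) (𝓡 (m q)) (fun z => (F z).2 q) K z (WithLp.toLp 2 w)) :=
      fun q => mul_nonneg (sq_nonneg _) (inner_self_nonneg' _ _ _)
    have hC0 : 0 ≤ w ⬝ᵥ C.mulVec w := hform ▸ Finset.sum_nonneg fun q _ => hnn q
    refine lt_of_le_of_ne (by positivity) fun h0 => hw ?_
    have hv0 : v ⬝ᵥ w = 0 := by nlinarith [sq_nonneg (v ⬝ᵥ w)]
    have hC1 : w ⬝ᵥ C.mulVec w = 0 := by nlinarith [sq_nonneg (v ⬝ᵥ w)]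
    rw [hC1] at hform
    have hz := (Finset.sum_eq_zero_iff_of_nonneg fun q _ => hnn q).1 hform.symm
    have hw0 : (WithLp.toLp 2 w : EuclideanSpace ℝ (Fin (∑ q, m q))) = 0 := by
      refine himm _ (by rw [hlin]; exact hv0) ?_
      ext i
      obtain ⟨a, rfl⟩ := finSigmaFinEquiv.surjective i
      rw [prodDeriv_apply]
      -- the factor `s_q` is positive because `N q` has positive dimension
      have hsq : s a.1 (F z).1 ≠ 0 := by
        intro h0
        have hne := (hA _ (F z).1.2 hr).ne'
        refine hne (Finset.prod_eq_zero (Finset.mem_univ a.1) ?_)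
        rw [h0, zero_pow]
        have := a.2.2
        omega
      have h3 : mfderivWithin (𝓡 (∑ q, m q)) (𝓡 (m a.1)) (fun z => (F z).2 a.1) K z
          (WithLp.toLp 2 w) = 0 := by
        by_contra hne
        have := (g a.1).pos _ _ hne
        have h4 := hz a.1 (Finset.mem_univ _)
        have : 0 < s a.1 (F z).1 ^ 2 := by positivity
        nlinarith
      erw [h3]
      simp
    simpa using congrArg WithLp.ofLp hw0
  have := eq_zero_of_det_add_vecMulVec_eq hCpsd hpd
    ((Real.sqrt_le_sqrt_iff hCpsd.det_nonneg).1 hle)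
  ext w
  rw [hlin, this]
  simp

/-- The derivative of a map into `M`, read in the product chart around `x`. -/
def warpedDeriv {k : ℕ} (x : ∀ q, N q) (F : EuclideanSpace ℝ (Fin k) → WarpedSpace lam N)
    (K : Set (EuclideanSpace ℝ (Fin k))) (z : EuclideanSpace ℝ (Fin k)) :
    EuclideanSpace ℝ (Fin k) →L[ℝ] EuclideanSpace ℝ (Fin ((∑ q, m q) + 1)) :=
  (consEquiv (∑ q, m q) : (ℝ × EuclideanSpace ℝ (Fin (∑ q, m q))) →L[ℝ] _).comp
    ((radialDeriv F K z).prod (prodDeriv x (fun z => (F z).2) K z))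

open Matrix in
/-- The volume density of a full-dimensional patch. -/
lemma sqrt_det_patchGram_full (hs : ∀ q, ∀ r ∈ radialInterval lam, 0 ≤ s q r)
    (K : Set (EuclideanSpace ℝ (Fin ((∑ q, m q) + 1))))
    (F : EuclideanSpace ℝ (Fin ((∑ q, m q) + 1)) → WarpedSpace lam N)
    (z : EuclideanSpace ℝ (Fin ((∑ q, m q) + 1))) {x : ∀ q, N q} (h : (F z).2 ∈ prodSource m x) :
    √(patchGram s g K F z).det = areaFactor m s (F z).1 * prodDensity g x (F z).2 *
        |(warpedDeriv x F K z).det| := by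
  let e : Unit ⊕ (Σ q, Fin (m q)) ≃ Fin ((∑ q, m q) + 1) :=
    (Equiv.sumComm _ _).trans ((finSigmaFinEquiv.sumCongr (Equiv.refl Unit)).trans
      ((Equiv.optionEquivSumPUnit _).symm.trans (finSuccEquiv _).symm))
  let D : Matrix (Unit ⊕ (Σ q, Fin (m q))) (Fin ((∑ q, m q) + 1)) ℝ := Matrix.of fun a i =>
    warpedDeriv x F K z (EuclideanSpace.single i 1) (e a)
  have he1 : ∀ a, e (Sum.inl a) = 0 := fun a => by simp [e]
  have he2 : ∀ a, e (Sum.inr a) = (finSigmaFinEquiv a).succ := fun a => by simp [e]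
  have h1 : patchGram s g K F z = Dᵀ * fromBlocks (1 : Matrix Unit Unit ℝ) 0 0
      (blockGram (fun q => s q (F z).1) g x (F z).2) * D := by
    ext i j
    rw [patchGram_eq, Matrix.add_apply, baseGram_apply _ g K (fun z => (F z).2) z h]
    simp only [Matrix.mul_apply, Fintype.sum_sum_type, Matrix.vecMulVec_apply, dotProduct_mulVec]
    simp [D, he1, he2, warpedDeriv, consEquiv_zero, consEquiv_succ, Matrix.vecMul, dotProduct,
      add_comm]
  have h2 : (D.submatrix e.symm id).det = (warpedDeriv x F K z).det := by
    rw [ContinuousLinearMap.det, ← LinearMap.det_toMatrix (EuclideanSpace.basisFun _ ℝ).toBasis]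
    congr 1
    ext i j
    simp [D, LinearMap.toMatrix_apply]
  rw [h1, det_transpose_mul_mul e, h2, det_fromBlocks_zero₂₁, det_one, one_mul,
    det_blockGram _ g h, ← mul_pow, Real.sqrt_sq_eq_abs, abs_mul, abs_mul,
    abs_of_pos (prodDensity_pos g h)]
  congr 2
  exact abs_of_nonneg (Finset.prod_nonneg fun q _ => pow_nonneg (hs q _ (F z).1.2) _)

end Patch

end ProductChart

/-! ### The Riemannian measure of the product of the base manifolds -/

lemma ContinuousOn.measurableSet_inter_preimage' {X Y : Type*} [TopologicalSpace X]
    [MeasurableSpace X] [OpensMeasurableSpace X] [TopologicalSpace Y] [MeasurableSpace Y]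
    [BorelSpace Y] {f : X → Y} {K : Set X} (hf : ContinuousOn f K) (hK : MeasurableSet K)
    {B : Set Y} (hB : MeasurableSet B) : MeasurableSet (K ∩ f ⁻¹' B) := by
  have h := (continuousOn_iff_continuous_domRestrict.1 hf).measurable hB
  have h2 := hK.subtype_image h
  convert h2 using 1
  ext x
  simp [and_comm]

section BaseMeasure

variable {p : ℕ} {m : Fin p → ℕ} {N : Fin p → Type*}
  [∀ q, TopologicalSpace (N q)] [∀ q, ChartedSpace (EuclideanSpace ℝ (Fin (m q))) (N q)]
  [∀ q, IsManifold (𝓡 (m q)) ∞ (N q)]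
  [∀ q, MeasurableSpace (N q)] [∀ q, BorelSpace (N q)] [∀ q, SecondCountableTopology (N q)]

lemma continuousOn_of_mdifferentiableOn_components {k : ℕ} {G : EuclideanSpace ℝ (Fin k) → ∀ q, N q}
    {K : Set (EuclideanSpace ℝ (Fin k))}
    (hG : ∀ q, MDifferentiableOn (𝓡 k) (𝓡 (m q)) (fun z => G z q) K) : ContinuousOn G K :=
  _root_.continuousOn_pi.2 fun q => (hG q).continuousOn

/-- The Riemannian measure on the domain of the product chart around `x`, extended by `0`. -/
def chartMeasure (g : ∀ q, SmoothMetric (m q) (N q)) (x : ∀ q, N q) : Measure (∀ q, N q) :=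
  ((volume.restrict (prodTarget m x)).withDensity
    fun w => ENNReal.ofReal (prodDensity g x (prodChartSymm m x w))).map (prodChartSymm m x)

lemma aemeasurable_prodChartSymm (x : ∀ q, N q) :
    AEMeasurable (prodChartSymm m x) (volume.restrict (prodTarget m x)) :=
  (continuousOn_prodChartSymm x).aemeasurable (isOpen_prodTarget x).measurableSet

lemma aemeasurable_prodDensity (g : ∀ q, SmoothMetric (m q) (N q)) (x : ∀ q, N q) :
    AEMeasurable (fun w => ENNReal.ofReal (prodDensity g x (prodChartSymm m x w)))
      (volume.restrict (prodTarget m x)) := by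
  refine ENNReal.measurable_ofReal.comp_aemeasurable ?_
  exact ((continuousOn_prodDensity g x).comp (continuousOn_prodChartSymm x)
    fun w hw => prodChartSymm_mem hw).aemeasurable (isOpen_prodTarget x).measurableSet

lemma lintegral_chartMeasure (g : ∀ q, SmoothMetric (m q) (N q)) (x : ∀ q, N q)
    {h : (∀ q, N q) → ℝ≥0∞} (hh : Measurable h) :
    ∫⁻ θ, h θ ∂chartMeasure g x = ∫⁻ w in prodTarget m x,
      ENNReal.ofReal (prodDensity g x (prodChartSymm m x w)) * h (prodChartSymm m x w) := by
  rw [chartMeasure, lintegral_map' hh.aemeasurable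
    ((aemeasurable_prodChartSymm x).mono_ac (withDensity_absolutelyContinuous _ _)),
    lintegral_withDensity_eq_lintegral_mul₀ (g := fun w => h (prodChartSymm m x w))
      (aemeasurable_prodDensity g x) (hh.comp_aemeasurable (aemeasurable_prodChartSymm x))]
  rfl

/-- The determinant factor of the change of variables for a map into `∏ q, N q`. -/
def baseJacobian (g : ∀ q, SmoothMetric (m q) (N q)) (K : Set (EuclideanSpace ℝ (Fin (∑ q, m q))))
    (G : EuclideanSpace ℝ (Fin (∑ q, m q)) → ∀ q, N q) (z : EuclideanSpace ℝ (Fin (∑ q, m q))) :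
    ℝ :=
  √(baseGram (fun _ => 1) g K G z).det

lemma baseJacobian_eq (g : ∀ q, SmoothMetric (m q) (N q))
    (K : Set (EuclideanSpace ℝ (Fin (∑ q, m q))))
    (G : EuclideanSpace ℝ (Fin (∑ q, m q)) → ∀ q, N q) (z : EuclideanSpace ℝ (Fin (∑ q, m q)))
    {x : ∀ q, N q} (h : G z ∈ prodSource m x) :
    baseJacobian g K G z = prodDensity g x (G z) * |(prodDeriv x G K z).det| := by
  rw [baseJacobian, det_baseGram _ g K G z h, Real.sqrt_sq_eq_abs, abs_mul, abs_mul,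
    abs_of_pos (prodDensity_pos g h)]
  simp

lemma measurableSet_image_of_subset_prodSource {K K' : Set (EuclideanSpace ℝ (Fin (∑ q, m q)))}
    {G : EuclideanSpace ℝ (Fin (∑ q, m q)) → ∀ q, N q}
    (hG : ∀ q, MDifferentiableOn (𝓡 (∑ q, m q)) (𝓡 (m q)) (fun z => G z q) K)
    (hK' : MeasurableSet K') (hsub : K' ⊆ K) (hinj : InjOn G K') {x : ∀ q, N q}
    (hx : MapsTo G K' (prodSource m x)) : MeasurableSet (G '' K') := by
  have hder : ∀ z ∈ K', HasFDerivWithinAt (fun z => prodChart m x (G z)) (prodDeriv x G K z) K' z :=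
    fun z hz => (hasFDerivWithinAt_prodChart_comp (fun q => hG q z (hsub hz)) (hx hz)).mono hsub
  have hinj' : InjOn (fun z => prodChart m x (G z)) K' := fun z hz z' hz' h => hinj hz hz' <| by
    rw [← prodChartSymm_prodChart (hx hz), ← prodChartSymm_prodChart (hx hz')]
    exact congrArg _ h
  have h1 := measurable_image_of_fderivWithin hK' hder hinj'
  have h2 : G '' K' = prodSource m x ∩
      prodChart m x ⁻¹' ((fun z => prodChart m x (G z)) '' K') := by
    ext θ
    constructor
    · rintro ⟨z, hz, rfl⟩
      exact ⟨hx hz, z, hz, rfl⟩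
    · rintro ⟨hθ, z, hz, h⟩
      refine ⟨z, hz, ?_⟩
      rw [← prodChartSymm_prodChart (hx hz), ← prodChartSymm_prodChart hθ]
      exact congrArg _ h
  rw [h2]
  exact (continuousOn_prodChart x).measurableSet_inter_preimage'
    (isOpen_prodSource x).measurableSet h1

/-- Change of variables for a map into the domain of a product chart. -/
lemma setLIntegral_chartMeasure_image (g : ∀ q, SmoothMetric (m q) (N q))
    {K K' : Set (EuclideanSpace ℝ (Fin (∑ q, m q)))}
    {G : EuclideanSpace ℝ (Fin (∑ q, m q)) → ∀ q, N q}
    (hG : ∀ q, MDifferentiableOn (𝓡 (∑ q, m q)) (𝓡 (m q)) (fun z => G z q) K)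
    (hK' : MeasurableSet K') (hsub : K' ⊆ K) (hinj : InjOn G K') {x : ∀ q, N q}
    (hx : MapsTo G K' (prodSource m x)) {h : (∀ q, N q) → ℝ≥0∞} (hh : Measurable h) :
    ∫⁻ θ in G '' K', h θ ∂chartMeasure g x =
      ∫⁻ z in K', h (G z) * ENNReal.ofReal (baseJacobian g K G z) := by
  have hder : ∀ z ∈ K', HasFDerivWithinAt (fun z => prodChart m x (G z)) (prodDeriv x G K z) K' z :=
    fun z hz => (hasFDerivWithinAt_prodChart_comp (fun q => hG q z (hsub hz)) (hx hz)).mono hsub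
  have hinj' : InjOn (fun z => prodChart m x (G z)) K' := fun z hz z' hz' h => hinj hz hz' <| by
    rw [← prodChartSymm_prodChart (hx hz), ← prodChartSymm_prodChart (hx hz')]
    exact congrArg _ h
  have hGK : MeasurableSet (G '' K') :=
    measurableSet_image_of_subset_prodSource hG hK' hsub hinj hx
  have hcov := lintegral_image_eq_lintegral_abs_det_fderiv_mul volume hK' hder hinj'
    (fun w => ENNReal.ofReal (prodDensity g x (prodChartSymm m x w)) * h (prodChartSymm m x w))
  rw [← lintegral_indicator hGK, lintegral_chartMeasure g x (hh.indicator hGK)]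
  have himg : (fun z => prodChart m x (G z)) '' K' ⊆ prodTarget m x := by
    rintro _ ⟨z, hz, rfl⟩
    exact prodChart_mem (hx hz)
  have e1 : ∫⁻ w in prodTarget m x, ENNReal.ofReal (prodDensity g x (prodChartSymm m x w)) *
      (G '' K').indicator h (prodChartSymm m x w) =
      ∫⁻ w in (fun z => prodChart m x (G z)) '' K',
        ENNReal.ofReal (prodDensity g x (prodChartSymm m x w)) * h (prodChartSymm m x w) := by
    rw [← inter_eq_self_of_subset_left himg, ← setLIntegral_indicator
      (measurable_image_of_fderivWithin hK' hder hinj')]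
    refine setLIntegral_congr_fun (isOpen_prodTarget x).measurableSet fun w hw => ?_
    have hiff : prodChartSymm m x w ∈ G '' K' ↔ w ∈ (fun z => prodChart m x (G z)) '' K' := by
      constructor
      · rintro ⟨z, hz, h⟩
        exact ⟨z, hz, by simp only [h, prodChart_prodChartSymm hw]⟩
      · rintro ⟨z, hz, rfl⟩
        exact ⟨z, hz, (prodChartSymm_prodChart (hx hz)).symm⟩
    by_cases hw' : w ∈ (fun z => prodChart m x (G z)) '' K'
    · simp only [indicator_of_mem hw', indicator_of_mem (hiff.2 hw')]
    · simp only [indicator_of_notMem hw', indicator_of_notMem (fun h => hw' (hiff.1 h)), mul_zero]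
  rw [e1, hcov]
  refine setLIntegral_congr_fun hK' fun z hz => ?_
  simp only [prodChartSymm_prodChart (hx hz)]
  rw [baseJacobian_eq g K G z (hx hz), ENNReal.ofReal_mul (prodDensity_pos g (hx hz)).le]
  ring

/-- The measures of two product charts agree on the common part of their domains. -/
lemma chartMeasure_apply_eq (g : ∀ q, SmoothMetric (m q) (N q)) (x y : ∀ q, N q)
    {B : Set (∀ q, N q)} (hB : MeasurableSet B) (hBx : B ⊆ prodSource m x)
    (hBy : B ⊆ prodSource m y) : chartMeasure g x B = chartMeasure g y B := by
  have hK : MeasurableSet (prodTarget m x ∩ prodChartSymm m x ⁻¹' B) :=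
    (continuousOn_prodChartSymm x).measurableSet_inter_preimage'
      (isOpen_prodTarget x).measurableSet hB
  have himg : prodChartSymm m x '' (prodTarget m x ∩ prodChartSymm m x ⁻¹' B) = B := by
    rw [image_inter_preimage]
    refine inter_eq_self_of_subset_right fun θ hθ => ?_
    exact ⟨_, prodChart_mem (hBx hθ), prodChartSymm_prodChart (hBx hθ)⟩
  have hinj : InjOn (prodChartSymm m x) (prodTarget m x ∩ prodChartSymm m x ⁻¹' B) := by
    intro w hw w' hw' h
    rw [← prodChart_prodChartSymm hw.1, ← prodChart_prodChartSymm hw'.1, h]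
  have key : ∀ y : ∀ q, N q, B ⊆ prodSource m y → _ := fun y hy =>
    setLIntegral_chartMeasure_image g (mdifferentiableOn_prodChartSymm x) hK inter_subset_left hinj
      (x := y) (fun w hw => hy hw.2) (h := fun _ => 1) measurable_const
  have h1 := (key x hBx).trans (key y hBy).symm
  rwa [himg, setLIntegral_one, setLIntegral_one] at h1

variable [∀ q, CompactSpace (N q)] [∀ q, T2Space (N q)]

lemma exists_nhds_chartMeasure_lt_top (g : ∀ q, SmoothMetric (m q) (N q)) (x : ∀ q, N q) :
    ∃ U, IsOpen U ∧ x ∈ U ∧ U ⊆ prodSource m x ∧ chartMeasure g x U < ⊤ := by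
  set d := prodDensity g x x + 1
  have h1 := (continuousOn_prodDensity g x).isOpen_inter_preimage (isOpen_prodSource x)
    (isOpen_Iio (a := d))
  have h2 := (continuousOn_prodChart x).isOpen_inter_preimage (isOpen_prodSource x)
    (Metric.isOpen_ball (x := prodChart m x x) (ε := 1))
  refine ⟨_, h1.inter h2, ⟨⟨mem_prodSource_self x, by simp [d]⟩, mem_prodSource_self x, by simp⟩,
    fun θ h => h.1.1, ?_⟩
  set U := (prodSource m x ∩ prodDensity g x ⁻¹' Iio d) ∩
    (prodSource m x ∩ prodChart m x ⁻¹' Metric.ball (prodChart m x x) 1)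
  have hU : MeasurableSet U := (h1.inter h2).measurableSet
  have e := lintegral_chartMeasure g x (h := U.indicator 1) (measurable_one.indicator hU)
  rw [lintegral_indicator_one hU] at e
  rw [e]
  calc ∫⁻ w in prodTarget m x, ENNReal.ofReal (prodDensity g x (prodChartSymm m x w)) *
        U.indicator 1 (prodChartSymm m x w)
      ≤ ∫⁻ w in prodTarget m x, (Metric.ball (prodChart m x x) 1).indicator
          (fun _ => ENNReal.ofReal d) w := by
        refine setLIntegral_mono' (isOpen_prodTarget x).measurableSet fun w hw => ?_
        by_cases hwU : prodChartSymm m x w ∈ U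
        · have hb : w ∈ Metric.ball (prodChart m x x) 1 := by
            have := hwU.2.2
            rwa [mem_preimage, prodChart_prodChartSymm hw] at this
          rw [indicator_of_mem hwU, indicator_of_mem hb, Pi.one_apply, mul_one]
          exact ENNReal.ofReal_le_ofReal (le_of_lt hwU.1.2)
        · simp [indicator_of_notMem hwU]
    _ ≤ ∫⁻ w, (Metric.ball (prodChart m x x) 1).indicator (fun _ => ENNReal.ofReal d) w :=
        setLIntegral_le_lintegral _ _
    _ < ⊤ := by
        rw [lintegral_indicator_const Metric.isOpen_ball.measurableSet]
        exact ENNReal.mul_lt_top ENNReal.ofReal_lt_top measure_ball_lt_top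

/-- The product is a finite disjoint union of measurable sets that lie in chart domains and have
finite measure. -/
lemma exists_finite_partition (g : ∀ q, SmoothMetric (m q) (N q)) :
    ∃ (k : ℕ) (c : Fin k → ∀ q, N q) (E : Fin k → Set (∀ q, N q)),
      (∀ i, MeasurableSet (E i)) ∧ Pairwise (fun i j => Disjoint (E i) (E j)) ∧ ⋃ i, E i = univ ∧
      ∀ i, E i ⊆ prodSource m (c i) ∧ chartMeasure g (c i) (E i) < ⊤ := by
  choose U hUo hUx hUs hUf using exists_nhds_chartMeasure_lt_top g
  obtain ⟨t, ht⟩ := CompactSpace.elim_nhds_subcover U fun x => (hUo x).mem_nhds (hUx x)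
  let e := t.equivFin
  refine ⟨t.card, fun i => (e.symm i : ∀ q, N q), disjointed fun i => U (e.symm i), fun i => ?_,
    disjoint_disjointed _, ?_, fun i => ⟨?_, ?_⟩⟩
  · exact disjointedRec (fun {s i} h => h.diff (hUo _).measurableSet) (hUo _).measurableSet
  · rw [iUnion_disjointed]
    refine eq_univ_of_univ_subset ?_
    rw [← top_eq_univ, ← ht]
    intro θ hθ
    simp only [mem_iUnion] at hθ ⊢
    obtain ⟨x, hx, h⟩ := hθ
    exact ⟨e ⟨x, hx⟩, by simpa using h⟩
  · exact (disjointed_le _ i).trans (hUs _)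
  · exact (measure_mono (disjointed_le _ i)).trans_lt (hUf _)

/-- The Riemannian measures on the chart domains glue to a finite measure. -/
lemma exists_baseMeasure (g : ∀ q, SmoothMetric (m q) (N q)) :
    ∃ ν : Measure (∀ q, N q), IsFiniteMeasure ν ∧ ∀ (x : ∀ q, N q) (B : Set (∀ q, N q)),
      MeasurableSet B → B ⊆ prodSource m x → ν B = chartMeasure g x B := by
  obtain ⟨k, c, E, hE, hd, hU, hc⟩ := exists_finite_partition g
  refine ⟨∑ i, (chartMeasure g (c i)).restrict (E i), ⟨?_⟩, fun x B hB hBx => ?_⟩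
  · simp only [Measure.coe_finsetSum, Finset.sum_apply, Measure.restrict_apply_univ]
    exact ENNReal.sum_lt_top.2 fun i _ => (hc i).2
  · simp only [Measure.coe_finsetSum, Finset.sum_apply]
    have h1 : B = ⋃ i, B ∩ E i := by rw [← inter_iUnion, hU, inter_univ]
    conv_rhs => rw [h1]
    rw [measure_iUnion (fun i j hij => (hd hij).mono inter_subset_right inter_subset_right)
      (fun i => hB.inter (hE i)), tsum_fintype]
    refine Finset.sum_congr rfl fun i _ => ?_
    rw [Measure.restrict_apply hB]
    exact chartMeasure_apply_eq g _ _ (hB.inter (hE i)) (inter_subset_right.trans (hc i).1)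
      (inter_subset_left.trans hBx)

/-- The Riemannian measure of the product `∏ q, N q` with the metric `∑ q, g_q`, characterized by
`baseMeasure_apply`. -/
def baseMeasure (g : ∀ q, SmoothMetric (m q) (N q)) : Measure (∀ q, N q) :=
  (exists_baseMeasure g).choose

instance (g : ∀ q, SmoothMetric (m q) (N q)) : IsFiniteMeasure (baseMeasure g) :=
  (exists_baseMeasure g).choose_spec.1

lemma baseMeasure_apply (g : ∀ q, SmoothMetric (m q) (N q)) (x : ∀ q, N q)
    {B : Set (∀ q, N q)} (hB : MeasurableSet B) (hBx : B ⊆ prodSource m x) :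
    baseMeasure g B = chartMeasure g x B :=
  (exists_baseMeasure g).choose_spec.2 x B hB hBx

lemma baseMeasure_restrict (g : ∀ q, SmoothMetric (m q) (N q)) (x : ∀ q, N q)
    {B : Set (∀ q, N q)} (hB : MeasurableSet B) (hBx : B ⊆ prodSource m x) :
    (baseMeasure g).restrict B = (chartMeasure g x).restrict B := by
  ext C hC
  rw [Measure.restrict_apply hC, Measure.restrict_apply hC]
  exact baseMeasure_apply g x (hC.inter hB) (inter_subset_right.trans hBx)

section ChangeOfVariables

variable (g : ∀ q, SmoothMetric (m q) (N q))
    {K K' : Set (EuclideanSpace ℝ (Fin (∑ q, m q)))}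
    {G : EuclideanSpace ℝ (Fin (∑ q, m q)) → ∀ q, N q}
    (hG : ∀ q, MDifferentiableOn (𝓡 (∑ q, m q)) (𝓡 (m q)) (fun z => G z q) K)
    (hK' : MeasurableSet K') (hsub : K' ⊆ K) (hinj : InjOn G K')

include g hG hK' hsub hinj

lemma measurableSet_image_base : MeasurableSet (G '' K') := by
  obtain ⟨k, c, E, hE, hd, hU, hc⟩ := exists_finite_partition g
  have hGc : ContinuousOn G K' := (continuousOn_of_mdifferentiableOn_components hG).mono hsub
  have h1 : G '' K' = ⋃ i, G '' (K' ∩ G ⁻¹' E i) := by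
    rw [← image_iUnion, ← inter_iUnion, ← preimage_iUnion, hU, preimage_univ, inter_univ]
  rw [h1]
  exact MeasurableSet.iUnion fun i => measurableSet_image_of_subset_prodSource hG
    (hGc.measurableSet_inter_preimage' hK' (hE i)) (inter_subset_left.trans hsub)
    (hinj.mono inter_subset_left) (fun z hz => (hc i).1 hz.2)

/-- Change of variables for an injective differentiable map into `∏ q, N q`. -/
lemma setLIntegral_baseMeasure_image {h : (∀ q, N q) → ℝ≥0∞} (hh : Measurable h) :
    ∫⁻ θ in G '' K', h θ ∂baseMeasure g =
      ∫⁻ z in K', h (G z) * ENNReal.ofReal (baseJacobian g K G z) := by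
  obtain ⟨k, c, E, hE, hd, hU, hc⟩ := exists_finite_partition g
  have hGc : ContinuousOn G K' := (continuousOn_of_mdifferentiableOn_components hG).mono hsub
  have hm : ∀ i, MeasurableSet (K' ∩ G ⁻¹' E i) := fun i =>
    hGc.measurableSet_inter_preimage' hK' (hE i)
  have hK'U : K' = ⋃ i, K' ∩ G ⁻¹' E i := by
    rw [← inter_iUnion, ← preimage_iUnion, hU, preimage_univ, inter_univ]
  have hm2 : ∀ i, MeasurableSet (G '' (K' ∩ G ⁻¹' E i)) := fun i =>
    measurableSet_image_of_subset_prodSource hG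
      (hm i) (inter_subset_left.trans hsub) (hinj.mono inter_subset_left)
      (fun z hz => (hc i).1 hz.2)
  conv_lhs => rw [hK'U]
  conv_rhs => rw [hK'U]
  rw [image_iUnion, lintegral_iUnion hm2, lintegral_iUnion hm]
  · refine tsum_congr fun i => ?_
    have hi : G '' (K' ∩ G ⁻¹' E i) ⊆ prodSource m (c i) := by
      rintro _ ⟨z, hz, rfl⟩
      exact (hc i).1 hz.2
    rw [baseMeasure_restrict g (c i) (hm2 i) hi]
    exact setLIntegral_chartMeasure_image g hG (hm i) (inter_subset_left.trans hsub)
      (hinj.mono inter_subset_left) (fun z hz => (hc i).1 hz.2) hh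
  · exact fun i j hij => ((hd hij).preimage G).mono inter_subset_right inter_subset_right
  · intro i j hij
    refine (hd hij).mono ?_ ?_ <;>
    · rintro _ ⟨z, hz, rfl⟩
      exact hz.2

end ChangeOfVariables

end BaseMeasure

/-! ### The volume of the warped product and the area of coordinate slices -/

lemma measurableSet_radialInterval (lam : EReal) : MeasurableSet (radialInterval lam) :=
  measurableSet_Ici.inter (measurable_coe_real_ereal measurableSet_Iio)

lemma zero_mem_radialInterval {lam : EReal} (hlam : 0 < lam) : (0 : ℝ) ∈ radialInterval lam :=
  ⟨le_rfl, by simpa using hlam⟩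

instance ordConnected_radialInterval (lam : EReal) : (radialInterval lam).OrdConnected :=
  ⟨fun _ hx _ hy _ hz => ⟨hx.1.trans hz.1, (EReal.coe_le_coe_iff.2 hz.2).trans_lt hy.2⟩⟩

/-- A real number as a point of `[0, lam)`, with the value `0` outside of the interval. -/
def toRadial {lam : EReal} (hlam : 0 < lam) (r : ℝ) : radialInterval lam :=
  open Classical in if h : r ∈ radialInterval lam then ⟨r, h⟩ else ⟨0, zero_mem_radialInterval hlam⟩

lemma toRadial_of_mem {lam : EReal} (hlam : 0 < lam) {r : ℝ} (h : r ∈ radialInterval lam) :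
    toRadial hlam r = ⟨r, h⟩ := dif_pos h

lemma continuousOn_toRadial {lam : EReal} (hlam : 0 < lam) :
    ContinuousOn (toRadial hlam) (radialInterval lam) :=
  Topology.IsInducing.subtypeVal.continuousOn_iff.2 <| continuousOn_id.congr fun r hr => by
    simp [toRadial_of_mem hlam hr]

lemma measurePreserving_consEquiv (n : ℕ) : MeasurePreserving (consEquiv n) := by
  have h1 := (EuclideanSpace.volume_preserving_symm_measurableEquiv_toLp (Fin n))
  have h2 := (volume_preserving_piFinSuccAbove (fun _ : Fin (n + 1) => ℝ) 0).symm
  have h3 := (EuclideanSpace.volume_preserving_symm_measurableEquiv_toLp (Fin (n + 1))).symm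
  have h4 := h3.comp (h2.comp ((MeasurePreserving.id (volume : Measure ℝ)).prod h1))
  convert h4 using 1
  · ext w i
    refine Fin.cases ?_ (fun i => ?_) i <;> rfl
  · rfl

section Volume

variable {p : ℕ} {m : Fin p → ℕ} {lam : EReal} {N : Fin p → Type*}
  [∀ q, TopologicalSpace (N q)] [∀ q, ChartedSpace (EuclideanSpace ℝ (Fin (m q))) (N q)]
  [∀ q, IsManifold (𝓡 (m q)) ∞ (N q)]
  [∀ q, MeasurableSpace (N q)] [∀ q, BorelSpace (N q)] [∀ q, SecondCountableTopology (N q)]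

lemma continuousOn_areaFactor {s : Fin p → ℝ → ℝ}
    (hs : ∀ q, ContinuousOn (s q) (radialInterval lam)) :
    ContinuousOn (areaFactor m s) (radialInterval lam) :=
  continuousOn_finsetProd _ fun q _ => (hs q).pow _

lemma areaFactor_nonneg {s : Fin p → ℝ → ℝ} (hs : ∀ q, ∀ r ∈ radialInterval lam, 0 ≤ s q r)
    {r : ℝ} (hr : r ∈ radialInterval lam) : 0 ≤ areaFactor m s r :=
  Finset.prod_nonneg fun q _ => pow_nonneg (hs q r hr) _

lemma IsPatch.continuousOn {k : ℕ} {S : Set (WarpedSpace lam N)}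
    {K : Set (EuclideanSpace ℝ (Fin k))} {F : EuclideanSpace ℝ (Fin k) → WarpedSpace lam N}
    (hF : IsPatch m S K F) : ContinuousOn F K := by
  refine ContinuousOn.prodMk ?_
    (continuousOn_of_mdifferentiableOn_components hF.differentiable_base)
  exact Topology.IsInducing.subtypeVal.continuousOn_iff.2 hF.differentiable_radial.continuousOn

lemma IsPatch.mono {k : ℕ} {S S' : Set (WarpedSpace lam N)}
    {K : Set (EuclideanSpace ℝ (Fin k))} {F : EuclideanSpace ℝ (Fin k) → WarpedSpace lam N}
    (hF : IsPatch m S K F) (h : S ⊆ S') : IsPatch m S' K F :=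
  ⟨hF.1, hF.2, hF.3.mono_right h, hF.4, hF.5⟩

lemma patchMeasure_apply (s : Fin p → ℝ → ℝ) (g : ∀ q, SmoothMetric (m q) (N q)) {k : ℕ}
    {S : Set (WarpedSpace lam N)}
    {K : Set (EuclideanSpace ℝ (Fin k))} {F : EuclideanSpace ℝ (Fin k) → WarpedSpace lam N}
    (hF : IsPatch m S K F) {B : Set (WarpedSpace lam N)} (hB : MeasurableSet B) :
    patchMeasure s g K F B =
      ∫⁻ z in K ∩ F ⁻¹' B, ENNReal.ofReal (√(patchGram s g K F z).det) := by
  have hm : AEMeasurable F (volume.restrict K) := hF.continuousOn.aemeasurable hF.measurableSet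
  have hn : NullMeasurableSet (F ⁻¹' B) (volume.restrict K) := hm.nullMeasurableSet_preimage hB
  rw [patchMeasure, Measure.map_apply_of_aemeasurable
    (hm.mono_ac (withDensity_absolutelyContinuous _ _)) hB, withDensity_apply₀ _ hn,
    Measure.restrict_restrict₀ hn, inter_comm]

lemma patchMeasure_le_riemannianMeasure (s : Fin p → ℝ → ℝ) (g : ∀ q, SmoothMetric (m q) (N q))
    {k : ℕ} {S : Set (WarpedSpace lam N)}
    {K : Set (EuclideanSpace ℝ (Fin k))} {F : EuclideanSpace ℝ (Fin k) → WarpedSpace lam N}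
    (hF : IsPatch m S K F) : patchMeasure s g K F ≤ riemannianMeasure s g k S :=
  le_iSup_of_le K <| le_iSup_of_le F <| le_iSup_of_le hF le_rfl

lemma riemannianMeasure_le_of_forall_patch {s : Fin p → ℝ → ℝ} {g : ∀ q, SmoothMetric (m q) (N q)}
    {k : ℕ} {S : Set (WarpedSpace lam N)} {μ : Measure (WarpedSpace lam N)}
    (h : ∀ (K : Set (EuclideanSpace ℝ (Fin k)))
      (F : EuclideanSpace ℝ (Fin k) → WarpedSpace lam N), IsPatch m S K F →
      ∀ B, MeasurableSet B →
      ∫⁻ z in K ∩ F ⁻¹' B, ENNReal.ofReal (√(patchGram s g K F z).det) ≤ μ B) :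
    riemannianMeasure s g k S ≤ μ := by
  refine iSup_le fun K => iSup_le fun F => iSup_le fun hF => Measure.le_iff.2 fun B hB => ?_
  rw [patchMeasure_apply s g hF hB]
  exact h K F hF B hB

lemma riemannianMeasure_mono (s : Fin p → ℝ → ℝ) (g : ∀ q, SmoothMetric (m q) (N q)) (k : ℕ)
    {S S' : Set (WarpedSpace lam N)} (h : S ⊆ S') :
    riemannianMeasure s g k S ≤ riemannianMeasure s g k S' :=
  iSup_mono fun _ => iSup_mono fun _ => iSup_mono' fun hF => ⟨hF.mono h, le_rfl⟩

variable [∀ q, CompactSpace (N q)] [∀ q, T2Space (N q)]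

/-- The area measure of a coordinate slice is at most `A(R)` times the measure of the base. -/
lemma riemannianMeasure_slice_le {s : Fin p → ℝ → ℝ} (g : ∀ q, SmoothMetric (m q) (N q))
    (hs : ∀ q, ∀ r ∈ radialInterval lam, 0 ≤ s q r) (R : radialInterval lam) :
    riemannianMeasure s g (∑ q, m q) (slice lam N R) ≤
      ENNReal.ofReal (areaFactor m s R) • (baseMeasure g).map fun θ => (R, θ) := by
  refine riemannianMeasure_le_of_forall_patch fun K F hF B hB => ?_
  have hR : ∀ z ∈ K, (F z).1 = R := fun z hz => Subtype.ext (hF.mapsTo hz)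
  have hinj : InjOn (fun z => (F z).2) K := fun z hz z' hz' h =>
    hF.injOn hz hz' (Prod.ext ((hR z hz).trans (hR z' hz').symm) h)
  have hdens : ∀ z ∈ K, √(patchGram s g K F z).det = areaFactor m s R *
      baseJacobian g K (fun z => (F z).2) z := by
    intro z hz
    rw [sqrt_det_patchGram_of_radialDeriv_eq_zero hs K F z (mem_prodSource_self (F z).2),
      baseJacobian_eq g K (fun z => (F z).2) z (mem_prodSource_self (F z).2), hR z hz]
    rw [radialDeriv, fderivWithin_congr (f := fun _ => (R : ℝ)) (fun w hw => by rw [hR w hw])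
      (by rw [hR z hz])]
    exact fderivWithin_const_apply _
  have hm : MeasurableSet (K ∩ F ⁻¹' B) :=
    hF.continuousOn.measurableSet_inter_preimage' hF.measurableSet hB
  have hcov := setLIntegral_baseMeasure_image g (G := fun z => (F z).2) hF.differentiable_base hm
    inter_subset_left (hinj.mono inter_subset_left) (h := fun _ => 1) measurable_const
  rw [Measure.smul_apply, Measure.map_apply (by fun_prop) hB, smul_eq_mul]
  calc ∫⁻ z in K ∩ F ⁻¹' B, ENNReal.ofReal (√(patchGram s g K F z).det)
      = ∫⁻ z in K ∩ F ⁻¹' B, ENNReal.ofReal (areaFactor m s R) *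
          (1 * ENNReal.ofReal (baseJacobian g K (fun z => (F z).2) z)) := by
        refine setLIntegral_congr_fun hm fun z hz => ?_
        simp only [hdens z hz.1, one_mul]
        rw [ENNReal.ofReal_mul (areaFactor_nonneg hs R.2)]
    _ = ENNReal.ofReal (areaFactor m s R) *
          baseMeasure g ((fun z => (F z).2) '' (K ∩ F ⁻¹' B)) := by
        rw [lintegral_const_mul' _ _ ENNReal.ofReal_ne_top, ← hcov, setLIntegral_one]
    _ ≤ _ := by
        gcongr
        rintro _ ⟨z, hz, rfl⟩
        have := hz.2
        rw [mem_preimage, ← hR z hz.1]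
        exact this

/-- The radial part `A(r) dr` of the volume. -/
def radialMeasure (lam : EReal) (m : Fin p → ℕ) (s : Fin p → ℝ → ℝ) :
    Measure (radialInterval lam) :=
  (Measure.comap Subtype.val (volume : Measure ℝ)).withDensity
    fun r => ENNReal.ofReal (areaFactor m s r)

lemma measurable_ofReal_areaFactor {s : Fin p → ℝ → ℝ}
    (hs : ∀ q, ContinuousOn (s q) (radialInterval lam)) :
    Measurable fun r : radialInterval lam => ENNReal.ofReal (areaFactor m s r) :=
  ENNReal.measurable_ofReal.comp
    (continuousOn_iff_continuous_domRestrict.1 (continuousOn_areaFactor hs)).measurable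

instance (s : Fin p → ℝ → ℝ) : SFinite (radialMeasure lam m s) := by
  have : SFinite (Measure.comap Subtype.val (volume : Measure ℝ) :
      Measure (radialInterval lam)) := by
    have : SigmaFinite ((Measure.comap Subtype.val (volume : Measure ℝ) :
        Measure (radialInterval lam)).map Subtype.val) := by
      rw [map_comap_subtype_coe (measurableSet_radialInterval lam)]
      infer_instance
    have := SigmaFinite.of_map _ measurable_subtype_coe.aemeasurable this
    infer_instance
  unfold radialMeasure
  infer_instance

/-- The product chart of `M` around a point over `x`. -/
def warpedChart (m : Fin p → ℕ) [∀ q, ChartedSpace (EuclideanSpace ℝ (Fin (m q))) (N q)]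
    (x : ∀ q, N q) (y : WarpedSpace lam N) : EuclideanSpace ℝ (Fin ((∑ q, m q) + 1)) :=
  consEquiv (∑ q, m q) ((y.1 : ℝ), prodChart m x y.2)

lemma continuousOn_warpedChart (x : ∀ q, N q) : ContinuousOn (warpedChart m x)
    {y : WarpedSpace lam N | y.2 ∈ prodSource m x} := by
  refine (consEquiv _).continuous.comp_continuousOn (ContinuousOn.prodMk (by fun_prop) ?_)
  exact (continuousOn_prodChart x).comp continuous_snd.continuousOn fun y hy => hy

lemma injOn_warpedChart (x : ∀ q, N q) : InjOn (warpedChart m x)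
    {y : WarpedSpace lam N | y.2 ∈ prodSource m x} := by
  intro y hy y' hy' h
  have h1 := Prod.ext_iff.1 ((consEquiv _).injective h)
  refine Prod.ext (Subtype.ext h1.1) ?_
  rw [← prodChartSymm_prodChart hy, ← prodChartSymm_prodChart hy']
  exact congrArg _ h1.2

/-- The measure of a set in the domain of a product chart of `M`, computed in the chart. -/
lemma prod_apply_of_subset_prodSource {s : Fin p → ℝ → ℝ} (g : ∀ q, SmoothMetric (m q) (N q))
    (hs_cont : ∀ q, ContinuousOn (s q) (radialInterval lam))
    (x : ∀ q, N q) {B : Set (WarpedSpace lam N)} (hB : MeasurableSet B)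
    (hBx : ∀ y ∈ B, y.2 ∈ prodSource m x) (hI : MeasurableSet (warpedChart m x '' B)) :
    ((radialMeasure lam m s).prod (baseMeasure g)) B = ∫⁻ v in warpedChart m x '' B,
      ENNReal.ofReal (areaFactor m s (v 0)) * ENNReal.ofReal (prodDensity g x (prodChartSymm m x
        ((consEquiv (∑ q, m q)).symm v).2)) := by
  set I := warpedChart m x '' B with hIdef
  set f : ℝ × EuclideanSpace ℝ (Fin (∑ q, m q)) → ℝ≥0∞ := fun w =>
    ENNReal.ofReal (areaFactor m s w.1) *
      (ENNReal.ofReal (prodDensity g x (prodChartSymm m x w.2)) *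
        I.indicator 1 (consEquiv (∑ q, m q) w)) with hf
  have hmem : ∀ (r : radialInterval lam) (w), w ∈ prodTarget m x →
      ((r, prodChartSymm m x w) ∈ B ↔ consEquiv (∑ q, m q) ((r : ℝ), w) ∈ I) := by
    intro r w hw
    constructor
    · intro h
      exact ⟨_, h, by simp only [warpedChart, prodChart_prodChartSymm hw]⟩
    · rintro ⟨y, hy, h⟩
      have h1 := Prod.ext_iff.1 ((consEquiv _).injective h)
      have h2 : y.1 = r := Subtype.ext h1.1
      have h3 : prodChart m x y.2 = w := h1.2
      rw [← h2, ← h3, prodChartSymm_prodChart (hBx y hy)]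
      exact hy
  have hsupp : ∀ w, consEquiv (∑ q, m q) w ∈ I → w ∈ radialInterval lam ×ˢ prodTarget m x := by
    rintro w ⟨y, hy, h⟩
    rw [← (consEquiv _).injective h]
    exact ⟨y.1.2, prodChart_mem (hBx y hy)⟩
  -- integrate over the fibres `{r} × ∏ q, N q`
  have e1 : ((radialMeasure lam m s).prod (baseMeasure g)) B =
      ∫⁻ r in radialInterval lam, ∫⁻ w in prodTarget m x, f (r, w) := by
    rw [Measure.prod_apply hB, radialMeasure, lintegral_withDensity_eq_lintegral_mul _
      (measurable_ofReal_areaFactor hs_cont) (measurable_measure_prodMk_left hB),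
      ← lintegral_subtype_comap (measurableSet_radialInterval lam)]
    refine lintegral_congr fun r => ?_
    have hBr : MeasurableSet (Prod.mk r ⁻¹' B) := hB.preimage measurable_prodMk_left
    rw [Pi.mul_apply, baseMeasure_apply g x hBr fun θ hθ => hBx _ hθ, ← lintegral_indicator_one hBr,
      lintegral_chartMeasure g x (measurable_one.indicator hBr)]
    simp only [hf]
    rw [lintegral_const_mul' _ _ ENNReal.ofReal_ne_top]
    congr 1
    refine setLIntegral_congr_fun (isOpen_prodTarget x).measurableSet fun w hw => ?_
    congr 1
    by_cases h : (r, prodChartSymm m x w) ∈ B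
    · rw [indicator_of_mem ((hmem r w hw).1 h), indicator_of_mem (by exact h)]
      rfl
    · rw [indicator_of_notMem (fun h' => h ((hmem r w hw).2 h')), indicator_of_notMem (by exact h)]
  have hfm : AEMeasurable f ((volume.restrict (radialInterval lam)).prod
      (volume.restrict (prodTarget m x))) := by
    have h1 : AEMeasurable (fun r => ENNReal.ofReal (areaFactor m s r))
        (volume.restrict (radialInterval lam)) := ENNReal.measurable_ofReal.comp_aemeasurable
      ((continuousOn_areaFactor hs_cont).aemeasurable (measurableSet_radialInterval lam))
    have h3 : Measurable fun w : ℝ × EuclideanSpace ℝ (Fin (∑ q, m q)) =>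
        I.indicator (1 : EuclideanSpace ℝ (Fin ((∑ q, m q) + 1)) → ℝ≥0∞) (consEquiv (∑ q, m q) w) :=
      (measurable_one.indicator hI).comp (consEquiv _).continuous.measurable
    exact h1.comp_fst.mul ((aemeasurable_prodDensity g x).comp_snd.mul h3.aemeasurable)
  rw [e1, ← lintegral_prod _ hfm, Measure.prod_restrict, ← lintegral_indicator hI,
    ← (measurePreserving_consEquiv _).lintegral_comp_emb
      (consEquiv (∑ q, m q)).toHomeomorph.measurableEmbedding, ← lintegral_indicator
      ((measurableSet_radialInterval lam).prod (isOpen_prodTarget x).measurableSet)]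
  refine lintegral_congr fun w => ?_
  by_cases h : consEquiv (∑ q, m q) w ∈ I
  · rw [indicator_of_mem (hsupp w h), indicator_of_mem h]
    simp only [hf, indicator_of_mem h, Pi.one_apply, mul_one, consEquiv_zero,
      ContinuousLinearEquiv.symm_apply_apply]
  · rw [indicator_of_notMem h]
    by_cases hw : w ∈ radialInterval lam ×ˢ prodTarget m x
    · rw [indicator_of_mem hw]
      simp only [hf, indicator_of_notMem h, mul_zero]
    · rw [indicator_of_notMem hw]

/-- Change of variables for a full-dimensional patch in the domain of a product chart of `M`. -/
lemma prod_image_patch {s : Fin p → ℝ → ℝ} (g : ∀ q, SmoothMetric (m q) (N q))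
    (hs_cont : ∀ q, ContinuousOn (s q) (radialInterval lam))
    (hs : ∀ q, ∀ r ∈ radialInterval lam, 0 ≤ s q r)
    {K K' : Set (EuclideanSpace ℝ (Fin ((∑ q, m q) + 1)))}
    {F : EuclideanSpace ℝ (Fin ((∑ q, m q) + 1)) → WarpedSpace lam N}
    (hF : IsPatch m univ K F) (hK' : MeasurableSet K') (hsub : K' ⊆ K) {x : ∀ q, N q}
    (hx : ∀ z ∈ K', (F z).2 ∈ prodSource m x) :
    MeasurableSet (F '' K') ∧ ((radialMeasure lam m s).prod (baseMeasure g)) (F '' K') =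
      ∫⁻ z in K', ENNReal.ofReal (√(patchGram s g K F z).det) := by
  have hder : ∀ z ∈ K', HasFDerivWithinAt (fun z => warpedChart m x (F z)) (warpedDeriv x F K z)
      K' z := by
    intro z hz
    refine HasFDerivWithinAt.mono ?_ hsub
    refine (consEquiv _).hasFDerivAt.comp_hasFDerivWithinAt z (HasFDerivWithinAt.prodMk ?_ ?_)
    · exact (hF.differentiable_radial z (hsub hz)).hasFDerivWithinAt
    · exact hasFDerivWithinAt_prodChart_comp (fun q => hF.differentiable_base q z (hsub hz))
        (hx z hz)
  have hinj : InjOn (fun z => warpedChart m x (F z)) K' := fun z hz z' hz' h =>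
    hF.injOn (hsub hz) (hsub hz') (injOn_warpedChart x (hx z hz) (hx z' hz') h)
  have hI : MeasurableSet ((fun z => warpedChart m x (F z)) '' K') :=
    measurable_image_of_fderivWithin hK' hder hinj
  have himg : warpedChart m x '' (F '' K') = (fun z => warpedChart m x (F z)) '' K' :=
    image_image _ _ _
  have hmeas : MeasurableSet (F '' K') := by
    have h2 : F '' K' = {y : WarpedSpace lam N | y.2 ∈ prodSource m x} ∩
        warpedChart m x ⁻¹' ((fun z => warpedChart m x (F z)) '' K') := by
      ext y
      constructor
      · rintro ⟨z, hz, rfl⟩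
        exact ⟨hx z hz, z, hz, rfl⟩
      · rintro ⟨hy, z, hz, h⟩
        exact ⟨z, hz, injOn_warpedChart x (hx z hz) hy h⟩
    rw [h2]
    exact (continuousOn_warpedChart x).measurableSet_inter_preimage'
      ((isOpen_prodSource x).measurableSet.preimage measurable_snd) hI
  refine ⟨hmeas, ?_⟩
  rw [prod_apply_of_subset_prodSource g hs_cont x hmeas (by rintro _ ⟨z, hz, rfl⟩; exact hx z hz)
    (himg ▸ hI), himg, lintegral_image_eq_lintegral_abs_det_fderiv_mul volume hK' hder hinj]
  refine setLIntegral_congr_fun hK' fun z hz => ?_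
  simp only [warpedChart, ContinuousLinearEquiv.symm_apply_apply, consEquiv_zero,
    prodChartSymm_prodChart (hx z hz)]
  rw [sqrt_det_patchGram_full hs K F z (hx z hz), mul_comm,
    ENNReal.ofReal_mul (mul_nonneg (areaFactor_nonneg hs (F z).1.2)
      (prodDensity_pos g (hx z hz)).le),
    ENNReal.ofReal_mul (areaFactor_nonneg hs (F z).1.2)]

/-- The volume measure of `M` is the product of `A(r) dr` and the measure of the base. -/
theorem riemannianMeasure_univ (hlam : 0 < lam) {s : Fin p → ℝ → ℝ}
    (g : ∀ q, SmoothMetric (m q) (N q))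
    (hs_cont : ∀ q, ContinuousOn (s q) (radialInterval lam))
    (hs : ∀ q, ∀ r ∈ radialInterval lam, 0 ≤ s q r) :
    riemannianMeasure s g ((∑ q, m q) + 1) univ =
      (radialMeasure lam m s).prod (baseMeasure g) := by
  obtain ⟨k, c, E, hE, hd, hU, hc⟩ := exists_finite_partition g
  have hEm : ∀ i, MeasurableSet (Prod.snd ⁻¹' E i : Set (WarpedSpace lam N)) :=
    fun i => (hE i).preimage measurable_snd
  have hsplit : ∀ B : Set (WarpedSpace lam N), B = ⋃ i, B ∩ Prod.snd ⁻¹' E i := fun B => by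
    rw [← inter_iUnion, ← preimage_iUnion, hU, preimage_univ, inter_univ]
  have hdis : ∀ B : Set (WarpedSpace lam N),
      Pairwise (fun i j => Disjoint (B ∩ Prod.snd ⁻¹' E i) (B ∩ Prod.snd ⁻¹' E j)) :=
    fun B i j hij => ((hd hij).preimage _).mono inter_subset_right inter_subset_right
  apply le_antisymm
  · refine riemannianMeasure_le_of_forall_patch fun K F hF B hB => ?_
    have hm : ∀ i, MeasurableSet (K ∩ F ⁻¹' (B ∩ Prod.snd ⁻¹' E i)) := fun i =>
      hF.continuousOn.measurableSet_inter_preimage' hF.measurableSet (hB.inter (hEm i))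
    have hKB : K ∩ F ⁻¹' B = ⋃ i, K ∩ F ⁻¹' (B ∩ Prod.snd ⁻¹' E i) := by
      rw [← inter_iUnion, ← preimage_iUnion, ← hsplit B]
    conv_rhs => rw [hsplit B]
    rw [hKB, lintegral_iUnion hm, measure_iUnion (hdis B) fun i => hB.inter (hEm i)]
    · refine ENNReal.tsum_le_tsum fun i => ?_
      rw [← (prod_image_patch g hs_cont hs hF (hm i) inter_subset_left
        fun z hz => (hc i).1 hz.2.2).2]
      refine measure_mono ?_
      rintro _ ⟨z, hz, rfl⟩
      exact hz.2
    · exact fun i j hij => ((hdis B hij).preimage F).mono inter_subset_right inter_subset_right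
  · refine Measure.le_iff.2 fun B hB => ?_
    conv_lhs => rw [hsplit B]
    conv_rhs => rw [hsplit B]
    rw [measure_iUnion (hdis B) fun i => hB.inter (hEm i),
      measure_iUnion (hdis B) fun i => hB.inter (hEm i)]
    refine ENNReal.tsum_le_tsum fun i => ?_
    -- the inverse of the product chart is a patch
    set K : Set (EuclideanSpace ℝ (Fin ((∑ q, m q) + 1))) :=
      (consEquiv (∑ q, m q)).symm ⁻¹' (radialInterval lam ×ˢ prodTarget m (c i)) with hK
    set F : EuclideanSpace ℝ (Fin ((∑ q, m q) + 1)) → WarpedSpace lam N := fun v =>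
      (toRadial hlam ((consEquiv (∑ q, m q)).symm v).1,
        prodChartSymm m (c i) ((consEquiv (∑ q, m q)).symm v).2) with hF
    have hrad : ∀ v ∈ K, ((F v).1 : ℝ) = ((consEquiv (∑ q, m q)).symm v).1 := fun v hv => by
      simp only [hF, toRadial_of_mem hlam hv.1]
    have hinv : ∀ v ∈ K, warpedChart m (c i) (F v) = v := fun v hv => by
      rw [warpedChart, hrad v hv, prodChart_prodChartSymm hv.2]
      exact (consEquiv _).apply_symm_apply v
    have hpatch : IsPatch m (univ : Set (WarpedSpace lam N)) K F := by
      refine ⟨?_, fun v hv v' hv' h => ?_, fun v _ => mem_univ _, ?_, fun q => ?_⟩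
      · exact ((measurableSet_radialInterval lam).prod (isOpen_prodTarget _).measurableSet).preimage
          (consEquiv _).symm.continuous.measurable
      · rw [← hinv v hv, ← hinv v' hv', h]
      · refine DifferentiableOn.congr (f := fun v => ((consEquiv (∑ q, m q)).symm v).1) ?_ hrad
        fun_prop
      · have h1 := mdifferentiableOn_prodChartSymm (m := m) (c i) q
        have h2 : MDifferentiable (𝓡 ((∑ q, m q) + 1)) (𝓡 (∑ q, m q))
            (fun v => ((consEquiv (∑ q, m q)).symm v).2) := by
          apply Differentiable.mdifferentiable
          fun_prop
        exact h1.comp h2.mdifferentiableOn fun v hv => hv.2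
    have hm : MeasurableSet (K ∩ F ⁻¹' (B ∩ Prod.snd ⁻¹' E i)) :=
      hpatch.continuousOn.measurableSet_inter_preimage' hpatch.measurableSet (hB.inter (hEm i))
    have himg : F '' (K ∩ F ⁻¹' (B ∩ Prod.snd ⁻¹' E i)) = B ∩ Prod.snd ⁻¹' E i := by
      rw [image_inter_preimage]
      refine inter_eq_self_of_subset_right fun y hy => ?_
      have hy2 := (hc i).1 hy.2
      refine ⟨warpedChart m (c i) y, ⟨?_, ?_⟩, ?_⟩
      · simp [warpedChart]
      · simpa [warpedChart] using prodChart_mem hy2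
      · simp only [hF, warpedChart, ContinuousLinearEquiv.symm_apply_apply,
          prodChartSymm_prodChart hy2, toRadial_of_mem hlam y.1.2]
    rw [← himg, (prod_image_patch g hs_cont hs hpatch hm inter_subset_left
        fun z hz => (hc i).1 hz.2.2).2, himg, ← patchMeasure_apply s g hpatch (hB.inter (hEm i))]
    exact patchMeasure_le_riemannianMeasure s g hpatch _

end Volume

/-! ### Lipschitz hypersurfaces -/

lemma volume_image_eq_zero_of_lipschitzWith {n : ℕ}
    {w : EuclideanSpace ℝ (Fin n) → EuclideanSpace ℝ (Fin n)} {L : ℝ≥0} (hw : LipschitzWith L w)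
    {Z : Set (EuclideanSpace ℝ (Fin n))} (hZ : volume Z = 0) : volume (w '' Z) = 0 := by
  have hH := isAddHaarMeasure_hausdorffMeasure (E := EuclideanSpace ℝ (Fin n))
  have h1 := Measure.absolutelyContinuous_isAddHaarMeasure
    (μH[Module.finrank ℝ (EuclideanSpace ℝ (Fin n))] : Measure (EuclideanSpace ℝ (Fin n))) volume hZ
  refine Measure.absolutelyContinuous_isAddHaarMeasure volume
    (μH[Module.finrank ℝ (EuclideanSpace ℝ (Fin n))] : Measure (EuclideanSpace ℝ (Fin n))) ?_
  refine le_antisymm ((hw.hausdorffMeasure_image_le (Nat.cast_nonneg _) Z).trans ?_) zero_le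
  rw [h1, mul_zero]

/-- A measure is dominated by another one as soon as this holds locally around the points of a set
of full measure. -/
lemma measure_le_of_locally {X : Type*} [TopologicalSpace X] [SecondCountableTopology X]
    [MeasurableSpace X] {μ ν : Measure X} {S : Set X} (hS : μ Sᶜ = 0)
    (h : ∀ x ∈ S, ∃ V ∈ 𝓝 x, MeasurableSet V ∧ ∀ B ⊆ V, MeasurableSet B → μ B ≤ ν B) :
    μ ≤ ν := by
  choose! V hVx hVm hV using h
  obtain ⟨t, htS, htc, ht⟩ := TopologicalSpace.countable_cover_nhdsWithin
    (f := V) (s := S) fun x hx => mem_nhdsWithin_of_mem_nhds (hVx x hx)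
  refine Measure.le_iff.2 fun B hB => ?_
  rcases t.eq_empty_or_nonempty with rfl | hne
  · have hSe : S = ∅ := by simpa using ht
    have : μ B = 0 := measure_mono_null (fun _ _ => by simp [hSe]) hS
    rw [this]
    exact zero_le
  obtain ⟨c, rfl⟩ := htc.exists_eq_range hne
  have hc : ∀ n, c n ∈ S := fun n => htS ⟨n, rfl⟩
  have hD : ∀ n, MeasurableSet (disjointed (fun n => V (c n)) n) := fun n =>
    disjointedRec (fun {s i} h => h.diff (hVm _ (hc i))) (hVm _ (hc n))
  have hU : S ⊆ ⋃ n, disjointed (fun n => V (c n)) n := by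
    rw [iUnion_disjointed]
    simpa using ht
  calc μ B ≤ μ ((⋃ n, B ∩ disjointed (fun n => V (c n)) n) ∪ Sᶜ) := by
        refine measure_mono fun y hy => ?_
        by_cases hyS : y ∈ S
        · rw [← inter_iUnion]
          exact Or.inl ⟨hy, hU hyS⟩
        · exact Or.inr hyS
    _ ≤ μ (⋃ n, B ∩ disjointed (fun n => V (c n)) n) + 0 := hS ▸ measure_union_le _ _
    _ ≤ ∑' n, μ (B ∩ disjointed (fun n => V (c n)) n) := by
        rw [add_zero]
        exact measure_iUnion_le _
    _ ≤ ∑' n, ν (B ∩ disjointed (fun n => V (c n)) n) := ENNReal.tsum_le_tsum fun n =>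
        hV _ (hc n) _ (inter_subset_right.trans (disjointed_le _ n)) (hB.inter (hD n))
    _ = ν (⋃ n, B ∩ disjointed (fun n => V (c n)) n) :=
        (measure_iUnion (fun i j hij => (disjoint_disjointed _ hij).mono inter_subset_right
          inter_subset_right) fun n => hB.inter (hD n)).symm
    _ ≤ ν B := measure_mono (iUnion_subset fun _ => inter_subset_left)

lemma IsPreconnected.subset_or_disjoint_closure {X : Type*} [TopologicalSpace X] {J Ω : Set X}
    (hJ : IsPreconnected J) (hΩ : IsOpen Ω) (h : ∀ y ∈ J, y ∉ frontier Ω) :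
    J ⊆ Ω ∨ J ⊆ (closure Ω)ᶜ := by
  refine hJ.subset_or_subset hΩ isClosed_closure.isOpen_compl
    (disjoint_compl_right.mono_left subset_closure) fun y hy => ?_
  by_contra hc
  rw [mem_union, not_or, mem_compl_iff, not_not] at hc
  exact h y hy (hΩ.frontier_eq ▸ ⟨hc.2, hc.1⟩)

section Graph

variable {p : ℕ} {m : Fin p → ℕ} {lam : EReal} {N : Fin p → Type*}
  [∀ q, TopologicalSpace (N q)] [∀ q, ChartedSpace (EuclideanSpace ℝ (Fin (m q))) (N q)]

/-- The radial coordinate of the point over `z` of the graph of `f`, with respect to the coordinates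
that `T` gives on `ℝ × ∏ q, ℝ^{m q}`. -/
def graphRadius (T : (ℝ × (∀ q, EuclideanSpace ℝ (Fin (m q)))) ≃L[ℝ]
      (EuclideanSpace ℝ (Fin (∑ q, m q)) × ℝ)) (f : EuclideanSpace ℝ (Fin (∑ q, m q)) → ℝ)
    (z : EuclideanSpace ℝ (Fin (∑ q, m q))) : ℝ := (T.symm (z, f z)).1

/-- The coordinates in the base of the point over `z` of the graph of `f`. -/
def graphBase (T : (ℝ × (∀ q, EuclideanSpace ℝ (Fin (m q)))) ≃L[ℝ]
      (EuclideanSpace ℝ (Fin (∑ q, m q)) × ℝ)) (f : EuclideanSpace ℝ (Fin (∑ q, m q)) → ℝ)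
    (z : EuclideanSpace ℝ (Fin (∑ q, m q))) : EuclideanSpace ℝ (Fin (∑ q, m q)) :=
  coordEquiv m (T.symm (z, f z)).2

/-- The point over `z` of the graph of `f`, as a point of `M` in the chart around `x`. -/
def graphMap (hlam : 0 < lam) (x : ∀ q, N q)
    (T : (ℝ × (∀ q, EuclideanSpace ℝ (Fin (m q)))) ≃L[ℝ]
      (EuclideanSpace ℝ (Fin (∑ q, m q)) × ℝ)) (f : EuclideanSpace ℝ (Fin (∑ q, m q)) → ℝ)
    (z : EuclideanSpace ℝ (Fin (∑ q, m q))) : WarpedSpace lam N :=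
  (toRadial hlam (graphRadius T f z), prodChartSymm m x (graphBase T f z))

/-- The points of the coordinate space over which the graph of `f` meets the set `V`. -/
def graphDomain (hlam : 0 < lam) (x : ∀ q, N q)
    (T : (ℝ × (∀ q, EuclideanSpace ℝ (Fin (m q)))) ≃L[ℝ]
      (EuclideanSpace ℝ (Fin (∑ q, m q)) × ℝ)) (f : EuclideanSpace ℝ (Fin (∑ q, m q)) → ℝ)
    (V : Set (WarpedSpace lam N)) : Set (EuclideanSpace ℝ (Fin (∑ q, m q))) :=
  {z | graphRadius T f z ∈ radialInterval lam ∧ graphBase T f z ∈ prodTarget m x} ∩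
    graphMap hlam x T f ⁻¹' V

/-- A neighbourhood `V` of the boundary point `x` in which `Ω` lies on one side of the graph
of `f`. -/
structure IsGraphNhd (x : WarpedSpace lam N) (Ω V : Set (WarpedSpace lam N))
    (T : (ℝ × (∀ q, EuclideanSpace ℝ (Fin (m q)))) ≃L[ℝ]
      (EuclideanSpace ℝ (Fin (∑ q, m q)) × ℝ)) (f : EuclideanSpace ℝ (Fin (∑ q, m q)) → ℝ)
    (L : ℝ≥0) : Prop where
  lipschitz : LipschitzWith L f
  isOpen : IsOpen V
  mem : x ∈ V
  source : ∀ y ∈ V, y.2 ∈ prodSource m x.2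
  mem_iff : ∀ y ∈ V, y ∈ Ω ↔ (T (warpedCoord m x y)).2 < f (T (warpedCoord m x y)).1
  frontier_iff : ∀ y ∈ V,
    y ∈ frontier Ω ↔ (T (warpedCoord m x y)).2 = f (T (warpedCoord m x y)).1

lemma IsLipschitzBoundaryAt.exists_isGraphNhd {Ω : Set (WarpedSpace lam N)} {x : WarpedSpace lam N}
    (h : IsLipschitzBoundaryAt m Ω x) : ∃ V T f L, IsGraphNhd (m := m) x Ω V T f L := by
  obtain ⟨T, f, L, hf, hev⟩ := h
  have hsrc : ∀ᶠ y in 𝓝 x, y.2 ∈ prodSource m x.2 :=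
    continuous_snd.continuousAt.eventually
      ((isOpen_prodSource x.2).mem_nhds (mem_prodSource_self _))
  obtain ⟨V, hV, hVo, hxV⟩ := eventually_nhds_iff.1 (hev.and hsrc)
  exact ⟨V, T, f, L, hf, hVo, hxV, fun y hy => (hV y hy).2, fun y hy => (hV y hy).1.1,
    fun y hy => (hV y hy).1.2⟩

variable {x : WarpedSpace lam N} {Ω V : Set (WarpedSpace lam N)}
  {T : (ℝ × (∀ q, EuclideanSpace ℝ (Fin (m q)))) ≃L[ℝ] (EuclideanSpace ℝ (Fin (∑ q, m q)) × ℝ)}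
  {f : EuclideanSpace ℝ (Fin (∑ q, m q)) → ℝ} {L : ℝ≥0}

lemma exists_lipschitzWith_graph (hf : LipschitzWith L f) :
    (∃ L', LipschitzWith L' (graphRadius T f)) ∧ ∃ L', LipschitzWith L' (graphBase T f) := by
  have h1 : LipschitzWith _ fun z => T.symm (z, f z) :=
    T.symm.lipschitz.comp (LipschitzWith.id.prodMk hf)
  exact ⟨⟨_, LipschitzWith.prod_fst.comp h1⟩,
    ⟨_, (coordEquiv m).lipschitz.comp (LipschitzWith.prod_snd.comp h1)⟩⟩

lemma differentiableAt_graph {z : EuclideanSpace ℝ (Fin (∑ q, m q))}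
    (hz : DifferentiableAt ℝ f z) :
    DifferentiableAt ℝ (graphRadius T f) z ∧ DifferentiableAt ℝ (graphBase T f) z := by
  unfold graphRadius graphBase
  constructor <;> fun_prop

lemma warpedCoord_graphMap {hlam : 0 < lam} {z : EuclideanSpace ℝ (Fin (∑ q, m q))}
    (hz : graphRadius T f z ∈ radialInterval lam ∧ graphBase T f z ∈ prodTarget m x.2) :
    T (warpedCoord m x (graphMap hlam x.2 T f z)) = (z, f z) := by
  rw [← ContinuousLinearEquiv.eq_symm_apply]
  refine Prod.ext ?_ ?_
  · simp only [warpedCoord, graphMap, toRadial_of_mem hlam hz.1]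
    rfl
  · have h := congrArg (coordEquiv m).symm (prodChart_prodChartSymm hz.2)
    rw [prodChart, ContinuousLinearEquiv.symm_apply_apply, graphBase,
      ContinuousLinearEquiv.symm_apply_apply] at h
    exact h

lemma graphRadius_warpedCoord {y : WarpedSpace lam N}
    (hy : (T (warpedCoord m x y)).2 = f (T (warpedCoord m x y)).1) :
    graphRadius T f (T (warpedCoord m x y)).1 = y.1 ∧
      graphBase T f (T (warpedCoord m x y)).1 = prodChart m x.2 y.2 := by
  unfold graphRadius graphBase
  rw [← hy]
  simp [warpedCoord, prodChart]

namespace IsGraphNhd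

variable (hG : IsGraphNhd (m := m) x Ω V T f L) (hlam : 0 < lam)

include hG

lemma mem_graphDomain {y : WarpedSpace lam N} (hyV : y ∈ V) (hy : y ∈ frontier Ω) :
    (T (warpedCoord m x y)).1 ∈ graphDomain hlam x.2 T f V ∧
      graphMap hlam x.2 T f (T (warpedCoord m x y)).1 = y := by
  obtain ⟨h1, h2⟩ := graphRadius_warpedCoord ((hG.frontier_iff y hyV).1 hy)
  have h3 : graphMap hlam x.2 T f (T (warpedCoord m x y)).1 = y := by
    rw [graphMap, h1, h2, toRadial_of_mem hlam y.1.2, prodChartSymm_prodChart (hG.source y hyV)]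
  refine ⟨⟨⟨?_, ?_⟩, ?_⟩, h3⟩
  · rw [h1]
    exact y.1.2
  · rw [h2]
    exact prodChart_mem (hG.source y hyV)
  · rw [mem_preimage, h3]
    exact hyV

lemma graphMap_mem {z} (hz : z ∈ graphDomain hlam x.2 T f V) :
    graphMap hlam x.2 T f z ∈ frontier Ω := by
  rw [hG.frontier_iff _ hz.2, warpedCoord_graphMap hz.1]

lemma injOn_graphMap : InjOn (graphMap hlam x.2 T f) (graphDomain hlam x.2 T f V) := by
  intro z hz z' hz' h
  have h1 := warpedCoord_graphMap (hlam := hlam) hz.1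
  rw [h, warpedCoord_graphMap hz'.1] at h1
  exact (congrArg Prod.fst h1).symm

lemma continuousOn_graphMap : ContinuousOn (graphMap hlam x.2 T f)
    {z | graphRadius T f z ∈ radialInterval lam ∧ graphBase T f z ∈ prodTarget m x.2} := by
  obtain ⟨⟨_, h1⟩, ⟨_, h2⟩⟩ := exists_lipschitzWith_graph (T := T) hG.lipschitz
  refine ContinuousOn.prodMk (Topology.IsInducing.subtypeVal.continuousOn_iff.2 ?_) ?_
  · exact h1.continuous.continuousOn.congr fun z hz => by
      simp only [Function.comp_apply, toRadial_of_mem hlam hz.1]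
  · exact (continuousOn_prodChartSymm x.2).comp h2.continuous.continuousOn fun z hz => hz.2

lemma coe_graphMap_fst {z} (hz : z ∈ graphDomain hlam x.2 T f V) :
    ((graphMap hlam x.2 T f z).1 : ℝ) = graphRadius T f z := by
  simp only [graphMap, toRadial_of_mem hlam hz.1.1]

lemma prodChart_graphMap {z} (hz : z ∈ graphDomain hlam x.2 T f V) :
    prodChart m x.2 (graphMap hlam x.2 T f z).2 = graphBase T f z :=
  prodChart_prodChartSymm hz.1.2

variable [∀ q, IsManifold (𝓡 (m q)) ∞ (N q)]
  [∀ q, MeasurableSpace (N q)] [∀ q, BorelSpace (N q)] [∀ q, SecondCountableTopology (N q)]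

lemma measurableSet_graphDomain : MeasurableSet (graphDomain hlam x.2 T f V) := by
  obtain ⟨⟨_, h1⟩, ⟨_, h2⟩⟩ := exists_lipschitzWith_graph (T := T) hG.lipschitz
  refine (hG.continuousOn_graphMap hlam).measurableSet_inter_preimage' ?_ hG.isOpen.measurableSet
  exact ((measurableSet_radialInterval lam).preimage h1.continuous.measurable).inter
    ((isOpen_prodTarget x.2).measurableSet.preimage h2.continuous.measurable)

/-- The part of the graph over the points of differentiability of `f` is a patch. -/
lemma isPatch : IsPatch m (frontier Ω)
    (graphDomain hlam x.2 T f V ∩ {z | DifferentiableAt ℝ f z}) (graphMap hlam x.2 T f) := by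
  refine ⟨(hG.measurableSet_graphDomain hlam).inter (measurableSet_of_differentiableAt ℝ f),
    (hG.injOn_graphMap hlam).mono inter_subset_left, fun z hz => hG.graphMap_mem hlam hz.1,
    ?_, fun q => ?_⟩
  · refine DifferentiableOn.congr (f := graphRadius T f) (fun z hz => ?_)
      fun z hz => hG.coe_graphMap_fst hlam hz.1
    exact (differentiableAt_graph hz.2).1.differentiableWithinAt
  · refine (mdifferentiableOn_prodChartSymm (m := m) x.2 q).comp (fun z hz => ?_)
      (fun z hz => hz.1.1.2)
    exact (differentiableAt_graph hz.2).2.differentiableWithinAt.mdifferentiableWithinAt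

variable [∀ q, CompactSpace (N q)] [∀ q, T2Space (N q)]

/-- The points over which `f` is not differentiable project to a null set of the base. -/
lemma baseMeasure_image_not_differentiable (g : ∀ q, SmoothMetric (m q) (N q)) :
    baseMeasure g ((fun z => (graphMap hlam x.2 T f z).2) ''
      (graphDomain hlam x.2 T f V \ {z | DifferentiableAt ℝ f z})) = 0 := by
  obtain ⟨_, ⟨_, h2⟩⟩ := exists_lipschitzWith_graph (T := T) hG.lipschitz
  have h3 := volume_image_eq_zero_of_lipschitzWith h2 hG.lipschitz.ae_differentiableAt
  set Z := toMeasurable volume (graphBase T f '' {z | DifferentiableAt ℝ f z}ᶜ) with hZ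
  have hZm : MeasurableSet Z := measurableSet_toMeasurable _ _
  have hZ0 : volume Z = 0 := by rw [hZ, measure_toMeasurable]; exact h3
  have hsub : (fun z => (graphMap hlam x.2 T f z).2) ''
      (graphDomain hlam x.2 T f V \ {z | DifferentiableAt ℝ f z}) ⊆
      prodSource m x.2 ∩ prodChart m x.2 ⁻¹' Z := by
    rintro _ ⟨z, hz, rfl⟩
    refine ⟨prodChartSymm_mem hz.1.1.2, ?_⟩
    rw [mem_preimage, hG.prodChart_graphMap hlam hz.1]
    exact subset_toMeasurable _ _ ⟨z, hz.2, rfl⟩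
  refine measure_mono_null hsub ?_
  have hB : MeasurableSet (prodSource m x.2 ∩ prodChart m x.2 ⁻¹' Z) :=
    (continuousOn_prodChart x.2).measurableSet_inter_preimage'
      (isOpen_prodSource x.2).measurableSet hZm
  rw [baseMeasure_apply g x.2 hB inter_subset_left, ← lintegral_indicator_one hB,
    lintegral_chartMeasure g x.2 (measurable_one.indicator hB)]
  refine (lintegral_eq_zero_of_ae_eq_zero ?_)
  have : ∀ᵐ w ∂volume.restrict (prodTarget m x.2), w ∉ Z :=
    ae_restrict_of_ae (measure_eq_zero_iff_ae_notMem.1 hZ0)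
  filter_upwards [this, ae_restrict_mem (isOpen_prodTarget x.2).measurableSet] with w hw hwt
  rw [indicator_of_notMem, mul_zero, Pi.zero_apply]
  rintro ⟨_, h⟩
  rw [mem_preimage, prodChart_prodChartSymm hwt] at h
  exact hw h

end IsGraphNhd

end Graph

/-! ### Comparison of the area measure with the measure of a graph over the base -/

section GraphMeasure

variable {p : ℕ} {m : Fin p → ℕ} {lam : EReal} {N : Fin p → Type*}
  [∀ q, TopologicalSpace (N q)] [∀ q, ChartedSpace (EuclideanSpace ℝ (Fin (m q))) (N q)]
  [∀ q, IsManifold (𝓡 (m q)) ∞ (N q)]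
  [∀ q, MeasurableSpace (N q)] [∀ q, BorelSpace (N q)] [∀ q, SecondCountableTopology (N q)]
  [∀ q, CompactSpace (N q)] [∀ q, T2Space (N q)]

/-- The measure `A(u) dν` on the graph of a function `u` on the base. -/
def graphMeasure (s : Fin p → ℝ → ℝ) (g : ∀ q, SmoothMetric (m q) (N q))
    (u : (∀ q, N q) → radialInterval lam) : Measure (WarpedSpace lam N) :=
  ((baseMeasure g).withDensity fun θ => ENNReal.ofReal (areaFactor m s (u θ))).map
    fun θ => (u θ, θ)

variable {s : Fin p → ℝ → ℝ} {g : ∀ q, SmoothMetric (m q) (N q)}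
  {u : (∀ q, N q) → radialInterval lam}

lemma graphMeasure_apply (hu : Measurable u) {B : Set (WarpedSpace lam N)} (hB : MeasurableSet B) :
    graphMeasure s g u B =
      ∫⁻ θ in (fun θ => (u θ, θ)) ⁻¹' B, ENNReal.ofReal (areaFactor m s (u θ)) ∂baseMeasure g := by
  have hm : Measurable fun θ => (u θ, θ) := hu.prodMk measurable_id
  rw [graphMeasure, Measure.map_apply hm hB, withDensity_apply _ (hm hB)]

lemma lintegral_graphMeasure (hs_cont : ∀ q, ContinuousOn (s q) (radialInterval lam))
    (hu : Measurable u) {h : WarpedSpace lam N → ℝ≥0∞} (hh : Measurable h) :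
    ∫⁻ y, h y ∂graphMeasure s g u =
      ∫⁻ θ, ENNReal.ofReal (areaFactor m s (u θ)) * h (u θ, θ) ∂baseMeasure g := by
  have hm : Measurable fun θ => (u θ, θ) := hu.prodMk measurable_id
  have hA : Measurable fun θ => ENNReal.ofReal (areaFactor m s (u θ)) :=
    (measurable_ofReal_areaFactor hs_cont).comp hu
  rw [graphMeasure, lintegral_map hh hm, lintegral_withDensity_eq_lintegral_mul _ hA
    (g := fun θ => h (u θ, θ)) (hh.comp hm)]
  rfl

lemma IsPatch.injOn_snd_of_graph {k : ℕ} {S : Set (WarpedSpace lam N)}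
    {K : Set (EuclideanSpace ℝ (Fin k))} {F : EuclideanSpace ℝ (Fin k) → WarpedSpace lam N}
    (hF : IsPatch m S K F) : InjOn (fun z => (F z).2) (K ∩ {z | (F z).1 = u (F z).2}) := by
  intro z hz z' hz' h
  refine hF.injOn hz.1 hz'.1 (Prod.ext ?_ h)
  have h' : (F z).2 = (F z').2 := h
  rw [show (F z).1 = u (F z).2 from hz.2, show (F z').1 = u (F z').2 from hz'.2, h']

variable {Ω V : Set (WarpedSpace lam N)}

/-- The part of a hypersurface patch that lies on the graph of `u`, measured by its projection to
the base. -/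
lemma setLIntegral_patch_graph (hs_cont : ∀ q, ContinuousOn (s q) (radialInterval lam))
    (hs : ∀ q, ∀ r ∈ radialInterval lam, 0 ≤ s q r)
    (hu : Measurable u) {S : Set (WarpedSpace lam N)}
    {K : Set (EuclideanSpace ℝ (Fin (∑ q, m q)))}
    {F : EuclideanSpace ℝ (Fin (∑ q, m q)) → WarpedSpace lam N} (hF : IsPatch m S K F)
    {B : Set (WarpedSpace lam N)} (hB : MeasurableSet B) :
    MeasurableSet (K ∩ F ⁻¹' B ∩ {z | (F z).1 = u (F z).2}) ∧
      MeasurableSet ((fun z => (F z).2) '' (K ∩ F ⁻¹' B ∩ {z | (F z).1 = u (F z).2})) ∧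
      ∫⁻ θ in (fun z => (F z).2) '' (K ∩ F ⁻¹' B ∩ {z | (F z).1 = u (F z).2}),
        ENNReal.ofReal (areaFactor m s (u θ)) ∂baseMeasure g =
      ∫⁻ z in K ∩ F ⁻¹' B ∩ {z | (F z).1 = u (F z).2}, ENNReal.ofReal (areaFactor m s (F z).1 *
        baseJacobian g K (fun z => (F z).2) z) := by
  have hΓ : MeasurableSet {y : WarpedSpace lam N | y.1 = u y.2} :=
    measurableSet_eq_fun measurable_fst (hu.comp measurable_snd)
  have hK' : MeasurableSet (K ∩ F ⁻¹' B ∩ {z | (F z).1 = u (F z).2}) := by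
    rw [inter_assoc]
    exact hF.continuousOn.measurableSet_inter_preimage' hF.measurableSet (hB.inter hΓ)
  have hsub : K ∩ F ⁻¹' B ∩ {z | (F z).1 = u (F z).2} ⊆ K := fun z hz => hz.1.1
  have hinj : InjOn (fun z => (F z).2) (K ∩ F ⁻¹' B ∩ {z | (F z).1 = u (F z).2}) :=
    (hF.injOn_snd_of_graph (u := u)).mono (inter_subset_inter_left _ inter_subset_left)
  refine ⟨hK', measurableSet_image_base g (G := fun z => (F z).2) hF.differentiable_base hK'
    hsub hinj, ?_⟩
  have hA : Measurable fun θ => ENNReal.ofReal (areaFactor m s (u θ)) :=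
    (measurable_ofReal_areaFactor hs_cont).comp hu
  rw [setLIntegral_baseMeasure_image g (G := fun z => (F z).2) hF.differentiable_base hK' hsub hinj
    hA]
  refine setLIntegral_congr_fun hK' fun z hz => ?_
  rw [ENNReal.ofReal_mul (areaFactor_nonneg hs (F z).1.2),
    show (F z).1 = u (F z).2 from hz.2]

/-- If `∂Ω` is a Lipschitz graph in `V`, then the measure of the part of the graph of `u` in `V` is
at most the integral of `A` times the Jacobian of the projection to the base: by the theorem of
Rademacher, the points of non-differentiability do not contribute. -/
lemma graphMeasure_le_setLIntegral (hlam : 0 < lam)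
    (hs_cont : ∀ q, ContinuousOn (s q) (radialInterval lam))
    (hs : ∀ q, ∀ r ∈ radialInterval lam, 0 ≤ s q r)
    (hu : Measurable u) (hfr : ∀ θ, (u θ, θ) ∈ frontier Ω) {x : WarpedSpace lam N}
    {T f L} (hG : IsGraphNhd (m := m) x Ω V T f L) {B : Set (WarpedSpace lam N)} (hBV : B ⊆ V)
    (hB : MeasurableSet B) :
    graphMeasure s g u B ≤
      ∫⁻ z in graphDomain hlam x.2 T f V ∩ {z | DifferentiableAt ℝ f z} ∩
        graphMap hlam x.2 T f ⁻¹' B,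
        ENNReal.ofReal (areaFactor m s (graphMap hlam x.2 T f z).1 * baseJacobian g
          (graphDomain hlam x.2 T f V ∩ {z | DifferentiableAt ℝ f z})
          (fun z => (graphMap hlam x.2 T f z).2) z) := by
  set F := graphMap hlam x.2 T f with hFdef
  set K := graphDomain hlam x.2 T f V ∩ {z | DifferentiableAt ℝ f z} with hK
  have hF : IsPatch m (frontier Ω) K F := hG.isPatch hlam
  set K' := K ∩ F ⁻¹' B ∩ {z | (F z).1 = u (F z).2} with hK'
  obtain ⟨hK'm, himg, hint⟩ := setLIntegral_patch_graph (g := g) hs_cont hs hu hF hB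
  -- the remaining part of the graph of `u` in `B` projects to a null set
  set Z := (fun z => (F z).2) '' (graphDomain hlam x.2 T f V \ {z | DifferentiableAt ℝ f z})
  have hZ : baseMeasure g Z = 0 := hG.baseMeasure_image_not_differentiable hlam g
  have hcover : (fun θ => (u θ, θ)) ⁻¹' B ⊆ (fun z => (F z).2) '' K' ∪ Z := by
    intro θ hθ
    obtain ⟨h1, h2⟩ := hG.mem_graphDomain hlam (hBV hθ) (hfr θ)
    set z := (T (warpedCoord m x (u θ, θ))).1
    have h3 : F z = (u θ, θ) := h2
    by_cases hz : DifferentiableAt ℝ f z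
    · left
      refine ⟨z, ?_, by simp only [h3]⟩
      refine ⟨⟨⟨h1, hz⟩, ?_⟩, ?_⟩
      · rw [mem_preimage, h3]; exact hθ
      · rw [mem_ofPred_eq, h3]
    · right
      exact ⟨z, ⟨h1, hz⟩, by simp only [h3]⟩
  rw [graphMeasure_apply hu hB]
  calc ∫⁻ θ in (fun θ => (u θ, θ)) ⁻¹' B, ENNReal.ofReal (areaFactor m s (u θ)) ∂baseMeasure g
      ≤ ∫⁻ θ in (fun z => (F z).2) '' K' ∪ Z,
          ENNReal.ofReal (areaFactor m s (u θ)) ∂baseMeasure g := lintegral_mono_set hcover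
    _ ≤ ∫⁻ θ in (fun z => (F z).2) '' K', ENNReal.ofReal (areaFactor m s (u θ)) ∂baseMeasure g +
          ∫⁻ θ in Z, ENNReal.ofReal (areaFactor m s (u θ)) ∂baseMeasure g :=
        lintegral_union_le _ _ _
    _ = ∫⁻ θ in (fun z => (F z).2) '' K', ENNReal.ofReal (areaFactor m s (u θ)) ∂baseMeasure g := by
        rw [setLIntegral_measure_zero _ _ hZ, add_zero]
    _ = ∫⁻ z in K', ENNReal.ofReal (areaFactor m s (F z).1 *
          baseJacobian g K (fun z => (F z).2) z) := hint
    _ ≤ _ := lintegral_mono_set inter_subset_left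

/-- The area density of a hypersurface patch dominates that of its projection to the base. -/
lemma areaFactor_mul_baseJacobian_le (hs : ∀ q, ∀ r ∈ radialInterval lam, 0 ≤ s q r)
    (K : Set (EuclideanSpace ℝ (Fin (∑ q, m q))))
    (F : EuclideanSpace ℝ (Fin (∑ q, m q)) → WarpedSpace lam N)
    (z : EuclideanSpace ℝ (Fin (∑ q, m q))) :
    areaFactor m s (F z).1 * baseJacobian g K (fun z => (F z).2) z ≤
      √(patchGram s g K F z).det := by
  rw [baseJacobian_eq g K (fun z => (F z).2) z (mem_prodSource_self (F z).2)]
  exact le_sqrt_det_patchGram hs K F z (mem_prodSource_self (F z).2)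

/-- If `∂Ω` is a Lipschitz graph in `V`, then its area in `V` dominates the measure of the part of
the graph of `u` in `V`. -/
lemma graphMeasure_le_of_subset (hlam : 0 < lam)
    (hs_cont : ∀ q, ContinuousOn (s q) (radialInterval lam))
    (hs : ∀ q, ∀ r ∈ radialInterval lam, 0 ≤ s q r)
    (hu : Measurable u) (hfr : ∀ θ, (u θ, θ) ∈ frontier Ω) {x : WarpedSpace lam N}
    {T f L} (hG : IsGraphNhd (m := m) x Ω V T f L) {B : Set (WarpedSpace lam N)} (hBV : B ⊆ V)
    (hB : MeasurableSet B) :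
    graphMeasure s g u B ≤ riemannianMeasure s g (∑ q, m q) (frontier Ω) B := by
  refine (graphMeasure_le_setLIntegral hlam hs_cont hs hu hfr hG hBV hB).trans ?_
  have hF := hG.isPatch hlam
  refine (lintegral_mono fun z => ENNReal.ofReal_le_ofReal
    (areaFactor_mul_baseJacobian_le hs _ _ z)).trans ?_
  rw [← patchMeasure_apply s g hF hB]
  exact patchMeasure_le_riemannianMeasure s g hF B

/-- The area measure of `∂Ω` dominates the measure `A(u) dν` on the graph of a function `u` on the
base whose graph lies in `∂Ω`. -/
theorem graphMeasure_le (hlam : 0 < lam)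
    (hs_cont : ∀ q, ContinuousOn (s q) (radialInterval lam))
    (hs : ∀ q, ∀ r ∈ radialInterval lam, 0 ≤ s q r) (hΩ : HasLipschitzBoundary m s Ω)
    (hu : Measurable u) (hfr : ∀ θ, (u θ, θ) ∈ frontier Ω) :
    graphMeasure s g u ≤ riemannianMeasure s g (∑ q, m q) (frontier Ω) := by
  have hA : Continuous fun y : WarpedSpace lam N => areaFactor m s y.1 :=
    (continuousOn_iff_continuous_domRestrict.1 (continuousOn_areaFactor (m := m) hs_cont)).comp
      continuous_fst
  refine measure_le_of_locally (S := frontier Ω ∩ {y | areaFactor m s y.1 ≠ 0}) ?_ ?_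
  · have hSm : MeasurableSet (frontier Ω ∩ {y : WarpedSpace lam N | areaFactor m s y.1 ≠ 0}) :=
      isClosed_frontier.measurableSet.inter (hA.measurable (measurableSet_singleton 0).compl)
    rw [graphMeasure_apply hu hSm.compl]
    refine (setLIntegral_congr_fun ((hu.prodMk measurable_id) hSm.compl) (g := fun _ => 0)
      fun θ hθ => ?_).trans (by simp)
    have h0 : areaFactor m s (u θ) = 0 := by
      by_contra h
      exact hθ ⟨hfr θ, h⟩
    simp [h0]
  · rintro y ⟨hy, hAy⟩
    obtain ⟨V, T, f, L, hG⟩ := (hΩ y hy hAy).exists_isGraphNhd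
    exact ⟨V, hG.isOpen.mem_nhds hG.mem, hG.isOpen.measurableSet,
      fun B hBV hB => graphMeasure_le_of_subset hlam hs_cont hs hu hfr hG hBV hB⟩

/-- A bounded open set whose boundary projects onto the base lies below the graph of a measurable
function whose graph is part of the boundary: `u θ` is the largest `r` with `(r, θ) ∈ ∂Ω`. It is
upper semicontinuous because `∂Ω` is compact. -/
lemma exists_top_function (hΩ : IsOpen Ω) (hbdd : IsBoundedInM Ω)
    (hsurj : ∀ θ : (∀ q, N q), ∃ x ∈ frontier Ω, x.2 = θ) :
    ∃ u : (∀ q, N q) → radialInterval lam, Measurable u ∧ (∀ θ, (u θ, θ) ∈ frontier Ω) ∧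
      (∀ y ∈ Ω, y.1 < u y.2) ∧ ∀ y ∈ frontier Ω, y.1 ≤ u y.2 := by
  obtain ⟨R, hR, hΩR⟩ := hbdd
  have hcl : closure Ω ⊆ {y : WarpedSpace lam N | (y.1 : ℝ) ≤ R} :=
    closure_minimal hΩR (isClosed_le (by fun_prop) continuous_const)
  have hfrR : ∀ y ∈ frontier Ω, y.1 ≤ (⟨R, hR⟩ : radialInterval lam) :=
    fun y hy => hcl (frontier_subset_closure hy)
  have hfc : IsCompact (frontier Ω) := by
    have h1 : IsCompact (Icc (0 : ℝ) R) := isCompact_Icc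
    have h2 : IsCompact {r : radialInterval lam | (r : ℝ) ≤ R} := by
      rw [Subtype.isCompact_iff]
      convert h1 using 1
      ext r
      constructor
      · rintro ⟨r, hr, rfl⟩
        exact ⟨r.2.1, hr⟩
      · intro hr
        exact ⟨⟨r, (ordConnected_radialInterval lam).out
          ⟨le_rfl, (EReal.coe_le_coe_iff.2 hR.1).trans_lt hR.2⟩ hR hr⟩, hr.2, rfl⟩
    exact (h2.prod isCompact_univ).of_isClosed_subset isClosed_frontier
      fun y hy => ⟨hfrR y hy, mem_univ _⟩
  have hex : ∀ θ, ∃ r : radialInterval lam, (r, θ) ∈ frontier Ω ∧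
      ∀ y ∈ frontier Ω, y.2 = θ → y.1 ≤ r := by
    intro θ
    obtain ⟨x, hx, hxθ⟩ := hsurj θ
    obtain ⟨y, hy, hmax⟩ := (hfc.inter_right (isClosed_singleton.preimage continuous_snd :
      IsClosed (Prod.snd ⁻¹' {θ}))).exists_isMaxOn ⟨x, hx, hxθ⟩
      (f := fun y : WarpedSpace lam N => y.1) continuous_fst.continuousOn
    have hyθ : y.2 = θ := hy.2
    refine ⟨y.1, ?_, fun z hz hzθ => hmax ⟨hz, hzθ⟩⟩
    rw [← hyθ]
    exact hy.1
  choose u hu1 hu2 using hex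
  refine ⟨u, ?_, hu1, fun y hy => ?_, fun y hy => hu2 _ y hy rfl⟩
  · refine measurable_of_Ici fun a => ?_
    have : u ⁻¹' Ici a = Prod.snd '' (frontier Ω ∩ Prod.fst ⁻¹' Ici a) := by
      ext θ
      constructor
      · intro h
        exact ⟨(u θ, θ), ⟨hu1 θ, h⟩, rfl⟩
      · rintro ⟨y, hy, rfl⟩
        exact le_trans (show a ≤ y.1 from hy.2) (hu2 _ y hy.1 rfl)
    rw [this]
    exact ((hfc.inter_right (isClosed_Ici.preimage continuous_fst)).image
      continuous_snd).isClosed.measurableSet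
  · -- the segment from `y` to a point of the fibre beyond `R` leaves `Ω` through the boundary
    by_contra hlt
    rw [not_lt] at hlt
    obtain ⟨R', hRR', hR'lam⟩ := EReal.lt_iff_exists_real_btwn.1 hR.2
    have hRR' : R < R' := EReal.coe_lt_coe_iff.1 hRR'
    have hR' : R' ∈ radialInterval lam := ⟨hR.1.trans hRR'.le, hR'lam⟩
    have hyR' : (y.1 : ℝ) ≤ R' := (hΩR y hy).trans hRR'.le
    have hlam : 0 < lam := (EReal.coe_nonneg.2 hR.1).trans_lt hR.2
    have hsub : Icc (y.1 : ℝ) R' ⊆ radialInterval lam :=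
      (ordConnected_radialInterval lam).out y.1.2 hR'
    have hJ : IsPreconnected ((fun t => ((toRadial hlam t, y.2) : WarpedSpace lam N)) ''
        Icc (y.1 : ℝ) R') :=
      isPreconnected_Icc.image _ (((continuousOn_toRadial hlam).mono hsub).prodMk
        continuousOn_const)
    have hR'Ω : ((toRadial hlam R', y.2) : WarpedSpace lam N) ∉ Ω := fun h => by
      have := hΩR _ h
      simp only [toRadial_of_mem hlam hR'] at this
      exact absurd this (not_le.2 hRR')
    have hyJ : y ∈ (fun t => ((toRadial hlam t, y.2) : WarpedSpace lam N)) '' Icc (y.1 : ℝ) R' :=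
      ⟨y.1, left_mem_Icc.2 hyR', by simp only [toRadial_of_mem hlam y.1.2]⟩
    have hmeet : ∃ t ∈ Icc (y.1 : ℝ) R',
        ((toRadial hlam t, y.2) : WarpedSpace lam N) ∈ frontier Ω := by
      by_contra hno
      push Not at hno
      rcases hJ.subset_or_disjoint_closure hΩ (by rintro _ ⟨t, ht, rfl⟩; exact hno t ht) with h | h
      · exact hR'Ω (h ⟨R', right_mem_Icc.2 hyR', rfl⟩)
      · exact h hyJ (subset_closure hy)
    obtain ⟨t, ht, htf⟩ := hmeet
    have h1 := hu2 _ _ htf rfl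
    have h2 : y.1 ≤ toRadial hlam t := by
      rw [toRadial_of_mem hlam (hsub ht)]
      exact ht.1
    have h3 : ((toRadial hlam t, y.2) : WarpedSpace lam N) = y :=
      Prod.ext (le_antisymm (h1.trans hlt) h2) rfl
    rw [h3, hΩ.frontier_eq] at htf
    exact htf.2 hy

end GraphMeasure

/-! ### The volume of balls and the radial comparison -/

/-- A non-decreasing convex function has a supporting line of non-negative slope at every point
that is not an endpoint. -/
lemma ConvexOn.exists_support {φ : ℝ → ℝ} {D : Set ℝ} (hφ : ConvexOn ℝ D φ) (hmono : MonotoneOn φ D)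
    {x : ℝ} (hx : x ∈ D) (hl : ∃ y ∈ D, y < x) (hr : ∃ z ∈ D, x < z) :
    ∃ k, 0 ≤ k ∧ ∀ y ∈ D, φ x + k * (y - x) ≤ φ y := by
  obtain ⟨y₀, hy₀, hy₀x⟩ := hl
  obtain ⟨z₀, hz₀, hxz₀⟩ := hr
  set S : Set ℝ := (fun y => (φ x - φ y) / (x - y)) '' {y | y ∈ D ∧ y < x} with hS
  have hub : ∀ z ∈ D, x < z → ∀ t ∈ S, t ≤ (φ z - φ x) / (z - x) := by
    rintro z hz hxz _ ⟨y, ⟨hy, hyx⟩, rfl⟩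
    exact hφ.slope_mono_adjacent hy hz hyx hxz
  have hbdd : BddAbove S := ⟨_, fun t ht => hub z₀ hz₀ hxz₀ t ht⟩
  have hmem : ∀ y ∈ D, y < x → (φ x - φ y) / (x - y) ≤ sSup S := fun y hy hyx =>
    le_csSup hbdd ⟨y, ⟨hy, hyx⟩, rfl⟩
  refine ⟨sSup S, ?_, fun y hy => ?_⟩
  · exact (div_nonneg (sub_nonneg.2 (hmono hy₀ hx hy₀x.le)) (sub_nonneg.2 hy₀x.le)).trans
      (hmem y₀ hy₀ hy₀x)
  · rcases lt_trichotomy y x with h | rfl | h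
    · have h1 := hmem y hy h
      rw [div_le_iff₀ (sub_pos.2 h)] at h1
      linarith
    · simp
    · have h1 : sSup S ≤ (φ y - φ x) / (y - x) :=
        csSup_le ⟨_, y₀, ⟨hy₀, hy₀x⟩, rfl⟩ (hub y hy h)
      rw [le_div_iff₀ (sub_pos.2 h)] at h1
      linarith

lemma exists_gt_mem_radialInterval {lam : EReal} {R : ℝ} (hR : R ∈ radialInterval lam) :
    ∃ R' ∈ radialInterval lam, R < R' := by
  obtain ⟨R', h1, h2⟩ := EReal.lt_iff_exists_real_btwn.1 hR.2
  have h1 : R < R' := EReal.coe_lt_coe_iff.1 h1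
  exact ⟨R', ⟨hR.1.trans h1.le, h2⟩, h1⟩

lemma Icc_subset_radialInterval {lam : EReal} {R : ℝ} (hR : R ∈ radialInterval lam) :
    Icc 0 R ⊆ radialInterval lam :=
  fun _ ht => ⟨ht.1, (EReal.coe_le_coe_iff.2 ht.2).trans_lt hR.2⟩

section Radial

variable {p : ℕ} {m : Fin p → ℕ} {lam : EReal} {N : Fin p → Type*}
  {s : Fin p → ℝ → ℝ} {c : ℝ → ℝ}

/-- The integral `∫₀ʳ c(t) A(t) dt`, which is `Ṽ(r)` up to a constant factor. -/
def radialVolume (m : Fin p → ℕ) (s : Fin p → ℝ → ℝ) (c : ℝ → ℝ) (r : ℝ) : ℝ :=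
  ∫ t in (0 : ℝ)..r, c t * areaFactor m s t

lemma setLIntegral_radialMeasure (hs_cont : ∀ q, ContinuousOn (s q) (radialInterval lam))
    (hs : ∀ q, ∀ r ∈ radialInterval lam, 0 ≤ s q r)
    (hc : Measurable fun r : radialInterval lam => c r) {r : ℝ} (hr : r ∈ radialInterval lam) :
    ∫⁻ t in {t : radialInterval lam | (t : ℝ) < r}, ENNReal.ofReal (c t) ∂radialMeasure lam m s =
      ∫⁻ t in Ico 0 r, ENNReal.ofReal (c t * areaFactor m s t) := by
  have hS : MeasurableSet {t : radialInterval lam | (t : ℝ) < r} :=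
    measurableSet_lt measurable_subtype_coe measurable_const
  have hA := measurable_ofReal_areaFactor (m := m) hs_cont
  have hcm : Measurable fun t : radialInterval lam => ENNReal.ofReal (c t) :=
    ENNReal.measurable_ofReal.comp hc
  rw [radialMeasure, ← lintegral_indicator hS,
    lintegral_withDensity_eq_lintegral_mul _ hA (hcm.indicator hS)]
  have h1 : ∀ t : radialInterval lam, ((fun r : radialInterval lam => ENNReal.ofReal
      (areaFactor m s r)) * {t : radialInterval lam | (t : ℝ) < r}.indicator
        fun t => ENNReal.ofReal (c t)) t = (Iio r).indicator
          (fun t => ENNReal.ofReal (c t * areaFactor m s t)) (t : ℝ) := by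
    intro t
    rw [Pi.mul_apply]
    by_cases ht : (t : ℝ) < r
    · rw [indicator_of_mem (by exact ht), indicator_of_mem (by exact ht), mul_comm,
        ENNReal.ofReal_mul' (areaFactor_nonneg hs t.2)]
    · rw [indicator_of_notMem (by exact ht), indicator_of_notMem (by exact ht), mul_zero]
  calc _ = ∫⁻ t : radialInterval lam, (Iio r).indicator
          (fun t => ENNReal.ofReal (c t * areaFactor m s t)) (t : ℝ)
            ∂Measure.comap Subtype.val volume := lintegral_congr h1
    _ = ∫⁻ t in radialInterval lam, (Iio r).indicator
          (fun t => ENNReal.ofReal (c t * areaFactor m s t)) t :=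
        lintegral_subtype_comap (measurableSet_radialInterval lam) _
    _ = ∫⁻ t in Ico 0 r, ENNReal.ofReal (c t * areaFactor m s t) := by
        rw [setLIntegral_indicator measurableSet_Iio]
        congr 2
        ext t
        exact ⟨fun h => ⟨h.2.1, h.1⟩,
          fun h => ⟨h.2, Icc_subset_radialInterval hr ⟨h.1, h.2.le⟩⟩⟩

lemma aestronglyMeasurable_radial (hs_cont : ∀ q, ContinuousOn (s q) (radialInterval lam))
    (hc : Measurable fun r : radialInterval lam => c r) :
    AEStronglyMeasurable (fun t => c t * areaFactor m s t)
      (volume.restrict (radialInterval lam)) := by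
  have h1 : AEMeasurable c (volume.restrict (radialInterval lam)) := by
    rw [← map_comap_subtype_coe (measurableSet_radialInterval lam),
      (MeasurableEmbedding.subtype_coe (measurableSet_radialInterval lam)).aemeasurable_map_iff]
    exact hc.aemeasurable
  exact (h1.mul ((continuousOn_areaFactor hs_cont).aemeasurable
    (measurableSet_radialInterval lam))).aestronglyMeasurable

lemma intervalIntegrable_radial (hs_cont : ∀ q, ContinuousOn (s q) (radialInterval lam))
    (hs : ∀ q, ∀ r ∈ radialInterval lam, 0 ≤ s q r)
    (hc : Measurable fun r : radialInterval lam => c r)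
    (hc_pos : ∀ r ∈ radialInterval lam, 0 < c r) {r : ℝ} (hr : r ∈ radialInterval lam)
    (hfin : ∫⁻ t in {t : radialInterval lam | (t : ℝ) < r}, ENNReal.ofReal (c t)
      ∂radialMeasure lam m s ≠ ⊤) :
    IntervalIntegrable (fun t => c t * areaFactor m s t) volume 0 r := by
  rw [setLIntegral_radialMeasure hs_cont hs hc hr] at hfin
  have hsub := Icc_subset_radialInterval hr
  rw [intervalIntegrable_iff_integrableOn_Ico_of_le hr.1]
  refine ⟨(aestronglyMeasurable_radial hs_cont hc).mono_set (Ico_subset_Icc_self.trans hsub), ?_⟩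
  rw [hasFiniteIntegral_iff_ofReal]
  · exact hfin.lt_top
  · filter_upwards [ae_restrict_mem measurableSet_Ico] with t ht
    have ht' := hsub (Ico_subset_Icc_self ht)
    exact mul_nonneg (hc_pos t ht').le (areaFactor_nonneg hs ht')

lemma setLIntegral_radial_eq (hs_cont : ∀ q, ContinuousOn (s q) (radialInterval lam))
    (hs : ∀ q, ∀ r ∈ radialInterval lam, 0 ≤ s q r)
    (hc : Measurable fun r : radialInterval lam => c r)
    (hc_pos : ∀ r ∈ radialInterval lam, 0 < c r) {r : ℝ} (hr : r ∈ radialInterval lam)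
    (hint : IntervalIntegrable (fun t => c t * areaFactor m s t) volume 0 r) :
    ∫⁻ t in {t : radialInterval lam | (t : ℝ) < r}, ENNReal.ofReal (c t) ∂radialMeasure lam m s =
      ENNReal.ofReal (radialVolume m s c r) := by
  have hsub := Icc_subset_radialInterval hr
  rw [setLIntegral_radialMeasure hs_cont hs hc hr, radialVolume,
    intervalIntegral.integral_of_le hr.1, ← integral_Ico_eq_integral_Ioc,
    ofReal_integral_eq_lintegral_ofReal]
  · exact (intervalIntegrable_iff_integrableOn_Ico_of_le hr.1).1 hint
  · filter_upwards [ae_restrict_mem measurableSet_Ico] with t ht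
    have ht' := hsub (Ico_subset_Icc_self ht)
    exact mul_nonneg (hc_pos t ht').le (areaFactor_nonneg hs ht')

variable (hA_pos : ∀ r ∈ radialInterval lam, 0 < r → 0 < areaFactor m s r)
  (hc_pos : ∀ r ∈ radialInterval lam, 0 < c r)
  (hint : ∀ r ∈ radialInterval lam,
    IntervalIntegrable (fun t => c t * areaFactor m s t) volume 0 r)

include hA_pos hc_pos hint

lemma strictMonoOn_radialVolume : StrictMonoOn (radialVolume m s c) (radialInterval lam) := by
  intro a ha b hb hab
  have h1 : IntervalIntegrable (fun t => c t * areaFactor m s t) volume a b :=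
    (hint a ha).symm.trans (hint b hb)
  have h2 : radialVolume m s c a + ∫ t in a..b, c t * areaFactor m s t = radialVolume m s c b :=
    intervalIntegral.integral_add_adjacent_intervals (hint a ha) h1
  have h3 : 0 < ∫ t in a..b, c t * areaFactor m s t := by
    refine intervalIntegral.intervalIntegral_pos_of_pos_on h1 (fun t ht => ?_) hab
    have ht' : t ∈ radialInterval lam := ⟨ha.1.trans ht.1.le,
      (EReal.coe_le_coe_iff.2 ht.2.le).trans_lt hb.2⟩
    exact mul_pos (hc_pos t ht') (hA_pos t ht' (ha.1.trans_lt ht.1))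
  linarith

lemma radialVolume_nonneg {r : ℝ} (hr : r ∈ radialInterval lam) : 0 ≤ radialVolume m s c r := by
  have h0 : radialVolume m s c 0 = 0 := intervalIntegral.integral_same
  rw [← h0]
  exact (strictMonoOn_radialVolume hA_pos hc_pos hint).monotoneOn
    (Icc_subset_radialInterval hr ⟨le_rfl, hr.1⟩) hr hr.1

omit hA_pos hc_pos in
lemma continuousOn_radialVolume {R : ℝ} (hR : R ∈ radialInterval lam) :
    ContinuousOn (radialVolume m s c) (Icc 0 R) := by
  have h := intervalIntegral.continuousOn_primitive_interval (a := 0) (b := R) (μ := volume)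
    (f := fun t => c t * areaFactor m s t) ?_
  · rwa [uIcc_of_le hR.1] at h
  · rw [uIcc_of_le hR.1]
    exact (intervalIntegrable_iff_integrableOn_Icc_of_le hR.1).1 (hint R hR)

end Radial

section Volume

variable {p : ℕ} {m : Fin p → ℕ} {lam : EReal} {N : Fin p → Type*}
  [∀ q, TopologicalSpace (N q)] [∀ q, ChartedSpace (EuclideanSpace ℝ (Fin (m q))) (N q)]
  [∀ q, IsManifold (𝓡 (m q)) ∞ (N q)]
  [∀ q, MeasurableSpace (N q)] [∀ q, BorelSpace (N q)] [∀ q, SecondCountableTopology (N q)]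
  [∀ q, CompactSpace (N q)] [∀ q, T2Space (N q)]

lemma baseMeasure_univ_ne_zero [∀ q, Nonempty (N q)] (g : ∀ q, SmoothMetric (m q) (N q)) :
    baseMeasure g univ ≠ 0 := by
  let x : ∀ q, N q := fun q => Classical.arbitrary _
  have hB := (isOpen_prodSource (m := m) x).measurableSet
  refine (lt_of_lt_of_le ?_ (measure_mono (subset_univ (prodSource m x)))).ne'
  rw [baseMeasure_apply g x hB subset_rfl, ← lintegral_indicator_one hB,
    lintegral_chartMeasure g x (measurable_one.indicator hB)]
  have h1 : ∫⁻ w in prodTarget m x, ENNReal.ofReal (prodDensity g x (prodChartSymm m x w)) *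
      (prodSource m x).indicator 1 (prodChartSymm m x w) =
      ∫⁻ w in prodTarget m x, ENNReal.ofReal (prodDensity g x (prodChartSymm m x w)) := by
    refine setLIntegral_congr_fun (isOpen_prodTarget x).measurableSet fun w hw => ?_
    simp only [indicator_of_mem (prodChartSymm_mem hw), Pi.one_apply, mul_one]
  have hT := isOpen_prodTarget (m := m) x
  rw [h1, pos_iff_ne_zero, Ne, lintegral_eq_zero_iff' (aemeasurable_prodDensity g x),
    Filter.EventuallyEq, ae_restrict_iff' hT.measurableSet]
  intro h2
  refine (hT.measure_pos volume ⟨_, prodChart_mem (mem_prodSource_self (m := m) x)⟩).ne'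
    (measure_mono_null (fun w hw => ?_) (ae_iff.1 h2))
  exact fun h3 => (ENNReal.ofReal_pos.2 (prodDensity_pos g (prodChartSymm_mem hw))).ne' (h3 hw)
variable {s : Fin p → ℝ → ℝ} {g : ∀ q, SmoothMetric (m q) (N q)} {c : ℝ → ℝ}

lemma weightedVolume_warpedBall_eq_mul (hlam : 0 < lam)
    (hs_cont : ∀ q, ContinuousOn (s q) (radialInterval lam))
    (hs : ∀ q, ∀ r ∈ radialInterval lam, 0 ≤ s q r)
    (hc : Measurable fun r : radialInterval lam => c r) (r : ℝ) :
    weightedVolume s g c (warpedBall lam N r) =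
      (∫⁻ t in {t : radialInterval lam | (t : ℝ) < r}, ENNReal.ofReal (c t)
        ∂radialMeasure lam m s) * baseMeasure g univ := by
  have hball : warpedBall lam N r = {t : radialInterval lam | (t : ℝ) < r} ×ˢ univ := by
    ext y
    exact ⟨fun h => ⟨h, mem_univ _⟩, fun h => h.1⟩
  have hcm : Measurable fun y : WarpedSpace lam N => ENNReal.ofReal (c y.1) :=
    (ENNReal.measurable_ofReal.comp hc).comp measurable_fst
  rw [weightedVolume, riemannianMeasure_univ hlam g hs_cont hs, hball, ← Measure.prod_restrict,
    lintegral_prod _ hcm.aemeasurable]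
  simp only [Measure.restrict_univ, lintegral_const]
  exact lintegral_mul_const _ (ENNReal.measurable_ofReal.comp hc)

/-- A bound for the volume of a set below the graph of `u`. -/
lemma weightedVolume_le_of_lt (hlam : 0 < lam)
    (hs_cont : ∀ q, ContinuousOn (s q) (radialInterval lam))
    (hs : ∀ q, ∀ r ∈ radialInterval lam, 0 ≤ s q r)
    (hc : Measurable fun r : radialInterval lam => c r)
    {Ω : Set (WarpedSpace lam N)} {u : (∀ q, N q) → radialInterval lam} (hu : Measurable u)
    (hΩ : ∀ y ∈ Ω, y.1 < u y.2) :
    weightedVolume s g c Ω ≤ ∫⁻ θ, ∫⁻ t in {t : radialInterval lam | (t : ℝ) < u θ},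
        ENNReal.ofReal (c t) ∂radialMeasure lam m s ∂baseMeasure g := by
  have hcm : Measurable fun y : WarpedSpace lam N => ENNReal.ofReal (c y.1) :=
    (ENNReal.measurable_ofReal.comp hc).comp measurable_fst
  have hS : MeasurableSet {y : WarpedSpace lam N | y.1 < u y.2} :=
    measurableSet_lt measurable_fst (hu.comp measurable_snd)
  rw [weightedVolume, riemannianMeasure_univ hlam g hs_cont hs]
  refine (lintegral_mono_set (show Ω ⊆ {y : WarpedSpace lam N | y.1 < u y.2} from hΩ)).trans ?_
  rw [← lintegral_indicator hS, lintegral_prod_symm _ (hcm.indicator hS).aemeasurable]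
  refine lintegral_mono fun θ => ?_
  rw [← lintegral_indicator (measurableSet_lt measurable_subtype_coe measurable_const)]
  exact le_of_eq rfl

lemma weightedVolume_mono (s : Fin p → ℝ → ℝ) (g : ∀ q, SmoothMetric (m q) (N q)) (c : ℝ → ℝ)
    {Ω Ω' : Set (WarpedSpace lam N)} (h : Ω ⊆ Ω') :
    weightedVolume s g c Ω ≤ weightedVolume s g c Ω' :=
  lintegral_mono_set h

lemma weightedVolume_warpedBall (hlam : 0 < lam)
    (hs_cont : ∀ q, ContinuousOn (s q) (radialInterval lam))
    (hs : ∀ q, ∀ r ∈ radialInterval lam, 0 ≤ s q r)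
    (hc : Measurable fun r : radialInterval lam => c r)
    (hc_pos : ∀ r ∈ radialInterval lam, 0 < c r)
    (hint : ∀ r ∈ radialInterval lam,
      IntervalIntegrable (fun t => c t * areaFactor m s t) volume 0 r)
    {r : ℝ} (hr : r ∈ radialInterval lam) :
    weightedVolume s g c (warpedBall lam N r) =
      ENNReal.ofReal (radialVolume m s c r) * baseMeasure g univ := by
  rw [weightedVolume_warpedBall_eq_mul hlam hs_cont hs hc,
    setLIntegral_radial_eq hs_cont hs hc hc_pos hr (hint r hr)]

/-- There is exactly one ball with the volume of a given bounded set. -/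
lemma existsUnique_radius [∀ q, Nonempty (N q)] (hlam : 0 < lam)
    (hs_cont : ∀ q, ContinuousOn (s q) (radialInterval lam))
    (hs : ∀ q, ∀ r ∈ radialInterval lam, 0 ≤ s q r)
    (hA_pos : ∀ r ∈ radialInterval lam, 0 < r → 0 < areaFactor m s r)
    (hc : Measurable fun r : radialInterval lam => c r)
    (hc_pos : ∀ r ∈ radialInterval lam, 0 < c r)
    (hint : ∀ r ∈ radialInterval lam,
      IntervalIntegrable (fun t => c t * areaFactor m s t) volume 0 r)
    {Ω : Set (WarpedSpace lam N)} (hbdd : IsBoundedInM Ω) :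
    ∃! R : ℝ, R ∈ radialInterval lam ∧
        weightedVolume s g c (warpedBall lam N R) = weightedVolume s g c Ω := by
  have hV0 : baseMeasure g univ ≠ 0 := baseMeasure_univ_ne_zero g
  have hVt : baseMeasure g univ ≠ ⊤ := measure_ne_top _ _
  have hball : ∀ r ∈ radialInterval lam, weightedVolume s g c (warpedBall lam N r) =
      ENNReal.ofReal (radialVolume m s c r) * baseMeasure g univ := fun r hr =>
    weightedVolume_warpedBall hlam hs_cont hs hc hc_pos hint hr
  have hmono := strictMonoOn_radialVolume hA_pos hc_pos hint
  obtain ⟨R₀, hR₀, hΩR₀⟩ := hbdd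
  obtain ⟨R₁, hR₁, hR₀₁⟩ := exists_gt_mem_radialInterval hR₀
  have hle : weightedVolume s g c Ω ≤
      ENNReal.ofReal (radialVolume m s c R₁) * baseMeasure g univ := by
    rw [← hball R₁ hR₁]
    exact weightedVolume_mono s g c fun y hy => (hΩR₀ y hy).trans_lt hR₀₁
  have hlt : weightedVolume s g c Ω ≠ ⊤ :=
    (hle.trans_lt (ENNReal.mul_lt_top ENNReal.ofReal_lt_top hVt.lt_top)).ne
  set v := (weightedVolume s g c Ω / baseMeasure g univ).toReal with hv
  have hdiv : weightedVolume s g c Ω / baseMeasure g univ ≠ ⊤ := ENNReal.div_ne_top hlt hV0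
  have hv0 : 0 ≤ v := ENNReal.toReal_nonneg
  have hvol : weightedVolume s g c Ω = ENNReal.ofReal v * baseMeasure g univ := by
    rw [hv, ENNReal.ofReal_toReal hdiv, ENNReal.div_mul_cancel hV0 hVt]
  have hv1 : v ≤ radialVolume m s c R₁ := by
    rw [hvol, ENNReal.mul_le_mul_iff_left hV0 hVt] at hle
    exact (ENNReal.ofReal_le_ofReal_iff (radialVolume_nonneg hA_pos hc_pos hint hR₁)).1 hle
  have h0 : radialVolume m s c 0 = 0 := intervalIntegral.integral_same
  obtain ⟨R, hR, hRv⟩ := intermediate_value_Icc hR₁.1 (continuousOn_radialVolume hint hR₁)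
    (show v ∈ Icc _ _ from ⟨h0.trans_le hv0, hv1⟩)
  have hRmem := Icc_subset_radialInterval hR₁ hR
  refine ⟨R, ⟨hRmem, ?_⟩, fun R' hR' => ?_⟩
  · rw [hball R hRmem, hRv, hvol]
  · refine hmono.injOn hR'.1 hRmem ?_
    have h1 := hR'.2
    rw [hball R' hR'.1, hvol, ENNReal.mul_left_inj hV0 hVt] at h1
    rw [hRv]
    exact (ENNReal.ofReal_eq_ofReal_iff (radialVolume_nonneg hA_pos hc_pos hint hR'.1) hv0).1 h1

variable {a : ℝ → ℝ}

lemma measurable_ofReal_fst (ha : ContinuousOn a (radialInterval lam)) :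
    Measurable fun y : WarpedSpace lam N => ENNReal.ofReal (a y.1) :=
  ENNReal.measurable_ofReal.comp
    ((continuousOn_iff_continuous_domRestrict.1 ha).measurable.comp measurable_fst)

/-- Only an inequality is stated because the boundary of a ball may be smaller than the slice:
`B_0` is empty. -/
lemma weightedArea_warpedBall_le (hs : ∀ q, ∀ r ∈ radialInterval lam, 0 ≤ s q r)
    (ha : ContinuousOn a (radialInterval lam)) {R : ℝ} (hR : R ∈ radialInterval lam) :
    weightedArea s g a (warpedBall lam N R) ≤
      ENNReal.ofReal (a R * areaFactor m s R) * baseMeasure g univ := by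
  have hsub : frontier (warpedBall lam N R) ⊆ slice lam N R :=
    frontier_lt_subset_eq (by fun_prop) continuous_const
  calc weightedArea s g a (warpedBall lam N R)
      ≤ ∫⁻ y, ENNReal.ofReal (a y.1) ∂(ENNReal.ofReal (areaFactor m s R) •
          (baseMeasure g).map fun θ => ((⟨R, hR⟩ : radialInterval lam), θ)) :=
        lintegral_mono' ((riemannianMeasure_mono s g _ hsub).trans
          (riemannianMeasure_slice_le g hs ⟨R, hR⟩)) le_rfl
    _ = _ := by
        rw [lintegral_smul_measure, lintegral_map (measurable_ofReal_fst ha) (by fun_prop)]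
        simp only
        rw [lintegral_const, smul_eq_mul, ← mul_assoc, mul_comm (a R),
          ENNReal.ofReal_mul (areaFactor_nonneg hs hR)]

lemma lintegral_graphMeasure_le_weightedArea (hlam : 0 < lam)
    (hs_cont : ∀ q, ContinuousOn (s q) (radialInterval lam))
    (hs : ∀ q, ∀ r ∈ radialInterval lam, 0 ≤ s q r) {Ω : Set (WarpedSpace lam N)}
    (hΩ : HasLipschitzBoundary m s Ω) {u : (∀ q, N q) → radialInterval lam} (hu : Measurable u)
    (hfr : ∀ θ, (u θ, θ) ∈ frontier Ω) :
    ∫⁻ y, ENNReal.ofReal (a y.1) ∂graphMeasure s g u ≤ weightedArea s g a Ω :=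
  lintegral_mono' (graphMeasure_le hlam hs_cont hs hΩ hu hfr) le_rfl

/-- The weighted area of the ball with the volume of `Ω` is at most `∫ ψ(u) dν`, where `ψ = a A`:
the supporting line of `ψ` at `R`, as a function of the volume, is integrated over the base, and the
mean volume below the graph of `u` is at least that of the ball. -/
lemma weightedArea_warpedBall_le_lintegral_graphMeasure (hlam : 0 < lam)
    (hs_cont : ∀ q, ContinuousOn (s q) (radialInterval lam))
    (hs : ∀ q, ∀ r ∈ radialInterval lam, 0 ≤ s q r)
    (hA_pos : ∀ r ∈ radialInterval lam, 0 < r → 0 < areaFactor m s r)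
    (hc : Measurable fun r : radialInterval lam => c r)
    (hc_pos : ∀ r ∈ radialInterval lam, 0 < c r)
    (hint : ∀ r ∈ radialInterval lam,
      IntervalIntegrable (fun t => c t * areaFactor m s t) volume 0 r)
    (ha : ContinuousOn a (radialInterval lam)) (ha_pos : ∀ r ∈ radialInterval lam, 0 < a r)
    {Ω : Set (WarpedSpace lam N)} {u : (∀ q, N q) → radialInterval lam} (hu : Measurable u)
    (hΩu : ∀ y ∈ Ω, y.1 < u y.2)
    {R : ℝ} (hR : R ∈ radialInterval lam)
    (hvol : weightedVolume s g c (warpedBall lam N R) = weightedVolume s g c Ω)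
    (hsupp : ∃ k, 0 ≤ k ∧ ∀ r ∈ radialInterval lam, a R * areaFactor m s R +
      k * (radialVolume m s c r - radialVolume m s c R) ≤ a r * areaFactor m s r) :
    weightedArea s g a (warpedBall lam N R) ≤
      ∫⁻ y, ENNReal.ofReal (a y.1) ∂graphMeasure s g u := by
  obtain ⟨k, hk, hsupp⟩ := hsupp
  set ψ : ℝ → ℝ := fun r => a r * areaFactor m s r with hψ
  have hψ0 : ∀ r ∈ radialInterval lam, 0 ≤ ψ r := fun r hr =>
    mul_nonneg (ha_pos r hr).le (areaFactor_nonneg hs hr)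
  have hW0 : ∀ r ∈ radialInterval lam, 0 ≤ radialVolume m s c r := fun r hr =>
    radialVolume_nonneg hA_pos hc_pos hint hr
  have hVt : baseMeasure g univ ≠ ⊤ := measure_ne_top _ _
  have e1 : ∫⁻ y, ENNReal.ofReal (a y.1) ∂graphMeasure s g u =
      ∫⁻ θ, ENNReal.ofReal (ψ (u θ)) ∂baseMeasure g := by
    rw [lintegral_graphMeasure hs_cont hu (measurable_ofReal_fst ha)]
    refine lintegral_congr fun θ => ?_
    rw [hψ, ENNReal.ofReal_mul (ha_pos _ (u θ).2).le, mul_comm]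
  have e2 : weightedVolume s g c Ω ≤
      ∫⁻ θ, ENNReal.ofReal (radialVolume m s c (u θ)) ∂baseMeasure g := by
    refine (weightedVolume_le_of_lt hlam hs_cont hs hc hu hΩu).trans (lintegral_mono fun θ => ?_)
    rw [setLIntegral_radial_eq hs_cont hs hc hc_pos (u θ).2 (hint _ (u θ).2)]
  rw [← hvol, weightedVolume_warpedBall hlam hs_cont hs hc hc_pos hint hR] at e2
  refine (weightedArea_warpedBall_le hs ha hR).trans ?_
  rw [e1]
  have hfin : ENNReal.ofReal (k * radialVolume m s c R) * baseMeasure g univ ≠ ⊤ :=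
    ENNReal.mul_ne_top ENNReal.ofReal_ne_top hVt
  refine (ENNReal.add_le_add_iff_right hfin).1 ?_
  calc ENNReal.ofReal (ψ R) * baseMeasure g univ +
        ENNReal.ofReal (k * radialVolume m s c R) * baseMeasure g univ
      = ENNReal.ofReal (ψ R) * baseMeasure g univ + ENNReal.ofReal k *
        (ENNReal.ofReal (radialVolume m s c R) * baseMeasure g univ) := by
        rw [ENNReal.ofReal_mul hk, mul_assoc]
    _ ≤ ENNReal.ofReal (ψ R) * baseMeasure g univ + ENNReal.ofReal k *
        ∫⁻ θ, ENNReal.ofReal (radialVolume m s c (u θ)) ∂baseMeasure g := by gcongr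
    _ = ∫⁻ θ, (ENNReal.ofReal (ψ R) + ENNReal.ofReal k *
          ENNReal.ofReal (radialVolume m s c (u θ))) ∂baseMeasure g := by
        rw [lintegral_add_left measurable_const, lintegral_const,
          lintegral_const_mul' _ _ ENNReal.ofReal_ne_top]
    _ ≤ ∫⁻ θ, (ENNReal.ofReal (ψ (u θ)) + ENNReal.ofReal (k * radialVolume m s c R))
          ∂baseMeasure g := by
        refine lintegral_mono fun θ => ?_
        rw [← ENNReal.ofReal_mul hk, ← ENNReal.ofReal_add (hψ0 R hR)
          (mul_nonneg hk (hW0 _ (u θ).2)), ← ENNReal.ofReal_add (hψ0 _ (u θ).2)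
          (mul_nonneg hk (hW0 R hR))]
        refine ENNReal.ofReal_le_ofReal ?_
        have := hsupp _ (u θ).2
        simp only [hψ]
        linarith
    _ = _ := by
        rw [lintegral_add_right _ measurable_const, lintegral_const]

end Volume

/-! ### Boundaries that are tangent to the coordinate slices -/

/-- A Lipschitz function whose derivative vanishes almost everywhere on a convex open set is
constant there. -/
lemma LipschitzWith.eq_of_ae_hasFDerivAt_zero {E : Type*} [NormedAddCommGroup E] [NormedSpace ℝ E]
    [FiniteDimensional ℝ E] [MeasurableSpace E] [BorelSpace E] (μ : Measure E) [μ.IsAddHaarMeasure]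
    {h : E → ℝ} {L : ℝ≥0} (hh : LipschitzWith L h) {U : Set E} (hU : IsOpen U) (hUc : Convex ℝ U)
    (h0 : ∀ᵐ w ∂μ, w ∈ U → HasFDerivAt h (0 : E →L[ℝ] ℝ) w) {c z : E} (hc : c ∈ U) (hz : z ∈ U) :
    h c = h z := by
  set S := (toMeasurable μ {w | ¬ (w ∈ U → HasFDerivAt h (0 : E →L[ℝ] ℝ) w)})ᶜ with hS
  have hSm : MeasurableSet S := (measurableSet_toMeasurable _ _).compl
  have hS' : ∀ w ∈ S, w ∈ U → HasFDerivAt h (0 : E →L[ℝ] ℝ) w := fun w hw => by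
    by_contra hc
    exact hw (subset_toMeasurable _ _ hc)
  have hSae : ∀ᵐ w ∂μ, w ∈ S := by
    rw [ae_iff]
    simp only [hS, mem_compl_iff, not_not]
    exact (measure_toMeasurable _).trans h0
  set v := z - c with hv
  have h1 := (ae_ae_add_linearMap_mem_iff (LinearMap.toSpanSingleton ℝ E v) volume μ hSm).2 hSae
  have hae : ∀ᵐ y ∂μ, y ∈ U → y + v ∈ U → h y = h (y + v) := by
    filter_upwards [h1] with y hy hyU hyvU
    have hline : LipschitzWith (L * ‖v‖₊) fun t : ℝ => h (y + t • v) := by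
      refine hh.comp (LipschitzWith.of_dist_le_mul fun t t' => ?_)
      rw [dist_add_left, dist_eq_norm, ← sub_smul, norm_smul, mul_comm, dist_eq_norm]
      rfl
    have hac := (hline.lipschitzOnWith (s := uIcc (0 : ℝ) 1)).absolutelyContinuousOnInterval
    obtain ⟨C, hC⟩ := hac.const_of_ae_hasDerivAt_zero (by
      filter_upwards [hy] with t ht ht01
      rw [uIcc_of_le zero_le_one] at ht01
      have hmem : y + t • v ∈ U := by
        have := hUc hyU hyvU (sub_nonneg.2 ht01.2) ht01.1 (by ring)
        convert this using 1
        module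
      have h2 := hS' _ ht hmem
      have h3 : HasDerivAt (fun t : ℝ => y + t • v) v t := by
        simpa using ((hasDerivAt_id t).smul_const v).const_add y
      have h4 : HasDerivAt (h ∘ fun t : ℝ => y + t • v) 0 t := by
        simpa using h2.comp_hasDerivAt t h3
      exact h4)
    have e0 := hC 0 left_mem_uIcc
    have e1 := hC 1 right_mem_uIcc
    simp only [zero_smul, add_zero, one_smul] at e0 e1
    rw [e0, e1]
  have hd : Dense {y | y ∈ U → y + v ∈ U → h y = h (y + v)} := μ.dense_of_ae hae
  set W := U ∩ (fun y => y + v) ⁻¹' U with hW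
  have hWo : IsOpen W := hU.inter (hU.preimage (by fun_prop))
  have hcW : c ∈ W := ⟨hc, by simpa [hv] using hz⟩
  have hcl := hd.open_subset_closure_inter hWo hcW
  have hclosed : IsClosed {y | h y = h (y + v)} :=
    isClosed_eq hh.continuous (hh.continuous.comp (by fun_prop))
  have := closure_minimal (fun y hy => hy.2 hy.1.1 hy.1.2) hclosed hcl
  simpa [hv] using this

section Graph

variable {p : ℕ} {m : Fin p → ℕ} {lam : EReal} {N : Fin p → Type*}
  [∀ q, TopologicalSpace (N q)] [∀ q, ChartedSpace (EuclideanSpace ℝ (Fin (m q))) (N q)]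
  {x : WarpedSpace lam N} {Ω V : Set (WarpedSpace lam N)}
  {T : (ℝ × (∀ q, EuclideanSpace ℝ (Fin (m q)))) ≃L[ℝ] (EuclideanSpace ℝ (Fin (∑ q, m q)) × ℝ)}
  {f : EuclideanSpace ℝ (Fin (∑ q, m q)) → ℝ} {L : ℝ≥0}

lemma continuousOn_warpedCoord (x : WarpedSpace lam N) :
    ContinuousOn (warpedCoord m x) {y | y.2 ∈ prodSource m x.2} := by
  refine ContinuousOn.prodMk (by fun_prop) (continuousOn_pi.2 fun q => ?_)
  exact (continuousOn_extChartAt (x.2 q)).comp (by fun_prop) fun y hy => hy q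

/-- The differential of the graph of `f` is injective. -/
lemma eq_zero_of_fderiv_graph_eq_zero {z v : EuclideanSpace ℝ (Fin (∑ q, m q))}
    (hz : DifferentiableAt ℝ f z) (h1 : fderiv ℝ (graphRadius T f) z v = 0)
    (h2 : fderiv ℝ (graphBase T f) z v = 0) : v = 0 := by
  have hP : HasFDerivAt (fun z => T.symm (z, f z)) ((T.symm : _ →L[ℝ] _).comp
      ((ContinuousLinearMap.id ℝ _).prod (fderiv ℝ f z))) z :=
    T.symm.hasFDerivAt.comp z ((hasFDerivAt_id z).prodMk hz.hasFDerivAt)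
  have e1 : HasFDerivAt (graphRadius T f) _ z := hasFDerivAt_fst.comp z hP
  have e2 : HasFDerivAt (graphBase T f) _ z :=
    (coordEquiv m).hasFDerivAt.comp z (hasFDerivAt_snd.comp z hP)
  rw [e1.fderiv] at h1
  rw [e2.fderiv] at h2
  have h3 : T.symm (v, fderiv ℝ f z v) = 0 := by
    refine Prod.ext h1 ?_
    exact (coordEquiv m).map_eq_zero_iff.1 h2
  exact congrArg Prod.fst (T.symm.map_eq_zero_iff.1 h3)

namespace IsGraphNhd

variable (hG : IsGraphNhd (m := m) x Ω V T f L) (hlam : 0 < lam)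

include hG

/-- Away from `r = 0` the neighbourhood can be chosen such that the graph lies over a ball. -/
lemma exists_graphDomain_eq_ball (hx : x ∈ frontier Ω) (hx0 : 0 < (x.1 : ℝ)) :
    ∃ V' ε, 0 < ε ∧ IsGraphNhd (m := m) x Ω V' T f L ∧
      graphDomain hlam x.2 T f V' = Metric.ball (T (warpedCoord m x x)).1 ε ∧
      ∀ z ∈ Metric.ball (T (warpedCoord m x x)).1 ε, 0 < graphRadius T f z := by
  set z₀ := (T (warpedCoord m x x)).1 with hz₀
  obtain ⟨hzd, hzx⟩ := hG.mem_graphDomain hlam hG.mem hx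
  obtain ⟨hr, hb⟩ := graphRadius_warpedCoord ((hG.frontier_iff x hG.mem).1 hx)
  obtain ⟨⟨_, hl1⟩, ⟨_, hl2⟩⟩ := exists_lipschitzWith_graph (T := T) hG.lipschitz
  have hO : IsOpen {z | (0 < graphRadius T f z ∧ (graphRadius T f z : EReal) < lam) ∧
      graphBase T f z ∈ prodTarget m x.2} := by
    refine ((isOpen_lt continuous_const hl1.continuous).inter (isOpen_lt
      (continuous_coe_real_ereal.comp hl1.continuous) continuous_const)).inter
      ((isOpen_prodTarget x.2).preimage hl2.continuous)
  have hOsub : {z | (0 < graphRadius T f z ∧ (graphRadius T f z : EReal) < lam) ∧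
      graphBase T f z ∈ prodTarget m x.2} ⊆
      {z | graphRadius T f z ∈ radialInterval lam ∧ graphBase T f z ∈ prodTarget m x.2} :=
    fun z hz => ⟨⟨hz.1.1.le, hz.1.2⟩, hz.2⟩
  have hU := ((hG.continuousOn_graphMap hlam).mono hOsub).isOpen_inter_preimage hO hG.isOpen
  obtain ⟨ε, hε, hball⟩ := Metric.isOpen_iff.1 hU z₀
    ⟨⟨⟨hr ▸ hx0, hzd.1.1.2⟩, hzd.1.2⟩, hzd.2⟩
  have hsrc : V ⊆ {y | y.2 ∈ prodSource m x.2} := fun y hy => hG.source y hy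
  set V' := V ∩ (fun y => (T (warpedCoord m x y)).1) ⁻¹' Metric.ball z₀ ε with hV'
  have hV'o : IsOpen V' := by
    refine ContinuousOn.isOpen_inter_preimage ?_ hG.isOpen Metric.isOpen_ball
    exact (continuous_fst.comp T.continuous).comp_continuousOn
      ((continuousOn_warpedCoord x).mono hsrc)
  refine ⟨V', ε, hε, ⟨hG.lipschitz, hV'o, ⟨hG.mem, Metric.mem_ball_self hε⟩,
    fun y hy => hG.source y hy.1, fun y hy => hG.mem_iff y hy.1,
    fun y hy => hG.frontier_iff y hy.1⟩, ?_, fun z hz => (hball hz).1.1.1⟩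
  ext z
  constructor
  · intro hz
    have := hz.2.2
    rwa [mem_preimage, warpedCoord_graphMap hz.1] at this
  · intro hz
    have h := hball hz
    refine ⟨hOsub h.1, h.2, ?_⟩
    rw [mem_preimage, warpedCoord_graphMap (hOsub h.1)]
    exact hz

/-- Points outside the closure of `Ω` accumulate at the boundary points with `r > 0`. -/
lemma mem_closure_compl_closure (hx : x ∈ frontier Ω) (hx0 : 0 < (x.1 : ℝ)) :
    x ∈ closure (closure Ω)ᶜ := by
  have hlam : 0 < lam := (EReal.coe_pos.2 hx0).trans x.1.2.2
  set z₀ := (T (warpedCoord m x x)).1 with hz₀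
  have hfx := (hG.frontier_iff x hG.mem).1 hx
  set w : ℝ → ℝ × (∀ q, EuclideanSpace ℝ (Fin (m q))) := fun t => T.symm (z₀, f z₀ + t) with hw
  have hwc : Continuous w := by fun_prop
  have hw0 : w 0 = warpedCoord m x x := by
    simp only [hw, add_zero]
    rw [← hfx, hz₀]
    simp
  set Φ : ℝ → WarpedSpace lam N := fun t =>
    (toRadial hlam (w t).1, prodChartSymm m x.2 (coordEquiv m (w t).2)) with hΦ
  have hwt : ∀ᶠ t in 𝓝 (0 : ℝ), (0 < (w t).1 ∧ ((w t).1 : EReal) < lam) ∧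
      coordEquiv m (w t).2 ∈ prodTarget m x.2 := by
    have hO : IsOpen {t | (0 < (w t).1 ∧ ((w t).1 : EReal) < lam) ∧
        coordEquiv m (w t).2 ∈ prodTarget m x.2} := by
      have h1 : Continuous fun t => (w t).1 := continuous_fst.comp hwc
      have h2 : Continuous fun t => coordEquiv m (w t).2 :=
        (coordEquiv m).continuous.comp (continuous_snd.comp hwc)
      exact ((isOpen_lt continuous_const h1).inter (isOpen_lt
        (continuous_coe_real_ereal.comp h1) continuous_const)).inter
        ((isOpen_prodTarget x.2).preimage h2)
    refine hO.mem_nhds ?_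
    simp only [mem_ofPred_eq, hw0]
    exact ⟨⟨hx0, x.1.2.2⟩, prodChart_mem (mem_prodSource_self x.2)⟩
  have hcoord : ∀ᶠ t in 𝓝 (0 : ℝ), T (warpedCoord m x (Φ t)) = (z₀, f z₀ + t) := by
    filter_upwards [hwt] with t ht
    rw [← ContinuousLinearEquiv.eq_symm_apply]
    refine Prod.ext ?_ ?_
    · simp only [warpedCoord, hΦ, toRadial_of_mem hlam ⟨ht.1.1.le, ht.1.2⟩]
      rfl
    · have h := congrArg (coordEquiv m).symm (prodChart_prodChartSymm ht.2)
      rw [prodChart, ContinuousLinearEquiv.symm_apply_apply,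
        ContinuousLinearEquiv.symm_apply_apply] at h
      exact h
  have hΦ0 : Φ 0 = x := by
    simp only [hΦ, hw0]
    refine Prod.ext ?_ ?_
    · exact toRadial_of_mem hlam x.1.2
    · exact prodChartSymm_prodChart (mem_prodSource_self (m := m) x.2)
  have hΦc : ContinuousAt Φ 0 := by
    have h0 := hwt.self_of_nhds
    have hmem : {r : ℝ | 0 < r ∧ (r : EReal) < lam} ∈ 𝓝 (w 0).1 :=
      ((isOpen_lt continuous_const continuous_id).inter (isOpen_lt continuous_coe_real_ereal
        continuous_const)).mem_nhds h0.1
    refine ContinuousAt.prodMk ?_ ?_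
    · exact ContinuousAt.comp (f := fun t => (w t).1) (g := toRadial hlam)
        (((continuousOn_toRadial hlam).mono (fun r hr => ⟨hr.1.le, hr.2⟩)).continuousAt hmem)
        (by fun_prop)
    · exact ContinuousAt.comp (f := fun t => coordEquiv m (w t).2) (g := prodChartSymm m x.2)
        ((continuousOn_prodChartSymm x.2).continuousAt ((isOpen_prodTarget x.2).mem_nhds h0.2))
        (by fun_prop)
  have hV : ∀ᶠ t in 𝓝 (0 : ℝ), Φ t ∈ V := by
    refine hΦc.eventually_mem ?_
    rw [hΦ0]
    exact hG.isOpen.mem_nhds hG.mem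
  have hext : ∀ᶠ t in 𝓝[>] (0 : ℝ), Φ t ∈ (closure Ω)ᶜ := by
    filter_upwards [nhdsWithin_le_nhds hcoord, nhdsWithin_le_nhds hV, self_mem_nhdsWithin]
      with t ht htV ht0 hcl
    have ht0 : 0 < t := ht0
    rw [closure_eq_self_union_frontier] at hcl
    rcases hcl with h | h
    · rw [hG.mem_iff _ htV, ht] at h
      simp only at h
      linarith
    · rw [hG.frontier_iff _ htV, ht] at h
      simp only at h
      linarith
  have hlim : Filter.Tendsto Φ (𝓝[>] (0 : ℝ)) (𝓝 x) := by
    have := hΦc.tendsto.mono_left (nhdsWithin_le_nhds (s := Ioi 0))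
    rwa [hΦ0] at this
  exact mem_closure_of_tendsto hlim hext

end IsGraphNhd

end Graph

section Rigidity

variable {p : ℕ} {m : Fin p → ℕ} {lam : EReal} {N : Fin p → Type*}
  [∀ q, TopologicalSpace (N q)] [∀ q, ChartedSpace (EuclideanSpace ℝ (Fin (m q))) (N q)]
  [∀ q, IsManifold (𝓡 (m q)) ∞ (N q)]
  [∀ q, MeasurableSpace (N q)] [∀ q, BorelSpace (N q)] [∀ q, SecondCountableTopology (N q)]
  [∀ q, CompactSpace (N q)] [∀ q, T2Space (N q)]
  {s : Fin p → ℝ → ℝ} {g : ∀ q, SmoothMetric (m q) (N q)}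
  {x : WarpedSpace lam N} {Ω V : Set (WarpedSpace lam N)}
  {T : (ℝ × (∀ q, EuclideanSpace ℝ (Fin (m q)))) ≃L[ℝ] (EuclideanSpace ℝ (Fin (∑ q, m q)) × ℝ)}
  {f : EuclideanSpace ℝ (Fin (∑ q, m q)) → ℝ} {L : ℝ≥0}

lemma continuousOn_blockGram (g : ∀ q, SmoothMetric (m q) (N q))
    (hs_cont : ∀ q, ContinuousOn (s q) (radialInterval lam)) (x : ∀ q, N q) :
    ContinuousOn (fun y : WarpedSpace lam N => blockGram (fun q => s q y.1) g x y.2)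
      {y | y.2 ∈ prodSource m x} := by
  have h : Continuous fun M : (∀ q, Matrix (Fin (m q)) (Fin (m q)) ℝ) =>
      Matrix.blockDiagonal' M := continuous_id.matrix_blockDiagonal'
  refine h.comp_continuousOn (continuousOn_pi.2 fun q => ?_)
  have h1 : ContinuousOn (fun y : WarpedSpace lam N => s q y.1 ^ 2)
      {y | y.2 ∈ prodSource m x} := ((hs_cont q).comp (by fun_prop) fun y _ => y.1.2).pow 2
  have h2 : ContinuousOn (fun y : WarpedSpace lam N => chartGram (g q) (x q) (y.2 q))
      {y | y.2 ∈ prodSource m x} :=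
    (continuousOn_chartGram (g q) (x q)).comp (by fun_prop) fun y hy => hy q
  exact h1.smul h2

namespace IsGraphNhd

variable (hG : IsGraphNhd (m := m) x Ω V T f L) (hlam : 0 < lam)
  {z₀ : EuclideanSpace ℝ (Fin (∑ q, m q))} {ε : ℝ}
  (hD : graphDomain hlam x.2 T f V = Metric.ball z₀ ε)

include hG hD

/-- By the theorem of Rademacher, the points of differentiability of `f` are dense. -/
lemma uniqueDiffWithinAt {z : EuclideanSpace ℝ (Fin (∑ q, m q))} (hz : z ∈ Metric.ball z₀ ε) :
    UniqueDiffWithinAt ℝ (graphDomain hlam x.2 T f V ∩ {z | DifferentiableAt ℝ f z}) z := by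
  rw [hD, ← uniqueDiffWithinAt_closure]
  have hd : Dense {z | DifferentiableAt ℝ f z} :=
    Measure.dense_of_ae (μ := volume) hG.lipschitz.ae_differentiableAt
  exact (Metric.isOpen_ball.uniqueDiffWithinAt hz).mono
    (hd.open_subset_closure_inter Metric.isOpen_ball)

lemma radialDeriv_graphMap {z : EuclideanSpace ℝ (Fin (∑ q, m q))}
    (hz : z ∈ graphDomain hlam x.2 T f V ∩ {z | DifferentiableAt ℝ f z}) :
    radialDeriv (graphMap hlam x.2 T f)
      (graphDomain hlam x.2 T f V ∩ {z | DifferentiableAt ℝ f z}) z =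
        fderiv ℝ (graphRadius T f) z := by
  have h := (differentiableAt_graph (T := T) hz.2).1.hasFDerivAt.hasFDerivWithinAt
    (s := graphDomain hlam x.2 T f V ∩ {z | DifferentiableAt ℝ f z})
  exact (h.congr (fun w hw => hG.coe_graphMap_fst hlam hw.1)
    (hG.coe_graphMap_fst hlam hz.1)).fderivWithin (hG.uniqueDiffWithinAt hlam hD (hD ▸ hz.1))

lemma prodDeriv_graphMap {z : EuclideanSpace ℝ (Fin (∑ q, m q))}
    (hz : z ∈ graphDomain hlam x.2 T f V ∩ {z | DifferentiableAt ℝ f z}) :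
    prodDeriv x.2 (fun z => (graphMap hlam x.2 T f z).2)
      (graphDomain hlam x.2 T f V ∩ {z | DifferentiableAt ℝ f z}) z =
        fderiv ℝ (graphBase T f) z := by
  have h := (differentiableAt_graph (T := T) hz.2).2.hasFDerivAt.hasFDerivWithinAt
    (s := graphDomain hlam x.2 T f V ∩ {z | DifferentiableAt ℝ f z})
  have h1 := h.congr (fun w hw => hG.prodChart_graphMap hlam hw.1)
    (hG.prodChart_graphMap hlam hz.1)
  have h2 := hasFDerivWithinAt_prodChart_comp (G := fun z => (graphMap hlam x.2 T f z).2)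
    (fun q => (hG.isPatch hlam).differentiable_base q z hz) (x := x.2)
    (prodChartSymm_mem hz.1.1.2)
  exact (hG.uniqueDiffWithinAt hlam hD (hD ▸ hz.1)).eq h2 h1

/-- Over a ball, the derivatives that occur in `patchGram` are the derivatives of the coordinates of
the graph, which depend measurably on the point. -/
lemma aemeasurable_sqrt_det_patchGram (hs_cont : ∀ q, ContinuousOn (s q) (radialInterval lam)) :
    AEMeasurable (fun z => ENNReal.ofReal (√(patchGram s g
      (graphDomain hlam x.2 T f V ∩ {z | DifferentiableAt ℝ f z}) (graphMap hlam x.2 T f) z).det))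
      (volume.restrict (graphDomain hlam x.2 T f V ∩ {z | DifferentiableAt ℝ f z})) := by
  set F := graphMap hlam x.2 T f with hFdef
  set K := graphDomain hlam x.2 T f V ∩ {z | DifferentiableAt ℝ f z} with hK
  have hF : IsPatch m (frontier Ω) K F := hG.isPatch hlam
  have hdet : Continuous fun M : Fin (∑ q, m q) → Fin (∑ q, m q) → ℝ => √(Matrix.of M).det := by
    have : Continuous fun M : Fin (∑ q, m q) → Fin (∑ q, m q) → ℝ => (Matrix.of M).det :=
      Continuous.matrix_det continuous_id
    exact Real.continuous_sqrt.comp this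
  refine ENNReal.measurable_ofReal.comp_aemeasurable ?_
  refine (hdet.measurable.comp_aemeasurable (f := fun z i j => patchGram s g K F z i j) ?_)
  refine aemeasurable_pi_lambda _ fun i => aemeasurable_pi_lambda _ fun j => ?_
  have hρ : ∀ v, Measurable fun z => fderiv ℝ (graphRadius T f) z v := fun v =>
    measurable_fderiv_apply_const ℝ _ v
  have hβ : ∀ v (a : Σ q, Fin (m q)),
      Measurable fun z => fderiv ℝ (graphBase T f) z v (finSigmaFinEquiv a) := fun v a =>
    (EuclideanSpace.proj (𝕜 := ℝ) (finSigmaFinEquiv a)).continuous.measurable.comp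
      (measurable_fderiv_apply_const ℝ _ v)
  have hblock : ∀ a b : Σ q, Fin (m q), AEMeasurable
      (fun z => blockGram (fun q => s q (F z).1) g x.2 (F z).2 a b) (volume.restrict K) := by
    intro a b
    have h1 := (continuousOn_blockGram g hs_cont x.2).comp hF.continuousOn
      fun z hz => prodChartSymm_mem hz.1.1.2
    have h2 : Continuous fun M : Matrix (Σ q, Fin (m q)) (Σ q, Fin (m q)) ℝ => M a b := by fun_prop
    exact (h2.comp_continuousOn h1).aemeasurable hF.measurableSet
  have hmeas : AEMeasurable (fun z =>
      (∑ a, fderiv ℝ (graphBase T f) z (EuclideanSpace.single i 1) (finSigmaFinEquiv a) *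
        ∑ b, blockGram (fun q => s q (F z).1) g x.2 (F z).2 a b *
          fderiv ℝ (graphBase T f) z (EuclideanSpace.single j 1) (finSigmaFinEquiv b)) +
      fderiv ℝ (graphRadius T f) z (EuclideanSpace.single i 1) *
        fderiv ℝ (graphRadius T f) z (EuclideanSpace.single j 1)) (volume.restrict K) := by
    refine AEMeasurable.add (Finset.aemeasurable_fun_sum _ fun a _ => ?_)
      ((hρ _).mul (hρ _)).aemeasurable
    exact (hβ _ a).aemeasurable.mul
      (Finset.aemeasurable_fun_sum _ fun b _ => (hblock a b).mul (hβ _ b).aemeasurable)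
  refine hmeas.congr ?_
  filter_upwards [ae_restrict_mem hF.measurableSet] with z hz
  have hsrc : (F z).2 ∈ prodSource m x.2 := prodChartSymm_mem hz.1.1.2
  rw [patchGram_eq, Matrix.add_apply, baseGram_apply _ g K (fun z => (F z).2) z hsrc,
    hG.prodDeriv_graphMap hlam hD hz, hG.radialDeriv_graphMap hlam hD hz, Matrix.vecMulVec_apply]
  rfl

/-- If the area of `∂Ω` in `V` does not exceed the measure of the part of the graph of `u` in `V`,
then `∂Ω` is a part of a coordinate slice there: the radial component of a parametrization of `∂Ω`
has vanishing derivative almost everywhere. -/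
lemma fst_eq_of_riemannianMeasure_le (hs_cont : ∀ q, ContinuousOn (s q) (radialInterval lam))
    (hs : ∀ q, ∀ r ∈ radialInterval lam, 0 ≤ s q r)
    (hA_pos : ∀ r ∈ radialInterval lam, 0 < r → 0 < areaFactor m s r)
    {u : (∀ q, N q) → radialInterval lam} (hu : Measurable u) (hfr : ∀ θ, (u θ, θ) ∈ frontier Ω)
    (hpos : ∀ z ∈ Metric.ball z₀ ε, 0 < graphRadius T f z)
    (hfin : graphMeasure s g u V ≠ ⊤)
    (hle : riemannianMeasure s g (∑ q, m q) (frontier Ω) V ≤ graphMeasure s g u V)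
    {y y' : WarpedSpace lam N} (hy : y ∈ frontier Ω) (hyV : y ∈ V) (hy' : y' ∈ frontier Ω)
    (hyV' : y' ∈ V) : (y.1 : ℝ) = y'.1 := by
  have hVm : MeasurableSet V := hG.isOpen.measurableSet
  have hg := graphMeasure_le_setLIntegral (g := g) hlam hs_cont hs hu hfr hG subset_rfl hVm
  have hmeas := hG.aemeasurable_sqrt_det_patchGram (g := g) hlam hD hs_cont
  have himm : ∀ z ∈ graphDomain hlam x.2 T f V ∩ {z | DifferentiableAt ℝ f z}, ∀ v, _ :=
    fun z hz v => eq_zero_of_fderiv_graph_eq_zero (T := T) (v := v) hz.2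
  have hrd := fun z hz => hG.radialDeriv_graphMap hlam hD (z := z) hz
  have hpd := fun z hz => hG.prodDeriv_graphMap hlam hD (z := z) hz
  set F := graphMap hlam x.2 T f with hFdef
  set K := graphDomain hlam x.2 T f V ∩ {z | DifferentiableAt ℝ f z} with hK
  have hF : IsPatch m (frontier Ω) K F := hG.isPatch hlam
  have hKV : K ∩ F ⁻¹' V = K := inter_eq_left.2 fun z hz => hz.1.2
  rw [hKV] at hg
  have hp := patchMeasure_le_riemannianMeasure s g hF V
  rw [patchMeasure_apply s g hF hVm, hKV] at hp
  have hup := (hp.trans hle).trans hg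
  have hlow : ∀ z, ENNReal.ofReal (areaFactor m s (F z).1 *
      baseJacobian g K (fun z => (F z).2) z) ≤ ENNReal.ofReal (√(patchGram s g K F z).det) :=
    fun z => ENNReal.ofReal_le_ofReal (areaFactor_mul_baseJacobian_le hs K F z)
  have hfin' : ∫⁻ z in K, ENNReal.ofReal (areaFactor m s (F z).1 *
      baseJacobian g K (fun z => (F z).2) z) ≠ ⊤ :=
    ((lintegral_mono hlow).trans_lt ((hp.trans hle).trans_lt hfin.lt_top)).ne
  have hae := ae_eq_of_ae_le_of_lintegral_le (Filter.Eventually.of_forall hlow) hfin' hmeas hup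
  rw [Filter.EventuallyEq, ae_restrict_iff' hF.measurableSet] at hae
  have hder : ∀ᵐ z, z ∈ Metric.ball z₀ ε →
      HasFDerivAt (graphRadius T f) (0 : EuclideanSpace ℝ (Fin (∑ q, m q)) →L[ℝ] ℝ) z := by
    filter_upwards [hae, hG.lipschitz.ae_differentiableAt] with z hz hdz hzD
    have hzK : z ∈ K := ⟨hD ▸ hzD, hdz⟩
    have hr0 : 0 < ((F z).1 : ℝ) := by
      rw [hG.coe_graphMap_fst hlam hzK.1]
      exact hpos z hzD
    have hsrc : (F z).2 ∈ prodSource m x.2 := prodChartSymm_mem hzK.1.1.2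
    have h1 := (ENNReal.ofReal_le_ofReal_iff (mul_nonneg (areaFactor_nonneg hs (F z).1.2)
      (show 0 ≤ baseJacobian g K (fun z => (F z).2) z from Real.sqrt_nonneg _))).1 (hz hzK).ge
    rw [baseJacobian_eq g K (fun z => (F z).2) z hsrc] at h1
    have h2 := radialDeriv_eq_zero hA_pos hs K F z hsrc hr0 (fun v hv1 hv2 => by
      rw [hrd z hzK] at hv1
      rw [hpd z hzK] at hv2
      exact himm z hzK v hv1 hv2) h1
    rw [← h2, hrd z hzK]
    exact (differentiableAt_graph hdz).1.hasFDerivAt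
  obtain ⟨⟨_, hl⟩, _⟩ := exists_lipschitzWith_graph (T := T) hG.lipschitz
  have hmem : ∀ w ∈ V, w ∈ frontier Ω → ∃ z ∈ Metric.ball z₀ ε, (w.1 : ℝ) = graphRadius T f z := by
    intro w hw hwf
    exact ⟨_, hD ▸ (hG.mem_graphDomain hlam hw hwf).1,
      (graphRadius_warpedCoord ((hG.frontier_iff w hw).1 hwf)).1.symm⟩
  obtain ⟨z, hz, h1⟩ := hmem y hyV hy
  obtain ⟨z', hz', h2⟩ := hmem y' hyV' hy'
  rw [h1, h2]
  exact hl.eq_of_ae_hasFDerivAt_zero volume Metric.isOpen_ball (convex_ball _ _) hder hz hz'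

end IsGraphNhd

end Rigidity

section Topological

variable {p : ℕ} {lam : EReal} {N : Fin p → Type*} [∀ q, TopologicalSpace (N q)]
  {Ω : Set (WarpedSpace lam N)}

lemma isPreconnected_radial (lam : EReal) {S : Set ℝ} (hS : S.OrdConnected) :
    IsPreconnected {t : radialInterval lam | (t : ℝ) ∈ S} := by
  rw [← Topology.IsInducing.subtypeVal.isPreconnected_image]
  have : Subtype.val '' {t : radialInterval lam | (t : ℝ) ∈ S} = S ∩ radialInterval lam := by
    ext t
    constructor
    · rintro ⟨t, ht, rfl⟩
      exact ⟨ht, t.2⟩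
    · exact fun h => ⟨⟨t, h.2⟩, h.1, rfl⟩
  rw [this]
  exact (hS.inter (ordConnected_radialInterval lam)).isPreconnected

lemma tendsto_toRadial_prodMk (w : WarpedSpace lam N) (hlam : 0 < lam) :
    Filter.Tendsto (fun t => (toRadial hlam t, w.2)) (𝓝[radialInterval lam] (w.1 : ℝ)) (𝓝 w) := by
  have h := (continuousOn_toRadial hlam (w.1 : ℝ) w.1.2).tendsto
  rw [toRadial_of_mem hlam w.1.2] at h
  exact h.prodMk_nhds tendsto_const_nhds

/-- Points of an open set can be moved to larger radii. -/
lemma IsOpen.exists_lt_fst (hΩ : IsOpen Ω) {w : WarpedSpace lam N} (hw : w ∈ Ω) :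
    ∃ w' ∈ Ω, w.1 < w'.1 := by
  have hlam : 0 < lam := (EReal.coe_nonneg.2 w.1.2.1).trans_lt w.1.2.2
  obtain ⟨R', hR', hlt⟩ := exists_gt_mem_radialInterval w.1.2
  have hmem : ∀ᶠ t in 𝓝[>] (w.1 : ℝ), t ∈ radialInterval lam := by
    filter_upwards [Ioo_mem_nhdsGT hlt] with t ht
    exact (ordConnected_radialInterval lam).out w.1.2 hR' ⟨ht.1.le, ht.2.le⟩
  have hle : 𝓝[>] (w.1 : ℝ) ≤ 𝓝[radialInterval lam] (w.1 : ℝ) :=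
    le_inf nhdsWithin_le_nhds (Filter.le_principal_iff.2 hmem)
  have h := ((tendsto_toRadial_prodMk w hlam).mono_left hle).eventually (hΩ.mem_nhds hw)
  obtain ⟨t, ht, htm, hgt⟩ := (h.and (hmem.and self_mem_nhdsWithin)).exists
  refine ⟨_, ht, ?_⟩
  simp only [toRadial_of_mem hlam htm]
  exact hgt

/-- Points of an open set with `r > 0` can be moved to smaller positive radii. -/
lemma IsOpen.exists_fst_lt (hΩ : IsOpen Ω) {w : WarpedSpace lam N} (hw : w ∈ Ω)
    (hw0 : 0 < (w.1 : ℝ)) : ∃ w' ∈ Ω, w'.1 < w.1 := by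
  have hlam : 0 < lam := (EReal.coe_nonneg.2 w.1.2.1).trans_lt w.1.2.2
  have hmem : ∀ᶠ t in 𝓝[<] (w.1 : ℝ), t ∈ radialInterval lam := by
    filter_upwards [Ioo_mem_nhdsLT hw0] with t ht
    exact Icc_subset_radialInterval w.1.2 ⟨ht.1.le, ht.2.le⟩
  have hle : 𝓝[<] (w.1 : ℝ) ≤ 𝓝[radialInterval lam] (w.1 : ℝ) :=
    le_inf nhdsWithin_le_nhds (Filter.le_principal_iff.2 hmem)
  have h := ((tendsto_toRadial_prodMk w hlam).mono_left hle).eventually (hΩ.mem_nhds hw)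
  obtain ⟨t, ht, htm, hgt⟩ := (h.and (hmem.and self_mem_nhdsWithin)).exists
  refine ⟨_, ht, ?_⟩
  simp only [toRadial_of_mem hlam htm]
  exact hgt

/-- If near `x` the boundary of `Ω` lies in the slice through `x`, then `Ω` and its exterior are the
two sides of this slice near `x`, so that the boundary contains the slice near `x`. -/
lemma eventually_mem_frontier [LocallyConnectedSpace (∀ q, N q)] (hΩ : IsOpen Ω)
    {x : WarpedSpace lam N} (hx : x ∈ frontier Ω) (hx0 : 0 < (x.1 : ℝ))
    (hext : x ∈ closure (closure Ω)ᶜ) (hfst : ∀ᶠ y in 𝓝 x, y ∈ frontier Ω → y.1 = x.1) :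
    ∀ᶠ θ in 𝓝 x.2, (x.1, θ) ∈ frontier Ω := by
  obtain ⟨I, hI, Q', hQ', hsub⟩ := mem_nhds_prod_iff.1 hfst
  obtain ⟨δ, hδ, hball⟩ := Metric.mem_nhds_iff.1 hI
  obtain ⟨Q, hQQ', hQo, hxQ, hQc⟩ :=
    locallyConnectedSpace_iff_subsets_isOpen_isConnected.1 ‹_› x.2 Q' hQ'
  set W : Set (WarpedSpace lam N) := Metric.ball x.1 δ ×ˢ Q with hW
  have hWo : IsOpen W := Metric.isOpen_ball.prod hQo
  have hWf : ∀ y ∈ W, y ∈ frontier Ω → y.1 = x.1 := fun y hy =>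
    hsub (show y ∈ I ×ˢ Q' from ⟨hball hy.1, hQQ' hy.2⟩)
  set Cl : Set (WarpedSpace lam N) :=
    {t : radialInterval lam | (t : ℝ) ∈ Ioo ((x.1 : ℝ) - δ) x.1} ×ˢ Q with hCl
  set Cr : Set (WarpedSpace lam N) :=
    {t : radialInterval lam | (t : ℝ) ∈ Ioo (x.1 : ℝ) (x.1 + δ)} ×ˢ Q with hCr
  have hClW : Cl ⊆ W := by
    rintro y ⟨⟨h1, h2⟩, h3⟩
    refine ⟨?_, h3⟩
    rw [Metric.mem_ball, Subtype.dist_eq, Real.dist_eq, abs_lt]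
    constructor <;> linarith
  have hCrW : Cr ⊆ W := by
    rintro y ⟨⟨h1, h2⟩, h3⟩
    refine ⟨?_, h3⟩
    rw [Metric.mem_ball, Subtype.dist_eq, Real.dist_eq, abs_lt]
    constructor <;> linarith
  have hWCl : ∀ y ∈ W, y.1 < x.1 → y ∈ Cl := by
    rintro y ⟨h1, h2⟩ hlt
    rw [Metric.mem_ball, Subtype.dist_eq, Real.dist_eq, abs_lt] at h1
    exact ⟨⟨by linarith, hlt⟩, h2⟩
  have hWCr : ∀ y ∈ W, x.1 < y.1 → y ∈ Cr := by
    rintro y ⟨h1, h2⟩ hlt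
    rw [Metric.mem_ball, Subtype.dist_eq, Real.dist_eq, abs_lt] at h1
    exact ⟨⟨hlt, by linarith⟩, h2⟩
  have hl : Cl ⊆ Ω ∨ Cl ⊆ (closure Ω)ᶜ :=
    ((isPreconnected_radial lam ordConnected_Ioo).prod
      hQc.isPreconnected).subset_or_disjoint_closure hΩ fun y hy hyf =>
      (ne_of_lt (show y.1 < x.1 from hy.1.2)) (hWf y (hClW hy) hyf)
  have hr : Cr ⊆ Ω ∨ Cr ⊆ (closure Ω)ᶜ :=
    ((isPreconnected_radial lam ordConnected_Ioo).prod
      hQc.isPreconnected).subset_or_disjoint_closure hΩ fun y hy hyf =>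
      (ne_of_gt (show x.1 < y.1 from hy.1.1)) (hWf y (hCrW hy) hyf)
  -- every open set that accumulates at `x` meets one of the two sides
  have hmeet : ∀ O : Set (WarpedSpace lam N), IsOpen O → x ∈ closure O →
      (Cl ∩ O).Nonempty ∨ (Cr ∩ O).Nonempty := by
    intro O hO hxO
    obtain ⟨w, hwW, hwO⟩ := mem_closure_iff.1 hxO W hWo ⟨Metric.mem_ball_self hδ, hxQ⟩
    rcases lt_or_ge w.1 x.1 with h | h
    · exact Or.inl ⟨w, hWCl w hwW h, hwO⟩
    · obtain ⟨w', hw', hlt⟩ := (hWo.inter hO).exists_lt_fst ⟨hwW, hwO⟩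
      exact Or.inr ⟨w', hWCr w' hw'.1 (h.trans_lt hlt), hw'.2⟩
  have hside : (Cl ⊆ Ω ∧ Cr ⊆ (closure Ω)ᶜ) ∨ (Cr ⊆ Ω ∧ Cl ⊆ (closure Ω)ᶜ) := by
    have hdisj : ∀ y, y ∈ Ω → y ∈ (closure Ω)ᶜ → False := fun y h1 h2 => h2 (subset_closure h1)
    have h1 := hmeet Ω hΩ (frontier_subset_closure hx)
    have h2 := hmeet _ isClosed_closure.isOpen_compl hext
    rcases hl with hl | hl <;> rcases hr with hr | hr
    · rcases h2 with ⟨y, hy, hy'⟩ | ⟨y, hy, hy'⟩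
      · exact (hdisj y (hl hy) hy').elim
      · exact (hdisj y (hr hy) hy').elim
    · exact Or.inl ⟨hl, hr⟩
    · exact Or.inr ⟨hr, hl⟩
    · rcases h1 with ⟨y, hy, hy'⟩ | ⟨y, hy, hy'⟩
      · exact (hdisj y hy' (hl hy)).elim
      · exact (hdisj y hy' (hr hy)).elim
  filter_upwards [hQo.mem_nhds hxQ] with θ hθ
  have hθW : (x.1, θ) ∈ W := ⟨Metric.mem_ball_self hδ, hθ⟩
  have hcl : (x.1, θ) ∈ closure Cl := mem_closure_iff.2 fun O hO hθO => by
    obtain ⟨w, hw, hlt⟩ := (hO.inter hWo).exists_fst_lt ⟨hθO, hθW⟩ hx0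
    exact ⟨w, hw.1, hWCl w hw.2 hlt⟩
  have hcr : (x.1, θ) ∈ closure Cr := mem_closure_iff.2 fun O hO hθO => by
    obtain ⟨w, hw, hlt⟩ := (hO.inter hWo).exists_lt_fst ⟨hθO, hθW⟩
    exact ⟨w, hw.1, hWCr w hw.2 hlt⟩
  have hcompl : (closure Ω)ᶜ ⊆ Ωᶜ := compl_subset_compl.2 subset_closure
  rw [frontier_eq_closure_inter_closure]
  rcases hside with ⟨h1, h2⟩ | ⟨h1, h2⟩
  · exact ⟨closure_mono h1 hcl, closure_mono (h2.trans hcompl) hcr⟩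
  · exact ⟨closure_mono h1 hcr, closure_mono (h2.trans hcompl) hcl⟩

lemma slice_subset_frontier [PreconnectedSpace (∀ q, N q)] {r₀ : radialInterval lam}
    (h : ∀ θ, (r₀, θ) ∈ frontier Ω → ∀ᶠ θ' in 𝓝 θ, (r₀, θ') ∈ frontier Ω) {θ₀ : ∀ q, N q}
    (h₀ : (r₀, θ₀) ∈ frontier Ω) (θ : ∀ q, N q) : (r₀, θ) ∈ frontier Ω := by
  have hclopen : IsClopen {θ : ∀ q, N q | (r₀, θ) ∈ frontier Ω} :=
    ⟨isClosed_frontier.preimage (by fun_prop : Continuous fun θ : (∀ q, N q) => (r₀, θ)),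
      isOpen_iff_mem_nhds.2 h⟩
  exact (hclopen.eq_univ ⟨θ₀, h₀⟩ ▸ mem_univ θ : θ ∈ {θ : ∀ q, N q | (r₀, θ) ∈ frontier Ω})

/-- If the part of `∂Ω` with `r > 0` is a single slice `{r = r₀}`, then `∂Ω` has no points with `r =
0`: otherwise `Ω` contains all the points with `0 < r < r₀`, and then `closure Ω` contains all the
points with `r < r₀`, which the assumption excludes. -/
lemma frontier_eq_slice [PreconnectedSpace (∀ q, N q)] (hΩ : IsOpen Ω) {r₀ : radialInterval lam}
    (hr₀ : 0 < (r₀ : ℝ)) (hslice : ∀ θ, (r₀, θ) ∈ frontier Ω)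
    (huniq : ∀ y ∈ frontier Ω, 0 < (y.1 : ℝ) → y.1 = r₀)
    (hext : (∃ x ∈ frontier Ω, (x.1 : ℝ) = 0) →
      ∀ ε : ℝ, 0 < ε → ∃ x : WarpedSpace lam N, x ∉ closure Ω ∧ (x.1 : ℝ) < ε) :
    frontier Ω = slice lam N r₀ := by
  set J : Set (WarpedSpace lam N) :=
    {t : radialInterval lam | (t : ℝ) ∈ Ioo (0 : ℝ) r₀} ×ˢ univ with hJ
  have hJor : J ⊆ Ω ∨ J ⊆ (closure Ω)ᶜ :=
    ((isPreconnected_radial lam ordConnected_Ioo).prod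
      isPreconnected_univ).subset_or_disjoint_closure hΩ fun y hy hyf =>
      (ne_of_lt (show y.1 < r₀ from hy.1.2)) (huniq y hyf hy.1.1)
  have hball : IsOpen {y : WarpedSpace lam N | y.1 < r₀} :=
    isOpen_lt continuous_fst continuous_const
  have h0 : ∀ y ∈ frontier Ω, 0 < (y.1 : ℝ) := by
    intro y hy
    by_contra hy0
    have hy0 : (y.1 : ℝ) = 0 := le_antisymm (not_lt.1 hy0) y.1.2.1
    rcases hJor with h | h
    -- if `J ⊆ Ω`, no point with `r < r₀` is outside of the closure of `Ω`
    · obtain ⟨w, hw, hwr⟩ := hext ⟨y, hy, hy0⟩ r₀ hr₀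
      refine hw (closure_mono h (mem_closure_iff.2 fun O hO hwO => ?_))
      obtain ⟨w', hw', hlt⟩ := (hO.inter hball).exists_lt_fst ⟨hwO, hwr⟩
      exact ⟨w', hw'.1, ⟨w.1.2.1.trans_lt hlt, hw'.2⟩, mem_univ _⟩
    -- if `J` is exterior, the points of `Ω` near `y` have `r = 0`, but `Ω` is open
    · obtain ⟨w, hwr, hwΩ⟩ := mem_closure_iff.1 (frontier_subset_closure hy) _ hball
        (show (y.1 : ℝ) < r₀ from hy0 ▸ hr₀)
      obtain ⟨w', hw', hlt⟩ := (hΩ.inter hball).exists_lt_fst ⟨hwΩ, hwr⟩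
      exact h (show w' ∈ J from ⟨⟨w.1.2.1.trans_lt hlt, hw'.2⟩, mem_univ _⟩)
        (subset_closure hw'.1)
  ext y
  constructor
  · exact fun hy => congrArg Subtype.val (huniq y hy (h0 y hy))
  · intro hy
    have : y = (r₀, y.2) := Prod.ext (Subtype.ext hy) rfl
    rw [this]
    exact hslice _

/-- An open set below a coordinate slice that is its boundary is a ball. -/
lemma eq_warpedBall_of_frontier_eq_slice [LocallyConnectedSpace (∀ q, N q)] (hΩ : IsOpen Ω)
    {r₀ : ℝ} (hr₀ : r₀ ∈ radialInterval lam) (hfr : frontier Ω = slice lam N r₀)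
    (hlt : ∀ y ∈ Ω, (y.1 : ℝ) < r₀) : Ω = warpedBall lam N r₀ := by
  refine Subset.antisymm hlt fun y hy => ?_
  obtain ⟨Q, -, hQo, hyQ, hQc⟩ :=
    locallyConnectedSpace_iff_subsets_isOpen_isConnected.1 ‹_› y.2 univ Filter.univ_mem
  set J : Set (WarpedSpace lam N) := {t : radialInterval lam | (t : ℝ) ∈ Iio r₀} ×ˢ Q with hJ
  have hJor : J ⊆ Ω ∨ J ⊆ (closure Ω)ᶜ :=
    ((isPreconnected_radial lam ordConnected_Iio).prod
      hQc.isPreconnected).subset_or_disjoint_closure hΩ fun y hy hyf => by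
        rw [hfr] at hyf
        exact absurd hyf (ne_of_lt hy.1)
  rcases hJor with h | h
  · exact h ⟨hy, hyQ⟩
  · have hmem : ((⟨r₀, hr₀⟩ : radialInterval lam), y.2) ∈ frontier Ω := by
      rw [hfr]
      rfl
    obtain ⟨w, hwQ, hwΩ⟩ := mem_closure_iff.1 (frontier_subset_closure hmem) (univ ×ˢ Q)
      (isOpen_univ.prod hQo) ⟨mem_univ _, hyQ⟩
    exact (h (show w ∈ J from ⟨hlt w hwΩ, hwQ.2⟩) (subset_closure hwΩ)).elim

end Topological

/-- Ordered measures that give the same finite value to a positive finite density agree. -/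
lemma MeasureTheory.Measure.eq_of_le_of_lintegral_le {X : Type*} [MeasurableSpace X]
    {μ ν : Measure X} (h : ν ≤ μ) {f : X → ℝ≥0∞} (hf : Measurable f) (hf0 : ∀ x, f x ≠ 0)
    (hft : ∀ x, f x ≠ ⊤) (hfin : ∫⁻ x, f x ∂ν ≠ ⊤) (hle : ∫⁻ x, f x ∂μ ≤ ∫⁻ x, f x ∂ν) :
    ν = μ := by
  have h1 : ν.withDensity f ≤ μ.withDensity f := Measure.le_iff.2 fun B hB => by
    rw [withDensity_apply _ hB, withDensity_apply _ hB]
    exact lintegral_mono' (Measure.restrict_mono subset_rfl h) le_rfl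
  have h2 : IsFiniteMeasure (ν.withDensity f) := isFiniteMeasure_withDensity hfin
  have h3 : ν.withDensity f = μ.withDensity f := by
    refine Measure.eq_of_le_of_measure_univ_eq h1 (le_antisymm (h1 _) ?_)
    simpa [withDensity_apply _ MeasurableSet.univ] using hle
  rw [← withDensity_inv_same (μ := ν) hf (ae_of_all _ hf0) (ae_of_all _ hft), h3,
    withDensity_inv_same hf (ae_of_all _ hf0) (ae_of_all _ hft)]

section Rigidity

variable {p : ℕ} {m : Fin p → ℕ} {lam : EReal} {N : Fin p → Type*}
  [∀ q, TopologicalSpace (N q)] [∀ q, ChartedSpace (EuclideanSpace ℝ (Fin (m q))) (N q)]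
  [∀ q, IsManifold (𝓡 (m q)) ∞ (N q)]
  [∀ q, MeasurableSpace (N q)] [∀ q, BorelSpace (N q)] [∀ q, SecondCountableTopology (N q)]
  [∀ q, CompactSpace (N q)] [∀ q, T2Space (N q)]
  {s : Fin p → ℝ → ℝ} {g : ∀ q, SmoothMetric (m q) (N q)} {Ω : Set (WarpedSpace lam N)}

lemma graphMeasure_univ_ne_top (hs_cont : ∀ q, ContinuousOn (s q) (radialInterval lam))
    {u : (∀ q, N q) → radialInterval lam} (hu : Measurable u) {R : ℝ}
    (hR : R ∈ radialInterval lam) (huR : ∀ θ, (u θ : ℝ) ≤ R) : graphMeasure s g u univ ≠ ⊤ := by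
  obtain ⟨C, hC⟩ := isCompact_Icc.bddAbove_image
    ((continuousOn_areaFactor (m := m) hs_cont).mono (Icc_subset_radialInterval hR))
  rw [graphMeasure_apply hu MeasurableSet.univ]
  refine ne_of_lt ?_
  calc ∫⁻ θ in (fun θ => (u θ, θ)) ⁻¹' univ, ENNReal.ofReal (areaFactor m s (u θ)) ∂baseMeasure g
      ≤ ∫⁻ θ, ENNReal.ofReal C ∂baseMeasure g := by
        rw [preimage_univ, Measure.restrict_univ]
        exact lintegral_mono fun θ => ENNReal.ofReal_le_ofReal
          (hC ⟨u θ, ⟨(u θ).2.1, huR θ⟩, rfl⟩)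
    _ < ⊤ := by
        rw [lintegral_const]
        exact ENNReal.mul_lt_top ENNReal.ofReal_lt_top (measure_lt_top _ _)

/-- A boundary whose area measure is that of a graph over the base is a coordinate slice, if the
base is connected. -/
theorem exists_frontier_eq_slice [∀ q, Nonempty (N q)] [∀ q, ConnectedSpace (N q)] (hlam : 0 < lam)
    (hs_cont : ∀ q, ContinuousOn (s q) (radialInterval lam))
    (hs : ∀ q, ∀ r ∈ radialInterval lam, 0 ≤ s q r)
    (hA_pos : ∀ r ∈ radialInterval lam, 0 < r → 0 < areaFactor m s r)
    (hΩ : IsOpen Ω) (hlip : HasLipschitzBoundary m s Ω)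
    {u : (∀ q, N q) → radialInterval lam} (hu : Measurable u) (hfr : ∀ θ, (u θ, θ) ∈ frontier Ω)
    (htop : ∀ y ∈ frontier Ω, y.1 ≤ u y.2) {R : ℝ} (hR : R ∈ radialInterval lam)
    (huR : ∀ θ, (u θ : ℝ) ≤ R)
    (hle : riemannianMeasure s g (∑ q, m q) (frontier Ω) ≤ graphMeasure s g u)
    (hext : (∃ x ∈ frontier Ω, (x.1 : ℝ) = 0) →
      ∀ ε : ℝ, 0 < ε → ∃ x : WarpedSpace lam N, x ∉ closure Ω ∧ (x.1 : ℝ) < ε) :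
    ∃ r₀ ∈ radialInterval lam, frontier Ω = slice lam N r₀ := by
  have hlc : ∀ q, LocallyConnectedSpace (N q) := fun q =>
    ChartedSpace.locallyConnectedSpace (EuclideanSpace ℝ (Fin (m q))) (N q)
  have hfin := graphMeasure_univ_ne_top (g := g) hs_cont hu hR huR
  have hloc : ∀ x ∈ frontier Ω, 0 < (x.1 : ℝ) → ∀ᶠ θ in 𝓝 x.2, (x.1, θ) ∈ frontier Ω := by
    intro x hx hx0
    obtain ⟨V, T, f, L, hG⟩ := (hlip x hx (hA_pos _ x.1.2 hx0).ne').exists_isGraphNhd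
    obtain ⟨V', ε, hε, hG', hD, hpos⟩ := hG.exists_graphDomain_eq_ball hlam hx hx0
    refine eventually_mem_frontier hΩ hx hx0 (hG.mem_closure_compl_closure hx hx0) ?_
    filter_upwards [hG'.isOpen.mem_nhds hG'.mem] with y hyV hy
    exact Subtype.ext (hG'.fst_eq_of_riemannianMeasure_le hlam hD hs_cont hs hA_pos hu hfr hpos
      (ne_top_of_le_ne_top hfin (measure_mono (subset_univ _))) (hle _) hy hyV hx hG'.mem)
  have hslice : ∀ x ∈ frontier Ω, 0 < (x.1 : ℝ) → ∀ θ, (x.1, θ) ∈ frontier Ω := by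
    intro x hx hx0 θ
    exact slice_subset_frontier (r₀ := x.1) (fun θ hθ => hloc (x.1, θ) hθ hx0) (θ₀ := x.2) hx θ
  -- a slice in the boundary has positive area, so that it meets the graph of `u`
  have hmeet : ∀ x ∈ frontier Ω, 0 < (x.1 : ℝ) → ∃ θ, u θ = x.1 := by
    intro x hx hx0
    by_contra hno
    push Not at hno
    have hSm : MeasurableSet {y : WarpedSpace lam N | y.1 = x.1} :=
      measurable_fst (measurableSet_singleton x.1)
    have h1 := (graphMeasure_le (g := g) hlam hs_cont hs hlip (u := fun _ => x.1)
      measurable_const (hslice x hx hx0)).trans hle {y : WarpedSpace lam N | y.1 = x.1}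
    rw [graphMeasure_apply measurable_const hSm, graphMeasure_apply hu hSm] at h1
    have e1 : (fun θ : (∀ q, N q) => (u θ, θ)) ⁻¹' {y : WarpedSpace lam N | y.1 = x.1} = ∅ :=
      eq_empty_of_forall_notMem fun θ hθ => hno θ hθ
    have e2 : (fun θ : (∀ q, N q) => (x.1, θ)) ⁻¹' {y : WarpedSpace lam N | y.1 = x.1} = univ :=
      eq_univ_of_forall fun θ => rfl
    rw [e1, e2, Measure.restrict_univ, Measure.restrict_empty, lintegral_zero_measure,
      lintegral_const, nonpos_iff_eq_zero, mul_eq_zero] at h1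
    rcases h1 with h1 | h1
    · exact (ENNReal.ofReal_pos.2 (hA_pos _ x.1.2 hx0)).ne' h1
    · exact baseMeasure_univ_ne_zero g h1
  by_cases hex : ∃ x ∈ frontier Ω, 0 < (x.1 : ℝ)
  · obtain ⟨x, hx, hx0⟩ := hex
    refine ⟨x.1, x.1.2, frontier_eq_slice hΩ hx0 (hslice x hx hx0) (fun y hy hy0 => ?_) hext⟩
    obtain ⟨θ, hθ⟩ := hmeet x hx hx0
    obtain ⟨θ', hθ'⟩ := hmeet y hy hy0
    refine le_antisymm ?_ ?_
    · exact (htop _ (hslice y hy hy0 θ)).trans hθ.le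
    · exact (htop _ (hslice x hx hx0 θ')).trans hθ'.le
  · -- if `∂Ω` has no points with `r > 0`, it is `{r = 0}` because it projects onto the base
    push Not at hex
    have h0 : ∀ y ∈ frontier Ω, (y.1 : ℝ) = 0 := fun y hy => le_antisymm (hex y hy) y.1.2.1
    refine ⟨0, zero_mem_radialInterval hlam, Subset.antisymm h0 fun y hy => ?_⟩
    have : y = (u y.2, y.2) := Prod.ext (Subtype.ext ((show (y.1 : ℝ) = 0 from hy).trans
      (h0 _ (hfr y.2)).symm)) rfl
    rw [this]
    exact hfr _

end Rigidity

/-! ### Supporting lines -/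

lemma convex_radialInterval (lam : EReal) : Convex ℝ (radialInterval lam) :=
  (ordConnected_radialInterval lam).convex

lemma exists_lt_mem_radialInterval {lam : EReal} {R : ℝ} (hR : R ∈ radialInterval lam)
    (h0 : R ≠ 0) : ∃ r ∈ radialInterval lam, r < R :=
  ⟨0, Icc_subset_radialInterval hR ⟨le_rfl, hR.1⟩, lt_of_le_of_ne hR.1 h0.symm⟩

/-- The supporting lines of a non-decreasing function `ψ` with `ψ ∘ (V W)⁻¹` convex. -/
lemma exists_support_of_convexOn_comp_invFunOn {lam : EReal} {ψ W B : ℝ → ℝ} {V : ℝ} (hV : 0 < V)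
    (hB : ∀ r ∈ radialInterval lam, B r = W r * V) (hW : StrictMonoOn W (radialInterval lam))
    (hψ : MonotoneOn ψ (radialInterval lam))
    (hconv : ConvexOn ℝ (B '' radialInterval lam) (ψ ∘ Function.invFunOn B (radialInterval lam)))
    {R : ℝ} (hR : R ∈ radialInterval lam) :
    ∃ k, 0 ≤ k ∧ ∀ r ∈ radialInterval lam, ψ R + k * (W r - W R) ≤ ψ r := by
  rcases eq_or_ne R 0 with rfl | h0
  · exact ⟨0, le_rfl, fun r hr => by simpa using hψ hR hr hr.1⟩
  have hBm : StrictMonoOn B (radialInterval lam) := fun a ha b hb hab => by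
    rw [hB a ha, hB b hb]
    exact mul_lt_mul_of_pos_right (hW ha hb hab) hV
  have hinv : ∀ r ∈ radialInterval lam, Function.invFunOn B (radialInterval lam) (B r) = r :=
    fun r hr => hBm.injOn.leftInvOn_invFunOn hr
  have hmono : MonotoneOn (ψ ∘ Function.invFunOn B (radialInterval lam))
      (B '' radialInterval lam) := by
    rintro _ ⟨a, ha, rfl⟩ _ ⟨b, hb, rfl⟩ hab
    simp only [Function.comp_apply, hinv a ha, hinv b hb]
    exact hψ ha hb ((hBm.le_iff_le ha hb).1 hab)
  obtain ⟨r₁, hr₁, hlt₁⟩ := exists_lt_mem_radialInterval hR h0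
  obtain ⟨r₂, hr₂, hlt₂⟩ := exists_gt_mem_radialInterval hR
  obtain ⟨k, hk, hsupp⟩ := hconv.exists_support hmono (mem_image_of_mem B hR)
    ⟨_, mem_image_of_mem B hr₁, hBm hr₁ hR hlt₁⟩ ⟨_, mem_image_of_mem B hr₂, hBm hR hr₂ hlt₂⟩
  refine ⟨k * V, mul_nonneg hk hV.le, fun r hr => ?_⟩
  have h1 := hsupp _ (mem_image_of_mem B hr)
  simp only [Function.comp_apply, hinv r hr, hinv R hR] at h1
  rw [hB r hr, hB R hR] at h1
  linarith

lemma integral_mul_exp (κ C a b : ℝ) :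
    ∫ t in a..b, κ * (C * Real.exp (κ * (t - b))) = C - C * Real.exp (κ * (a - b)) := by
  have h : ∀ t ∈ uIcc a b, HasDerivAt (fun t => C * Real.exp (κ * (t - b)))
      (κ * (C * Real.exp (κ * (t - b)))) t := fun t _ => by
    have h1 : HasDerivAt (fun t => κ * (t - b)) κ t := by
      simpa using ((hasDerivAt_id t).sub_const b).const_mul κ
    exact (h1.exp.const_mul C).congr_deriv (by ring)
  rw [intervalIntegral.integral_eq_sub_of_hasDerivAt h
    (Continuous.intervalIntegrable (by fun_prop) _ _)]
  simp

/-- For log-convex `A`, the function `A` has supporting lines with respect to its own primitive: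
if `κ` is the slope of a supporting line of `log A` at `R`, then `A` grows at least as
`exp (κ t)` after `R` and at most so before `R`. -/
lemma exists_support_of_log_convexOn {lam : EReal} {A : ℝ → ℝ}
    (hA_cont : ContinuousOn A (radialInterval lam)) (hA : ∀ r ∈ radialInterval lam, 0 < A r)
    (hmono : MonotoneOn A (radialInterval lam))
    (hconv : ConvexOn ℝ (radialInterval lam) fun r => Real.log (A r))
    {R : ℝ} (hR : R ∈ radialInterval lam) :
    ∃ k, 0 ≤ k ∧ ∀ r ∈ radialInterval lam,
      A R + k * ((∫ t in (0 : ℝ)..r, A t) - ∫ t in (0 : ℝ)..R, A t) ≤ A r := by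
  rcases eq_or_ne R 0 with rfl | h0
  · exact ⟨0, le_rfl, fun r hr => by simpa using hmono hR hr hr.1⟩
  have hlogm : MonotoneOn (fun r => Real.log (A r)) (radialInterval lam) := fun a ha b hb hab =>
    Real.log_le_log (hA a ha) (hmono ha hb hab)
  obtain ⟨κ, hκ, hsupp⟩ := hconv.exists_support hlogm hR
    (exists_lt_mem_radialInterval hR h0) (exists_gt_mem_radialInterval hR)
  have hexp : ∀ a ∈ radialInterval lam, ∀ b ∈ radialInterval lam,
      Real.log (A a) ≤ Real.log (A b) + κ * (a - b) → A a ≤ A b * Real.exp (κ * (a - b)) := by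
    intro a ha b hb h
    have := Real.exp_le_exp.2 h
    rwa [Real.exp_log (hA a ha), Real.exp_add, Real.exp_log (hA b hb)] at this
  have hexp' : ∀ a ∈ radialInterval lam, ∀ b ∈ radialInterval lam,
      Real.log (A b) + κ * (a - b) ≤ Real.log (A a) → A b * Real.exp (κ * (a - b)) ≤ A a := by
    intro a ha b hb h
    have := Real.exp_le_exp.2 h
    rwa [Real.exp_log (hA a ha), Real.exp_add, Real.exp_log (hA b hb)] at this
  have hii : ∀ a ∈ radialInterval lam, ∀ b ∈ radialInterval lam,
      IntervalIntegrable A volume a b := fun a ha b hb =>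
    (hA_cont.mono ((ordConnected_radialInterval lam).uIcc_subset ha hb)).intervalIntegrable
  have h0mem : (0 : ℝ) ∈ radialInterval lam := Icc_subset_radialInterval hR ⟨le_rfl, hR.1⟩
  refine ⟨κ, hκ, fun r hr => ?_⟩
  rw [intervalIntegral.integral_interval_sub_left (hii 0 h0mem r hr) (hii 0 h0mem R hR),
    ← intervalIntegral.integral_const_mul]
  rcases le_total R r with hle | hle
  · have h1 : ∫ t in R..r, κ * A t ≤ ∫ t in R..r, κ * (A r * Real.exp (κ * (t - r))) := by
      refine intervalIntegral.integral_mono_on hle ((hii R hR r hr).const_mul κ)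
        (Continuous.intervalIntegrable (by fun_prop) _ _) fun t ht => ?_
      have htm : t ∈ radialInterval lam := (ordConnected_radialInterval lam).out hR hr ht
      refine mul_le_mul_of_nonneg_left (hexp t htm r hr ?_) hκ
      -- the slope of `log A` on `[t, r]` is at least `κ`
      rcases eq_or_lt_of_le ht.1 with rfl | hRt
      · linarith [hsupp r hr]
      rcases eq_or_lt_of_le ht.2 with rfl | htr
      · simp
      have h2 := hconv.slope_mono_adjacent hR hr hRt htr
      have h3 := hsupp t htm
      rw [div_le_div_iff₀ (sub_pos.2 hRt) (sub_pos.2 htr)] at h2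
      have h4 : κ * (t - R) * (r - t) ≤
          (Real.log (A t) - Real.log (A R)) * (r - t) :=
        mul_le_mul_of_nonneg_right (by linarith) (sub_nonneg.2 htr.le)
      have h5 : (κ * (r - t)) * (t - R) ≤ (Real.log (A r) - Real.log (A t)) * (t - R) := by
        linarith
      have h6 := le_of_mul_le_mul_right h5 (sub_pos.2 hRt)
      linarith
    rw [integral_mul_exp] at h1
    have h2 : A R ≤ A r * Real.exp (κ * (R - r)) := hexp R hR r hr (by linarith [hsupp r hr])
    linarith
  · rw [intervalIntegral.integral_symm]
    have h1 : ∫ t in r..R, κ * (A R * Real.exp (κ * (t - R))) ≤ ∫ t in r..R, κ * A t := by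
      refine intervalIntegral.integral_mono_on hle (Continuous.intervalIntegrable (by fun_prop) _ _)
        ((hii r hr R hR).const_mul κ) fun t ht => ?_
      have htm : t ∈ radialInterval lam := (ordConnected_radialInterval lam).out hr hR ht
      exact mul_le_mul_of_nonneg_left (hexp' t htm R hR (hsupp t htm)) hκ
    rw [integral_mul_exp] at h1
    have h2 : A R * Real.exp (κ * (r - R)) ≤ A r := hexp' r hr R hR (hsupp r hr)
    linarith

section AreaFactor

variable {p : ℕ} {m : Fin p → ℕ} {lam : EReal} {s : Fin p → ℝ → ℝ}

lemma areaFactor_pos (hs : ∀ q, ∀ r ∈ radialInterval lam, 0 < s q r) {r : ℝ}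
    (hr : r ∈ radialInterval lam) : 0 < areaFactor m s r :=
  Finset.prod_pos fun q _ => pow_pos (hs q r hr) _

lemma monotoneOn_areaFactor (hs : ∀ q, ∀ r ∈ radialInterval lam, 0 < s q r)
    (hmono : ∀ q, MonotoneOn (s q) (radialInterval lam)) :
    MonotoneOn (areaFactor m s) (radialInterval lam) := fun a ha _ hb hab =>
  Finset.prod_le_prod (fun q _ => (pow_pos (hs q a ha) _).le) fun q _ =>
    pow_le_pow_left₀ (hs q a ha).le (hmono q ha hb hab) _

lemma convexOn_log_areaFactor (hs : ∀ q, ∀ r ∈ radialInterval lam, 0 < s q r)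
    (hconv : ∀ q, ConvexOn ℝ (radialInterval lam) fun r => Real.log (s q r)) :
    ConvexOn ℝ (radialInterval lam) fun r => Real.log (areaFactor m s r) := by
  have h : ∀ r ∈ radialInterval lam,
      Real.log (areaFactor m s r) = ∑ q, (m q : ℝ) * Real.log (s q r) := fun r hr => by
    rw [areaFactor, Real.log_prod fun q _ => (pow_pos (hs q r hr) _).ne']
    simp only [Real.log_pow]
  refine ⟨convex_radialInterval lam, fun a ha b hb α β hα hβ hαβ => ?_⟩
  simp only
  rw [h a ha, h b hb, h _ (convex_radialInterval lam ha hb hα hβ hαβ), Finset.smul_sum,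
    Finset.smul_sum, ← Finset.sum_add_distrib]
  refine Finset.sum_le_sum fun q _ => ?_
  have := mul_le_mul_of_nonneg_left ((hconv q).2 ha hb hα hβ hαβ) (Nat.cast_nonneg (α := ℝ) (m q))
  simp only [smul_eq_mul] at this ⊢
  linarith

end AreaFactor

/-! ### The isoperimetric inequality -/

section Isoperimetric

variable {p : ℕ} {m : Fin p → ℕ} {lam : EReal} {N : Fin p → Type*}
  [∀ q, TopologicalSpace (N q)] [∀ q, ChartedSpace (EuclideanSpace ℝ (Fin (m q))) (N q)]
  [∀ q, IsManifold (𝓡 (m q)) ∞ (N q)]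
  [∀ q, MeasurableSpace (N q)] [∀ q, BorelSpace (N q)] [∀ q, SecondCountableTopology (N q)]
  [∀ q, CompactSpace (N q)] [∀ q, T2Space (N q)]
  {s : Fin p → ℝ → ℝ} {g : ∀ q, SmoothMetric (m q) (N q)} {a c : ℝ → ℝ}
  {Ω : Set (WarpedSpace lam N)}

lemma intervalIntegrable_of_weightedVolume_ne_top [∀ q, Nonempty (N q)] (hlam : 0 < lam)
    (hs_cont : ∀ q, ContinuousOn (s q) (radialInterval lam))
    (hs : ∀ q, ∀ r ∈ radialInterval lam, 0 ≤ s q r)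
    (hc : Measurable fun r : radialInterval lam => c r)
    (hc_pos : ∀ r ∈ radialInterval lam, 0 < c r)
    {r : ℝ} (hr : r ∈ radialInterval lam)
    (hfin : weightedVolume s g c (warpedBall lam N r) ≠ ⊤) :
    IntervalIntegrable (fun t => c t * areaFactor m s t) volume 0 r := by
  refine intervalIntegrable_radial hs_cont hs hc hc_pos hr fun h => hfin ?_
  rw [weightedVolume_warpedBall_eq_mul hlam hs_cont hs hc, h,
    ENNReal.top_mul (baseMeasure_univ_ne_zero g)]

lemma ballVolume_eq (hlam : 0 < lam)
    (hs_cont : ∀ q, ContinuousOn (s q) (radialInterval lam))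
    (hs : ∀ q, ∀ r ∈ radialInterval lam, 0 ≤ s q r)
    (hA_pos : ∀ r ∈ radialInterval lam, 0 < r → 0 < areaFactor m s r)
    (hc : Measurable fun r : radialInterval lam => c r)
    (hc_pos : ∀ r ∈ radialInterval lam, 0 < c r)
    (hint : ∀ r ∈ radialInterval lam,
      IntervalIntegrable (fun t => c t * areaFactor m s t) volume 0 r)
    {r : ℝ} (hr : r ∈ radialInterval lam) :
    ballVolume lam s g c r = radialVolume m s c r * (baseMeasure g univ).toReal := by
  rw [ballVolume, weightedVolume_warpedBall hlam hs_cont hs hc hc_pos hint hr, ENNReal.toReal_mul,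
    ENNReal.toReal_ofReal (radialVolume_nonneg hA_pos hc_pos hint hr)]

lemma fst_le_of_mem_frontier {R : ℝ} (hR : ∀ x ∈ Ω, (x.1 : ℝ) ≤ R) {y : WarpedSpace lam N}
    (hy : y ∈ frontier Ω) : (y.1 : ℝ) ≤ R :=
  closure_minimal (t := {y : WarpedSpace lam N | (y.1 : ℝ) ≤ R}) hR
    (isClosed_le (by fun_prop) continuous_const) (frontier_subset_closure hy)

lemma weightedArea_warpedBall_ne_top (hs : ∀ q, ∀ r ∈ radialInterval lam, 0 ≤ s q r)
    (ha : ContinuousOn a (radialInterval lam)) {R : ℝ} (hR : R ∈ radialInterval lam) :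
    weightedArea s g a (warpedBall lam N R) ≠ ⊤ :=
  ne_top_of_le_ne_top (ENNReal.mul_ne_top ENNReal.ofReal_ne_top (measure_ne_top _ _))
    (weightedArea_warpedBall_le hs ha hR)

/-- The isoperimetric inequality, from the supporting lines of `ψ ∘ Ṽ⁻¹`. -/
theorem weightedArea_warpedBall_le_weightedArea (hlam : 0 < lam)
    (hs_cont : ∀ q, ContinuousOn (s q) (radialInterval lam))
    (hs : ∀ q, ∀ r ∈ radialInterval lam, 0 ≤ s q r)
    (hA_pos : ∀ r ∈ radialInterval lam, 0 < r → 0 < areaFactor m s r)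
    (hΩ : IsOpen Ω) (hbdd : IsBoundedInM Ω) (hlip : HasLipschitzBoundary m s Ω)
    (hsurj : ∀ θ : (∀ q, N q), ∃ x ∈ frontier Ω, x.2 = θ)
    (hc : Measurable fun r : radialInterval lam => c r)
    (hc_pos : ∀ r ∈ radialInterval lam, 0 < c r)
    (hint : ∀ r ∈ radialInterval lam,
      IntervalIntegrable (fun t => c t * areaFactor m s t) volume 0 r)
    (ha : ContinuousOn a (radialInterval lam)) (ha_pos : ∀ r ∈ radialInterval lam, 0 < a r)
    {R : ℝ} (hR : R ∈ radialInterval lam)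
    (hvol : weightedVolume s g c (warpedBall lam N R) = weightedVolume s g c Ω)
    (hsupp : ∃ k, 0 ≤ k ∧ ∀ r ∈ radialInterval lam, a R * areaFactor m s R +
      k * (radialVolume m s c r - radialVolume m s c R) ≤ a r * areaFactor m s r) :
    weightedArea s g a (warpedBall lam N R) ≤ weightedArea s g a Ω := by
  obtain ⟨u, hu, hfr, hlt, -⟩ := exists_top_function hΩ hbdd hsurj
  exact (weightedArea_warpedBall_le_lintegral_graphMeasure hlam hs_cont hs hA_pos hc hc_pos hint ha
    ha_pos hu hlt hR hvol hsupp).trans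
    (lintegral_graphMeasure_le_weightedArea hlam hs_cont hs hlip hu hfr)

/-- Equality in the isoperimetric inequality forces the area measure of `∂Ω` to be that of a graph
over the base, so that `∂Ω` is a coordinate slice. -/
theorem exists_frontier_eq_slice_of_weightedArea_eq [∀ q, Nonempty (N q)]
    [∀ q, ConnectedSpace (N q)] (hlam : 0 < lam)
    (hs_cont : ∀ q, ContinuousOn (s q) (radialInterval lam))
    (hs : ∀ q, ∀ r ∈ radialInterval lam, 0 ≤ s q r)
    (hA_pos : ∀ r ∈ radialInterval lam, 0 < r → 0 < areaFactor m s r)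
    (hΩ : IsOpen Ω) (hbdd : IsBoundedInM Ω) (hlip : HasLipschitzBoundary m s Ω)
    (hsurj : ∀ θ : (∀ q, N q), ∃ x ∈ frontier Ω, x.2 = θ)
    (hc : Measurable fun r : radialInterval lam => c r)
    (hc_pos : ∀ r ∈ radialInterval lam, 0 < c r)
    (hint : ∀ r ∈ radialInterval lam,
      IntervalIntegrable (fun t => c t * areaFactor m s t) volume 0 r)
    (ha : ContinuousOn a (radialInterval lam)) (ha_pos : ∀ r ∈ radialInterval lam, 0 < a r)
    {R : ℝ} (hR : R ∈ radialInterval lam)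
    (hvol : weightedVolume s g c (warpedBall lam N R) = weightedVolume s g c Ω)
    (hsupp : ∃ k, 0 ≤ k ∧ ∀ r ∈ radialInterval lam, a R * areaFactor m s R +
      k * (radialVolume m s c r - radialVolume m s c R) ≤ a r * areaFactor m s r)
    (hext : (∃ x ∈ frontier Ω, (x.1 : ℝ) = 0) →
      ∀ ε : ℝ, 0 < ε → ∃ x : WarpedSpace lam N, x ∉ closure Ω ∧ (x.1 : ℝ) < ε)
    (heq : weightedArea s g a Ω = weightedArea s g a (warpedBall lam N R)) :
    ∃ r₀ ∈ radialInterval lam, frontier Ω = slice lam N r₀ := by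
  obtain ⟨u, hu, hfr, hlt, htop⟩ := exists_top_function hΩ hbdd hsurj
  obtain ⟨R₀, hR₀, hΩR₀⟩ := hbdd
  have h1 := weightedArea_warpedBall_le_lintegral_graphMeasure hlam hs_cont hs hA_pos hc hc_pos hint
    ha ha_pos hu hlt hR hvol hsupp
  have h2 := lintegral_graphMeasure_le_weightedArea (a := a) (g := g) hlam hs_cont hs hlip hu hfr
  have hβμ : graphMeasure s g u = riemannianMeasure s g (∑ q, m q) (frontier Ω) :=
    Measure.eq_of_le_of_lintegral_le (graphMeasure_le hlam hs_cont hs hlip hu hfr)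
      (measurable_ofReal_fst ha) (fun y => (ENNReal.ofReal_pos.2 (ha_pos _ y.1.2)).ne')
      (fun y => ENNReal.ofReal_ne_top)
      (ne_top_of_le_ne_top (weightedArea_warpedBall_ne_top hs ha hR) (h2.trans heq.le))
      (heq.le.trans h1)
  exact exists_frontier_eq_slice hlam hs_cont hs hA_pos hΩ hlip hu hfr htop hR₀
    (fun θ => fst_le_of_mem_frontier hΩR₀ (hfr θ)) hβμ.ge hext

/-- A set whose boundary is a coordinate slice is a ball, and equal to every ball of its volume. -/
theorem eq_warpedBall_of_weightedVolume_eq [∀ q, Nonempty (N q)] (hlam : 0 < lam)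
    (hs_cont : ∀ q, ContinuousOn (s q) (radialInterval lam))
    (hs : ∀ q, ∀ r ∈ radialInterval lam, 0 ≤ s q r)
    (hA_pos : ∀ r ∈ radialInterval lam, 0 < r → 0 < areaFactor m s r)
    (hΩ : IsOpen Ω) (hbdd : IsBoundedInM Ω)
    (hsurj : ∀ θ : (∀ q, N q), ∃ x ∈ frontier Ω, x.2 = θ)
    (hc : Measurable fun r : radialInterval lam => c r)
    (hc_pos : ∀ r ∈ radialInterval lam, 0 < c r)
    (hint : ∀ r ∈ radialInterval lam,
      IntervalIntegrable (fun t => c t * areaFactor m s t) volume 0 r)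
    {R : ℝ} (hR : R ∈ radialInterval lam)
    (hvol : weightedVolume s g c (warpedBall lam N R) = weightedVolume s g c Ω)
    {r₀ : ℝ} (hr₀ : r₀ ∈ radialInterval lam) (hslice : frontier Ω = slice lam N r₀) :
    Ω = warpedBall lam N R := by
  have hlc : ∀ q, LocallyConnectedSpace (N q) := fun q =>
    ChartedSpace.locallyConnectedSpace (EuclideanSpace ℝ (Fin (m q))) (N q)
  obtain ⟨u, hu, hfr, hlt, -⟩ := exists_top_function hΩ hbdd hsurj
  have hur : ∀ θ, (u θ : ℝ) = r₀ := fun θ => by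
    have h := hfr θ
    rwa [hslice] at h
  have hball : Ω = warpedBall lam N r₀ := eq_warpedBall_of_frontier_eq_slice hΩ hr₀ hslice
    fun y hy => (show (y.1 : ℝ) < u y.2 from hlt y hy).trans_eq (hur _)
  have hRr := (existsUnique_radius (g := g) hlam hs_cont hs hA_pos hc hc_pos hint hbdd).unique
    ⟨hR, hvol⟩ ⟨hr₀, by rw [← hball]⟩
  rw [hRr, ← hball]

end Isoperimetric

theorem mainTheorem2 {p : ℕ} (m : Fin p → ℕ) (lam : EReal) (hlam : 0 < lam)
    (N : Fin p → Type*) [∀ q, TopologicalSpace (N q)] [∀ q, T2Space (N q)]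
    [∀ q, CompactSpace (N q)] [∀ q, Nonempty (N q)]
    [∀ q, MeasurableSpace (N q)] [∀ q, BorelSpace (N q)]
    [∀ q, ChartedSpace (EuclideanSpace ℝ (Fin (m q))) (N q)]
    [∀ q, IsManifold (𝓡 (m q)) ∞ (N q)]
    (g : ∀ q, SmoothMetric (m q) (N q))
    (s : Fin p → ℝ → ℝ)
    (hs_cont : ∀ q, ContinuousOn (s q) (radialInterval lam))
    (hs_nonneg : ∀ q, ∀ r ∈ radialInterval lam, 0 ≤ s q r)
    (hA_pos : ∀ r ∈ radialInterval lam, 0 < r → 0 < areaFactor m s r)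
    (Ω : Set (WarpedSpace lam N)) (hΩ_open : IsOpen Ω) (hΩ_bdd : IsBoundedInM Ω)
    (hΩ_lip : HasLipschitzBoundary m s Ω)
    (hΩ_surj : ∀ θ : (∀ q, N q), ∃ x ∈ frontier Ω, x.2 = θ) :
    -- the weighted isoperimetric inequality
    (∀ a c : ℝ → ℝ,
      -- the weight `c` of the volume
      Measurable (fun r : radialInterval lam => c r) →
      (∀ r ∈ radialInterval lam, 0 < c r) →
      (∀ r ∈ radialInterval lam, weightedVolume s g c (warpedBall lam N r) ≠ ⊤) →
      -- the weight `a` of the area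
      ContinuousOn a (radialInterval lam) →
      (∀ r ∈ radialInterval lam, 0 < a r) →
      -- `ψ = a A` is non-decreasing and `ψ ∘ Ṽ⁻¹` is convex
      MonotoneOn (fun r => a r * areaFactor m s r) (radialInterval lam) →
      ConvexOn ℝ (ballVolume lam s g c '' radialInterval lam)
        ((fun r => a r * areaFactor m s r) ∘
          Function.invFunOn (ballVolume lam s g c) (radialInterval lam)) →
      (∃! R : ℝ, R ∈ radialInterval lam ∧
        weightedVolume s g c (warpedBall lam N R) = weightedVolume s g c Ω) ∧
      ∀ R ∈ radialInterval lam,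
        weightedVolume s g c (warpedBall lam N R) = weightedVolume s g c Ω →
        weightedArea s g a (warpedBall lam N R) ≤ weightedArea s g a Ω ∧
        -- the equality case
        ((∃ r₀ ∈ radialInterval lam, frontier Ω = slice lam N r₀) →
          weightedArea s g a Ω = weightedArea s g a (warpedBall lam N R)) ∧
        ((∀ q, ConnectedSpace (N q)) →
          ((∃ x ∈ frontier Ω, (x.1 : ℝ) = 0) →
            ∀ ε : ℝ, 0 < ε → ∃ x : WarpedSpace lam N, x ∉ closure Ω ∧ (x.1 : ℝ) < ε) →
          weightedArea s g a Ω = weightedArea s g a (warpedBall lam N R) →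
          ∃ r₀ ∈ radialInterval lam, frontier Ω = slice lam N r₀)) ∧
    -- the unweighted case, for non-decreasing log-convex warping functions
    ((∀ q, ∀ r ∈ radialInterval lam, 0 < s q r) →
      (∀ q, MonotoneOn (s q) (radialInterval lam)) →
      (∀ q, ConvexOn ℝ (radialInterval lam) (fun r => Real.log (s q r))) →
      (∃! R : ℝ, R ∈ radialInterval lam ∧
        weightedVolume s g (fun _ => 1) (warpedBall lam N R) =
          weightedVolume s g (fun _ => 1) Ω) ∧
      ∀ R ∈ radialInterval lam,
        weightedVolume s g (fun _ => 1) (warpedBall lam N R) =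
          weightedVolume s g (fun _ => 1) Ω →
        weightedArea s g (fun _ => 1) (warpedBall lam N R) ≤
          weightedArea s g (fun _ => 1) Ω) := by
  have hsc : ∀ q, SecondCountableTopology (N q) := fun q =>
    ChartedSpace.secondCountable_of_sigmaCompact (EuclideanSpace ℝ (Fin (m q))) (N q)
  refine ⟨fun a c hc hc_pos hfin ha ha_pos hψ hconv => ?_, fun hs_pos hs_mono hs_conv => ?_⟩
  · have hint : ∀ r ∈ radialInterval lam,
        IntervalIntegrable (fun t => c t * areaFactor m s t) volume 0 r := fun r hr =>
      intervalIntegrable_of_weightedVolume_ne_top hlam hs_cont hs_nonneg hc hc_pos hr (hfin r hr)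
    have hsupp : ∀ R ∈ radialInterval lam, ∃ k, 0 ≤ k ∧ ∀ r ∈ radialInterval lam,
        a R * areaFactor m s R + k * (radialVolume m s c r - radialVolume m s c R) ≤
          a r * areaFactor m s r := fun R hR =>
      exists_support_of_convexOn_comp_invFunOn
        (ENNReal.toReal_pos (baseMeasure_univ_ne_zero g) (measure_ne_top _ _))
        (fun r hr => ballVolume_eq hlam hs_cont hs_nonneg hA_pos hc hc_pos hint hr)
        (strictMonoOn_radialVolume hA_pos hc_pos hint) hψ hconv hR
    refine ⟨existsUnique_radius hlam hs_cont hs_nonneg hA_pos hc hc_pos hint hΩ_bdd,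
      fun R hR hvol => ⟨?_, ?_, ?_⟩⟩
    · exact weightedArea_warpedBall_le_weightedArea hlam hs_cont hs_nonneg hA_pos hΩ_open hΩ_bdd
        hΩ_lip hΩ_surj hc hc_pos hint ha ha_pos hR hvol (hsupp R hR)
    · rintro ⟨r₀, hr₀, hslice⟩
      rw [← eq_warpedBall_of_weightedVolume_eq hlam hs_cont hs_nonneg hA_pos hΩ_open hΩ_bdd
        hΩ_surj hc hc_pos hint hR hvol hr₀ hslice]
    · intro hconn hext heq
      exact exists_frontier_eq_slice_of_weightedArea_eq hlam hs_cont hs_nonneg hA_pos hΩ_open hΩ_bdd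
        hΩ_lip hΩ_surj hc hc_pos hint ha ha_pos hR hvol (hsupp R hR) hext heq
  · have hA_cont := continuousOn_areaFactor (m := m) hs_cont
    have hint : ∀ r ∈ radialInterval lam,
        IntervalIntegrable (fun t => 1 * areaFactor m s t) volume 0 r := fun r hr => by
      simp only [one_mul]
      refine (hA_cont.mono ?_).intervalIntegrable
      rw [uIcc_of_le hr.1]
      exact Icc_subset_radialInterval hr
    refine ⟨existsUnique_radius hlam hs_cont hs_nonneg hA_pos measurable_const
      (fun _ _ => one_pos) hint hΩ_bdd, fun R hR hvol => ?_⟩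
    refine weightedArea_warpedBall_le_weightedArea hlam hs_cont hs_nonneg hA_pos hΩ_open hΩ_bdd
      hΩ_lip hΩ_surj measurable_const (fun _ _ => one_pos) hint continuousOn_const
      (fun _ _ => one_pos) hR hvol ?_
    simp only [radialVolume, one_mul]
    exact exists_support_of_log_convexOn hA_cont (fun r hr => areaFactor_pos hs_pos hr)
      (monotoneOn_areaFactor hs_pos hs_mono) (convexOn_log_areaFactor hs_pos hs_conv) hR

end
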